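/- **Languages.** A DLE-language $\mathcal L=\mathcal L(\mathcal F,\mathcal G)$ has disjoint families $\mathcal F,\mathcal G$ of connectives; each connective $h$ has an arity $n_h\ge 0$ and an order-type $\varepsilon_h\in\{1,\partial\}^{n_h}$. Its terms are built from countably many proposition variables with $\top,\bot,\wedge,\vee$ and the connectives of $\mathcal F\cup\mathcal G$. The expanded language $\mathcal L^*=\mathcal L(\mathcal F^*,\mathcal G^*)$ has in addition, in $\mathcal F^*$, the two left residuals of $\vee$ (in each coordinate), the residuals $f^\sharp_i$ with $\varepsilon_f(i)=\partial$ and $g^\flat_i$ with $\varepsilon_g(i)=1$; and, in $\mathcal G^*$, the two right residuals of $\wedge$, the $f^\sharp_i$ with $\varepsilon_f(i)=1$ and the $g^\flat_i$ with $\varepsilon_g(i)=\partial$. The order-type of the residual of $h$ in coordinate $i$ keeps $\varepsilon_h(i)$ at $i$; at $j\ne i$ it is $\varepsilon_h(j)$ if $\varepsilon_h(i)=\partial$, and the opposite of $\varepsilon_h(j)$ if $\varepsilon_h(i)=1$. $\mathcal L^*$-inequalities may contain, besides proposition variables, nominals and conominals; one without proposition variables is *pure*. **Perfect DLEs.** A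 perfect DLE is a complete, completely distributive lattice $A$, completely join-generated by its completely join-prime elements, with operations such that each $f\in\mathcal F$ preserves all joins in each coordinate $i$ with $\varepsilon_f(i)=1$ and turns all meets into joins in each coordinate with $\varepsilon_f(i)=\partial$, and each $g\in\mathcal G$ preserves all meets in each coordinate with $\varepsilon_g(i)=1$ and turns all joins into meets in each coordinate with $\varepsilon_g(i)=\partial$. The additional connectives of $\mathcal L^*$ are interpreted by residuation. An inequality is valid on $A$ if it holds under all assignments of elements of $A$ to proposition variables, of completely join-irreducible elements to nominals and of completely meet-irreducible elements to conominals. **Signed trees.** The signed generation tree $+s$ (resp. $-s$) has sign $+$ (resp. $-$) at the root; signs are kept below $\wedge,\vee$ and in coordinates of order-type $1$, and reversed in coordinates of order-type $\partial$. *Skeleton* nodes: $\pm\wedge,\pm\vee,+f,-g$. *PIA* nodes: $\pm\wedge,\pm\vee,+g,-f$. (The constants $\top,\bot$ may be taken as nodes of either kind.) Fix an upper part of the tree (a set of nodes closed under ancestors), its *Skeleton part*; the other nodes form the *PIA part*. A branch is *good* if its nodes in the Skeleton part are Skeleton nodes and its nodes in the PIA part are PIA nodes, apart from variables at the leaf.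 The *SRR* nodes are the nodes $+\vee$, $-\wedge$, and $+g$, $-f$ of arity at least $2$, in the PIA part. For an order-type $\epsilon$ on the variables, a leaf $p$ is *$\epsilon$-critical* if its sign is $+$ when $\epsilon(p)=1$ and $-$ when $\epsilon(p)=\partial$; a branch is critical if its leaf is. A subtree is *$\epsilon^\partial$-uniform* if it has no $\epsilon$-critical leaf. For an irreflexive and transitive relation $\Omega$ on the variables, $\ast s$ ($\ast\in\{+,-\}$) is *$(\Omega,\epsilon)$-inductive* if each branch with an $\epsilon$-critical leaf $p$ is good and, for each SRR node on it, every immediate subtree $\gamma$ of that node not on the branch is $\epsilon^\partial$-uniform and each variable $q$ of $\gamma$ satisfies $q<_\Omega p$. It is *restricted analytic $(\Omega,\epsilon)$-inductive* if, for some choice of the Skeleton part, (1) it is $(\Omega,\epsilon)$-inductive; (2) every branch is good; (3) every subtree rooted in the PIA part that is maximal among the $\epsilon^\partial$-uniform ones rooted there is an immediate subtree of an SRR node of some $\epsilon$-critical branch. **Primitive terms and inequalities.** Left-primitive terms $\psi$ and right-primitive terms $\phi$ are given by $$\psi::=p\mid\top\mid\psi\vee\psi\mid\psi\wedge\psi\mid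 f(\vec\chi),\qquad \phi::=p\mid\bot\mid\phi\wedge\phi\mid\phi\vee\phi\mid g(\vec\chi),$$ where $\chi_i$ in $f(\vec\chi)$ is left-primitive if $\varepsilon_f(i)=1$ and right-primitive if $\varepsilon_f(i)=\partial$, and $\chi_i$ in $g(\vec\chi)$ is right-primitive if $\varepsilon_g(i)=1$ and left-primitive if $\varepsilon_g(i)=\partial$ (and $p$ may be any variable; for $\mathcal L^*$, $f\in\mathcal F^*$, $g\in\mathcal G^*$, and also any nominal or conominal). An inequality $s_1\le s_2$ is *left-primitive* (resp. *right-primitive*) if both sides are left-primitive (resp. right-primitive), each variable (nominal, conominal) occurs at most once in its head $s_1$ (resp. $s_2$), each one occurs in the other side only positively or only negatively, and each one common to both sides occurs in both with the same polarity. **Very restricted analytic inductive inequalities.** $s\le t$ is *very restricted left-analytic* (resp. *right-analytic*) *inductive* if, for some $\Omega$ and $\epsilon$, $+s$ (resp. $-t$) is restricted analytic $(\Omega,\epsilon)$-inductive, $-t$ (resp. $+s$) is $\epsilon^\partial$-uniform, and $t$ is left-primitive (resp. $s$ is right-primitive). **ALBA-reductions.** An ALBA-reduction of an $\mathcal L$-inequality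 $e$ to a finite set $E$ of $\mathcal L^*$-inequalities is a finite sequence of applications of the following rules. 1. *Preprocessing* of $e$ to a finite set of inequalities: distribution of $+f,+\wedge$ over $+\vee$ (over $-\wedge$ in coordinates of order-type $\partial$) and of $-g,-\vee$ over $-\wedge$ (over $+\vee$ in coordinates of order-type $\partial$), when not in the scope of a node $+g$ or $-f$; dually, distribution at $-f$ and $+g$, and at $-\wedge$ and $+\vee$ in the scope of a node $-f$ or $+g$; replacing $f'(\dots,\bot^{\varepsilon(i)},\dots)$ by $\bot$ for $f'\in\mathcal F^*\cup\{\wedge\}$ and $g'(\dots,\top^{\varepsilon(i)},\dots)$ by $\top$ for $g'\in\mathcal G^*\cup\{\vee\}$ (with $\bot^1=\top^\partial=\bot$, $\top^1=\bot^\partial=\top$), and removing $\bot$ from joins and $\top$ from meets; *splitting* of $\alpha\le\beta\wedge\gamma$ and $\alpha\vee\beta\le\gamma$ into two inequalities; removal of tautologies $\bot\le\beta$, $\alpha\le\top$; replacing $p$ by $\bot$ in $\alpha\le\beta$ if $\alpha$ is negative and $\beta$ positive in $p$, and by $\top$ if $\alpha$ is positive and $\beta$ negative in $p$. 2. *First approximation*,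 for each resulting inequality $s\le t$ separately: pass to the quasi-inequality $\mathbf i\le s\ \&\ t\le\mathbf m\Rightarrow\mathbf i\le\mathbf m$ with a nominal $\mathbf i$ and a conominal $\mathbf m$. 3. *Reduction-elimination* on the premises: splitting; residuation rules for the connectives of $\mathcal L$, $\wedge$ and $\vee$; the rules for constants and the removal of tautologies; approximation rules, by which in a premise $\mathbf i\le s$ or $s\le\mathbf m$ an occurrence of a subterm $u$ all of whose proper ancestors in $+s$, resp. $-s$, are nodes $+\wedge,+f,-\vee,-g$ is replaced by a fresh nominal $\mathbf k$ with new premise $\mathbf k\le u$, if its sign is $+$, or by a fresh conominal $\mathbf n$ with new premise $u\le\mathbf n$, if its sign is $-$; the right Ackermann rule, by which premises $\alpha_1\le p,\dots,\alpha_k\le p$ ($k\ge 0$) are deleted and $p$ is replaced by $\alpha_1\vee\dots\vee\alpha_k$ ($\bot$ if $k=0$) in all other premises $\beta\le\gamma$, provided that $p$ does not occur in the $\alpha_i$ or in the conclusion, and each such $\beta$ is positive and $\gamma$ negative in $p$; and the order-dual left Ackermann rule. This stage ends when no proposition variable is left. 4. *Output*: the pure quasi-inequality is turned into a single inequality by deleting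 premises $t\le\mathbf n$ while replacing a conclusion $\alpha\le\mathbf n$ by $\alpha\le t$, and premises $\mathbf j\le s$ while replacing a conclusion $\mathbf j\le\beta$ by $s\le\beta$, provided that $\mathbf n$, resp. $\mathbf j$, does not occur in the result. **Theorem.** For every very restricted left-analytic (resp. right-analytic) inductive $\mathcal L$-inequality $s\le t$ there are an ALBA-reduction and a finite set $E$ of pure left-primitive (resp. right-primitive) $\mathcal L^*$-inequalities such that the reduction transforms $s\le t$ into $E$, and $s\le t$ is equivalent to $E$ on perfect DLEs: for every perfect DLE $A$ for $\mathcal L$, $s\le t$ is valid on $A$ if and only if all inequalities of $E$ are valid on $A$. -/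

import Mathlib

/-! ### Languages of distributive lattice expansions -/

/-- Polarities. They serve both as the entries of an order-type (`pos` is `1`, `neg` is `∂`) and as
the signs `+`, `-` of the nodes of a signed generation tree. -/
inductive Pol where
  | pos : Pol
  | neg : Pol
  deriving DecidableEq

namespace Pol

/-- The opposite polarity. -/
def flip : Pol → Pol
  | pos => neg
  | neg => pos

/-- Sign propagation: the sign of a child with polarity `τ` below a node of sign `σ`. -/
def mul : Pol → Pol → Pol
  | pos, τ => τ
  | neg, τ => τ.flip

end Pol

/-- The parameters `(𝓕, 𝓖)` of a DLE-language: two disjoint families of connectives, each connective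
with an arity and an order-type over its arity. -/
structure DLESig where
  F : Type*
  G : Type*
  arF : F → ℕ
  arG : G → ℕ
  otF : (f : F) → Fin (arF f) → Pol
  otG : (g : G) → Fin (arG g) → Pol

/-- Terms of the DLE-language `L` over the set `V` of variables. -/
inductive Tm (L : DLESig) (V : Type) where
  | var : V → Tm L V
  | top : Tm L V
  | bot : Tm L V
  | and : Tm L V → Tm L V → Tm L V
  | or : Tm L V → Tm L V → Tm L V
  | fc : (f : L.F) → (Fin (L.arF f) → Tm L V) → Tm L V
  | gc : (g : L.G) → (Fin (L.arG g) → Tm L V) → Tm L V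

/-- An inequality `lhs ≤ rhs` between terms. -/
structure Ineq (L : DLESig) (V : Type) where
  lhs : Tm L V
  rhs : Tm L V

/-! ### The expanded language -/

/-- The family `𝓕*`: the connectives of `𝓕`, the two left residuals of `∨`, the residuals `f♯ᵢ` with
`ε_f(i) = ∂` and the residuals `g♭ᵢ` with `ε_g(i) = 1`. -/
inductive FStar (L : DLESig) where
  | base : L.F → FStar L
  /-- `a ⤙ c`, the left residual of `∨` in its first coordinate: `a ≤ b ∨ c` iff `a ⤙ c ≤ b`. -/
  | orRes₁ : FStar L
  /-- `b ⤚ a`, the left residual of `∨` in its second coordinate: `a ≤ b ∨ c` iff `b ⤚ a ≤ c`. -/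
  | orRes₂ : FStar L
  | sharp : (f : L.F) → (i : Fin (L.arF f)) → L.otF f i = Pol.neg → FStar L
  | flat : (g : L.G) → (i : Fin (L.arG g)) → L.otG g i = Pol.pos → FStar L

/-- The family `𝓖*`: the connectives of `𝓖`, the two right residuals of `∧`, the residuals `f♯ᵢ` with
`ε_f(i) = 1` and the residuals `g♭ᵢ` with `ε_g(i) = ∂`. -/
inductive GStar (L : DLESig) where
  | base : L.G → GStar L
  /-- `c ← b`, the right residual of `∧` in its first coordinate: `a ∧ b ≤ c` iff `a ≤ c ← b`. -/
  | andRes₁ : GStar L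
  /-- `a → c`, the right residual of `∧` in its second coordinate: `a ∧ b ≤ c` iff `b ≤ a → c`. -/
  | andRes₂ : GStar L
  | sharp : (f : L.F) → (i : Fin (L.arF f)) → L.otF f i = Pol.pos → GStar L
  | flat : (g : L.G) → (i : Fin (L.arG g)) → L.otG g i = Pol.neg → GStar L

/-- The order-type of the residual in the `i`-th coordinate of a connective of order-type `ε`: the
`i`-th entry is kept, the other ones are kept if `ε i = ∂` and reversed if `ε i = 1`. -/
def resOT {n : ℕ} (ε : Fin n → Pol) (i : Fin n) : Fin n → Pol := fun j =>
  if j = i then ε i else ((ε i).flip).mul (ε j)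

/-- The expanded language `L*`. -/
def DLESig.star (L : DLESig) : DLESig where
  F := FStar L
  G := GStar L
  arF
    | .base f => L.arF f
    | .orRes₁ => 2
    | .orRes₂ => 2
    | .sharp f _ _ => L.arF f
    | .flat g _ _ => L.arG g
  arG
    | .base g => L.arG g
    | .andRes₁ => 2
    | .andRes₂ => 2
    | .sharp f _ _ => L.arF f
    | .flat g _ _ => L.arG g
  otF
    | .base f => L.otF f
    | .orRes₁ => ![Pol.pos, Pol.neg]
    | .orRes₂ => ![Pol.neg, Pol.pos]
    | .sharp f i _ => resOT (L.otF f) i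
    | .flat g i _ => resOT (L.otG g) i
  otG
    | .base g => L.otG g
    | .andRes₁ => ![Pol.pos, Pol.neg]
    | .andRes₂ => ![Pol.neg, Pol.pos]
    | .sharp f i _ => resOT (L.otF f) i
    | .flat g i _ => resOT (L.otG g) i

/-- The variables of the language `L*⁺`: nominals, conominals and proposition variables. -/
inductive Var where
  | nom : ℕ → Var
  | conom : ℕ → Var
  | prop : ℕ → Var
  deriving DecidableEq

/-- Terms of `L*⁺`. -/
abbrev STm (L : DLESig) := Tm L.star Var

/-- Inequalities of `L*⁺`. -/
abbrev SIneq (L : DLESig) := Ineq L.star Var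

namespace Tm

variable {L : DLESig} {V W : Type}

/-- Uniform substitution of terms for variables. -/
def subst (θ : V → Tm L W) : Tm L V → Tm L W
  | var v => θ v
  | top => top
  | bot => bot
  | and s t => and (subst θ s) (subst θ t)
  | or s t => or (subst θ s) (subst θ t)
  | fc f a => fc f (fun i => subst θ (a i))
  | gc g a => gc g (fun i => subst θ (a i))

/-- `s[α/p]`. -/
def substVar [DecidableEq V] (s : Tm L V) (p : V) (α : Tm L V) : Tm L V :=
  s.subst (Function.update var p α)

/-- The `L`-term `s`, read as a term of `L*⁺`. -/
def emb : Tm L ℕ → STm L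
  | var p => var (Var.prop p)
  | top => top
  | bot => bot
  | and s t => and (emb s) (emb t)
  | or s t => or (emb s) (emb t)
  | fc f a => fc (L := L.star) (FStar.base f) (fun i => emb (a i))
  | gc g a => gc (L := L.star) (GStar.base g) (fun i => emb (a i))

/-- `OccSign s σ v τ`: in the generation tree of `s` signed `σ` at the root, some leaf is labelled
with the variable `v` and has sign `τ`. -/
def OccSign : Tm L V → Pol → V → Pol → Prop
  | var w, σ, v, τ => w = v ∧ σ = τ
  | top, _, _, _ => False
  | bot, _, _, _ => False
  | and s t, σ, v, τ => OccSign s σ v τ ∨ OccSign t σ v τ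
  | or s t, σ, v, τ => OccSign s σ v τ ∨ OccSign t σ v τ
  | fc f a, σ, v, τ => ∃ i, OccSign (a i) (σ.mul (L.otF f i)) v τ
  | gc g a, σ, v, τ => ∃ i, OccSign (a i) (σ.mul (L.otG g i)) v τ

/-- The variable `v` occurs in `s`. -/
def Occurs (s : Tm L V) (v : V) : Prop := ∃ τ, s.OccSign Pol.pos v τ

/-- The term `s` is positive in the variable `v`. -/
def PositiveIn (s : Tm L V) (v : V) : Prop := ∀ τ, s.OccSign Pol.pos v τ → τ = Pol.pos

/-- The term `s` is negative in the variable `v`. -/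
def NegativeIn (s : Tm L V) (v : V) : Prop := ∀ τ, s.OccSign Pol.pos v τ → τ = Pol.neg

/-- The signed tree `σ s` is `ε`-uniform: each variable occurs in it only with the sign given by `ε`. -/
def Uniform (ε : V → Pol) (σ : Pol) (s : Tm L V) : Prop := ∀ v τ, s.OccSign σ v τ → τ = ε v

/-- The number of occurrences of the variable `v` in a term. -/
def occ [DecidableEq V] (v : V) : Tm L V → ℕ
  | var w => if w = v then 1 else 0
  | top => 0
  | bot => 0
  | and s t => occ v s + occ v t
  | or s t => occ v s + occ v t
  | fc _ a => ∑ i, occ v (a i)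
  | gc _ a => ∑ i, occ v (a i)

/-- Each variable occurs at most once. -/
def Scattered [DecidableEq V] (s : Tm L V) : Prop := ∀ v, occ v s ≤ 1

/-! ### Primitive terms -/

/-- `IsPrim pos s`: the term `s` is left-primitive. `IsPrim neg s`: it is right-primitive. -/
def IsPrim : Pol → Tm L V → Prop
  | _, var _ => True
  | σ, top => σ = Pol.pos
  | σ, bot => σ = Pol.neg
  | σ, and s t => IsPrim σ s ∧ IsPrim σ t
  | σ, or s t => IsPrim σ s ∧ IsPrim σ t
  | σ, fc f a => σ = Pol.pos ∧ ∀ i, IsPrim (L.otF f i) (a i)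
  | σ, gc g a => σ = Pol.neg ∧ ∀ i, IsPrim (L.otG g i).flip (a i)

/-- Left-primitive terms. -/
abbrev LeftPrimitive (s : Tm L V) : Prop := IsPrim Pol.pos s

/-- Right-primitive terms. -/
abbrev RightPrimitive (s : Tm L V) : Prop := IsPrim Pol.neg s

/-! ### Signed generation trees -/

/-- The `k`-th immediate subterm (counted from `0`) with the polarity of its coordinate. -/
def child : Tm L V → ℕ → Option (Pol × Tm L V)
  | and s _, 0 => some (Pol.pos, s)
  | and _ t, 1 => some (Pol.pos, t)
  | or s _, 0 => some (Pol.pos, s)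
  | or _ t, 1 => some (Pol.pos, t)
  | fc f a, k => if h : k < L.arF f then some (L.otF f ⟨k, h⟩, a ⟨k, h⟩) else none
  | gc g a, k => if h : k < L.arG g then some (L.otG g ⟨k, h⟩, a ⟨k, h⟩) else none
  | _, _ => none

/-- `nodeAt σ s π`: the signed subtree at the position `π` of the tree `σ s`, a position being the
list of child indices on the path from the root. -/
def nodeAt : Pol → Tm L V → List ℕ → Option (Pol × Tm L V)
  | σ, s, [] => some (σ, s)
  | σ, s, k :: π =>
    match s.child k with
    | some (τ, u) => nodeAt (σ.mul τ) u π
    | none => none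

/-- Skeleton nodes: `±∧`, `±∨`, `+f`, `-g`; also the constants `⊤`, `⊥`, which may be taken as nodes
of either kind. -/
def IsSkeleton : Pol → Tm L V → Prop
  | _, var _ => False
  | σ, fc _ _ => σ = Pol.pos
  | σ, gc _ _ => σ = Pol.neg
  | _, _ => True

/-- PIA nodes: `±∧`, `±∨`, `+g`, `-f`; also the constants `⊤`, `⊥`. -/
def IsPIA : Pol → Tm L V → Prop
  | _, var _ => False
  | σ, fc _ _ => σ = Pol.neg
  | σ, gc _ _ => σ = Pol.pos
  | _, _ => True

/-- SRR nodes: `+∨`, `-∧`, and `+g`, `-f` of arity at least two. -/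
def IsSRR : Pol → Tm L V → Prop
  | σ, or _ _ => σ = Pol.pos
  | σ, and _ _ => σ = Pol.neg
  | σ, gc g _ => σ = Pol.pos ∧ 2 ≤ L.arG g
  | σ, fc f _ => σ = Pol.neg ∧ 2 ≤ L.arF f
  | _, _ => False

def IsVar : Tm L V → Prop
  | var _ => True
  | _ => False

/-- The position `π` of `σ s` is a leaf. -/
def IsLeaf (σ : Pol) (s : Tm L V) (π : List ℕ) : Prop :=
  ∃ τ u, nodeAt σ s π = some (τ, u) ∧ ∀ k, u.child k = none

/-- The position `π` of `σ s` is an `ε`-critical leaf, labelled with the variable `p`. -/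
def IsCritical (ε : V → Pol) (σ : Pol) (s : Tm L V) (π : List ℕ) (p : V) : Prop :=
  nodeAt σ s π = some (ε p, var p)

/-- Let `S` be the set of the positions that are taken as the Skeleton part of the tree (a set closed
under prefixes). The branch from the leaf at `π` is good if it is the concatenation of a lower path,
outside `S`, of PIA nodes (apart from variables) and an upper path, inside `S`, of Skeleton nodes. -/
def GoodBranch (S : Set (List ℕ)) (σ : Pol) (s : Tm L V) (π : List ℕ) : Prop :=
  ∀ ρ, ρ <+: π → ∀ τ u, nodeAt σ s ρ = some (τ, u) →
    (ρ ∈ S → IsSkeleton τ u) ∧ (ρ ∉ S → IsVar u ∨ IsPIA τ u)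

/-- The signed generation tree `σ s`, with Skeleton part `S`, is `(Ω, ε)`-inductive. The nodes `±∧`,
`±∨` occur among both the Skeleton and the PIA nodes; such a node counts as an SRR node only if it
lies in the PIA part of the tree. -/
structure Inductive (S : Set (List ℕ)) (Ω : V → V → Prop) (ε : V → Pol) (σ : Pol) (s : Tm L V) :
    Prop where
  good : ∀ π p, IsCritical ε σ s π p → GoodBranch S σ s π
  srr : ∀ π p, IsCritical ε σ s π p →
    ∀ ρ, ρ <+: π → ρ ∉ S → ∀ τ u, nodeAt σ s ρ = some (τ, u) → IsSRR τ u →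
      ∀ h, ¬ (ρ ++ [h] <+: π) → ∀ τ' γ, nodeAt σ s (ρ ++ [h]) = some (τ', γ) →
        Uniform (fun v => (ε v).flip) τ' γ ∧ ∀ q, γ.Occurs q → Ω q p

/-- The signed generation tree `σ s` is restricted analytic `(Ω, ε)`-inductive. The field `maxUnif`
is the requirement on the maximal `ε^∂`-uniform subtrees; variable-free pieces of the Skeleton part
are not subject to it. -/
def RestrictedAnalytic (Ω : V → V → Prop) (ε : V → Pol) (σ : Pol) (s : Tm L V) : Prop :=
  ∃ S : Set (List ℕ), (∀ π ∈ S, ∀ ρ, ρ <+: π → ρ ∈ S) ∧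
    Inductive S Ω ε σ s ∧
    (∀ π, IsLeaf σ s π → GoodBranch S σ s π) ∧
    (∀ π τ γ, π ∉ S → nodeAt σ s π = some (τ, γ) → Uniform (fun v => (ε v).flip) τ γ →
      (∀ ρ, ρ <+: π → ρ ≠ π → ρ ∉ S → ∀ τ' u, nodeAt σ s ρ = some (τ', u) →
        ¬ Uniform (fun v => (ε v).flip) τ' u) →
      ∃ ρ h τ' u, π = ρ ++ [h] ∧ ρ ∉ S ∧ nodeAt σ s ρ = some (τ', u) ∧ IsSRR τ' u ∧
        ∃ π' p, IsCritical ε σ s π' p ∧ ρ <+: π')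

end Tm

namespace Ineq

variable {L : DLESig} {V : Type}

/-- The variable `v` occurs in the inequality. -/
def Occurs (e : Ineq L V) (v : V) : Prop := e.lhs.Occurs v ∨ e.rhs.Occurs v

/-- Both sides have the same order-type relative to the variables they have in common. -/
def SameOrderType (e : Ineq L V) : Prop :=
  ∀ v τ τ', e.lhs.OccSign Pol.pos v τ → e.rhs.OccSign Pol.pos v τ' → τ = τ'

/-- Left-primitive inequalities; the left-hand side is the head. -/
structure LeftPrimitive [DecidableEq V] (e : Ineq L V) : Prop where
  lhs_prim : e.lhs.LeftPrimitive
  rhs_prim : e.rhs.LeftPrimitive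
  scattered : e.lhs.Scattered
  same : e.SameOrderType
  uniform : ∃ ε : V → Pol, Tm.Uniform ε Pol.pos e.rhs

/-- Right-primitive inequalities; the right-hand side is the head. -/
structure RightPrimitive [DecidableEq V] (e : Ineq L V) : Prop where
  lhs_prim : e.lhs.RightPrimitive
  rhs_prim : e.rhs.RightPrimitive
  scattered : e.rhs.Scattered
  same : e.SameOrderType
  uniform : ∃ ε : V → Pol, Tm.Uniform ε Pol.pos e.lhs

/-- Very restricted left-analytic `(Ω, ε)`-inductive inequalities. -/
structure VeryRestrictedLeft (Ω : V → V → Prop) (ε : V → Pol) (e : Ineq L V) : Prop where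
  head : Tm.RestrictedAnalytic Ω ε Pol.pos e.lhs
  tail_uniform : Tm.Uniform (fun v => (ε v).flip) Pol.neg e.rhs
  tail_prim : e.rhs.LeftPrimitive

/-- Very restricted right-analytic `(Ω, ε)`-inductive inequalities. -/
structure VeryRestrictedRight (Ω : V → V → Prop) (ε : V → Pol) (e : Ineq L V) : Prop where
  head : Tm.RestrictedAnalytic Ω ε Pol.neg e.rhs
  tail_uniform : Tm.Uniform (fun v => (ε v).flip) Pol.pos e.lhs
  tail_prim : e.lhs.RightPrimitive

/-- Very restricted left-analytic inductive inequalities. -/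
def IsVeryRestrictedLeft (e : Ineq L V) : Prop :=
  ∃ (Ω : V → V → Prop) (ε : V → Pol), (∀ p, ¬ Ω p p) ∧ (∀ p q r, Ω p q → Ω q r → Ω p r) ∧
    e.VeryRestrictedLeft Ω ε

/-- Very restricted right-analytic inductive inequalities. -/
def IsVeryRestrictedRight (e : Ineq L V) : Prop :=
  ∃ (Ω : V → V → Prop) (ε : V → Pol), (∀ p, ¬ Ω p p) ∧ (∀ p q r, Ω p q → Ω q r → Ω p r) ∧
    e.VeryRestrictedRight Ω ε

/-- The inequality `e`, read in `L*⁺`. -/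
def emb (e : Ineq L ℕ) : SIneq L := ⟨e.lhs.emb, e.rhs.emb⟩

/-- An inequality of `L*⁺` is pure if no proposition variable occurs in it. -/
def Pure (e : SIneq L) : Prop := ∀ p, ¬ e.Occurs (Var.prop p)

/-- `e[α/p]`. -/
def substVar [DecidableEq V] (p : V) (α : Tm L V) (e : Ineq L V) : Ineq L V :=
  ⟨Tm.substVar e.lhs p α, Tm.substVar e.rhs p α⟩

end Ineq

/-! ### Perfect algebras -/

/-- Operations on `A` interpreting the connectives of `L`. -/
structure Interp (L : DLESig) (A : Type*) where
  fop : (f : L.F) → (Fin (L.arF f) → A) → A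
  gop : (g : L.G) → (Fin (L.arG g) → A) → A

/-- The value of a term under an assignment. -/
def Tm.eval {L : DLESig} {V : Type} {A : Type*} [Lattice A] [BoundedOrder A] (I : Interp L A)
    (v : V → A) : Tm L V → A
  | .var x => v x
  | .top => ⊤
  | .bot => ⊥
  | .and s t => s.eval I v ⊓ t.eval I v
  | .or s t => s.eval I v ⊔ t.eval I v
  | .fc f a => I.fop f (fun i => (a i).eval I v)
  | .gc g a => I.gop g (fun i => (a i).eval I v)

section Perfect

variable {A : Type*}

/-- Completely join-prime elements. -/
def CJoinPrime [CompleteLattice A] (j : A) : Prop := ∀ S : Set A, j ≤ sSup S → ∃ x ∈ S, j ≤ x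

/-- Completely join-irreducible elements. -/
def CJoinIrred [CompleteLattice A] (j : A) : Prop := ∀ S : Set A, j = sSup S → j ∈ S

/-- Completely meet-irreducible elements. -/
def CMeetIrred [CompleteLattice A] (m : A) : Prop := ∀ S : Set A, m = sInf S → m ∈ S

/-- The algebra `(A, I)` is a perfect (normal) DLE: `A` is complete, completely distributive and
completely join-generated by its completely join-prime elements, and in each coordinate each
`f`-operation preserves all joins or turns all meets into joins, and each `g`-operation preserves all
meets or turns all joins into meets, as its order-type says. -/
structure IsPerfectDLE {L : DLESig} [CompletelyDistribLattice A] (I : Interp L A) : Prop where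
  join_gen : ∀ a : A, a = sSup {j | CJoinPrime j ∧ j ≤ a}
  f_pos : ∀ f i, L.otF f i = Pol.pos → ∀ (a : Fin (L.arF f) → A) (S : Set A),
    I.fop f (Function.update a i (sSup S)) = sSup ((fun x => I.fop f (Function.update a i x)) '' S)
  f_neg : ∀ f i, L.otF f i = Pol.neg → ∀ (a : Fin (L.arF f) → A) (S : Set A),
    I.fop f (Function.update a i (sInf S)) = sSup ((fun x => I.fop f (Function.update a i x)) '' S)
  g_pos : ∀ g i, L.otG g i = Pol.pos → ∀ (a : Fin (L.arG g) → A) (S : Set A),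
    I.gop g (Function.update a i (sInf S)) = sInf ((fun x => I.gop g (Function.update a i x)) '' S)
  g_neg : ∀ g i, L.otG g i = Pol.neg → ∀ (a : Fin (L.arG g) → A) (S : Set A),
    I.gop g (Function.update a i (sSup S)) = sInf ((fun x => I.gop g (Function.update a i x)) '' S)

/-- The interpretation of the connectives of `L*` on a perfect `L`-algebra, the additional ones by
residuation: `f♯ᵢ(a₁, …, b, …, aₙ)` (with `b` in the `i`-th place) is the largest (if `ε_f(i) = 1`) or
least (if `ε_f(i) = ∂`) `x` with `f(a₁, …, x, …, aₙ) ≤ b`; dually for `g♭ᵢ`. -/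
def Interp.star {L : DLESig} [CompletelyDistribLattice A] (I : Interp L A) : Interp L.star A where
  fop
    | .base f => fun a => I.fop f a
    | .orRes₁ => fun a : Fin 2 → A => a 0 \ a 1
    | .orRes₂ => fun a : Fin 2 → A => a 1 \ a 0
    | .sharp f i _ => fun a : Fin (L.arF f) → A => sInf {x | I.fop f (Function.update a i x) ≤ a i}
    | .flat g i _ => fun a : Fin (L.arG g) → A => sInf {x | a i ≤ I.gop g (Function.update a i x)}
  gop
    | .base g => fun a => I.gop g a
    | .andRes₁ => fun a : Fin 2 → A => a 1 ⇨ a 0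
    | .andRes₂ => fun a : Fin 2 → A => a 0 ⇨ a 1
    | .sharp f i _ => fun a : Fin (L.arF f) → A => sSup {x | I.fop f (Function.update a i x) ≤ a i}
    | .flat g i _ => fun a : Fin (L.arG g) → A => sSup {x | a i ≤ I.gop g (Function.update a i x)}

/-- Validity of an `L`-inequality in an `L`-algebra. -/
def Ineq.Valid {L : DLESig} [Lattice A] [BoundedOrder A] (I : Interp L A) (e : Ineq L ℕ) : Prop :=
  ∀ v : ℕ → A, e.lhs.eval I v ≤ e.rhs.eval I v

/-- Validity of an `L*⁺`-inequality in a perfect `L`-algebra: nominals range over the completely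
join-irreducible and conominals over the completely meet-irreducible elements. -/
def Ineq.SValid {L : DLESig} [CompletelyDistribLattice A] (I : Interp L A) (e : SIneq L) : Prop :=
  ∀ v : Var → A, (∀ n, CJoinIrred (v (Var.nom n))) → (∀ n, CMeetIrred (v (Var.conom n))) →
    e.lhs.eval I.star v ≤ e.rhs.eval I.star v

end Perfect

/-! ### ALBA -/

namespace ALBA

variable {L : DLESig}

/-- `⊥^δ`, that is `⊥` if `δ = 1` and `⊤` if `δ = ∂`. -/
def botPow : Pol → STm L
  | .pos => .bot
  | .neg => .top

/-- `⊤^δ`, that is `⊤` if `δ = 1` and `⊥` if `δ = ∂`. -/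
def topPow : Pol → STm L
  | .pos => .top
  | .neg => .bot

/-- Distribution rules at a node of sign `σ`. The flag tells whether the node is in the scope of a PIA
node that is not a Skeleton node. -/
inductive Dist : Bool → Pol → STm L → STm L → Prop
  | and_skel (s t u) : Dist false .pos (.and s (.or t u)) (.or (.and s t) (.and s u))
  | and_skel' (s t u) : Dist false .pos (.and (.or t u) s) (.or (.and t s) (.and u s))
  | or_skel (s t u) : Dist false .neg (.or s (.and t u)) (.and (.or s t) (.or s u))
  | or_skel' (s t u) : Dist false .neg (.or (.and t u) s) (.and (.or t s) (.or u s))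
  | and_pia (s t u) : Dist true .neg (.and s (.or t u)) (.or (.and s t) (.and s u))
  | and_pia' (s t u) : Dist true .neg (.and (.or t u) s) (.or (.and t s) (.and u s))
  | or_pia (s t u) : Dist true .pos (.or s (.and t u)) (.and (.or s t) (.or s u))
  | or_pia' (s t u) : Dist true .pos (.or (.and t u) s) (.and (.or t s) (.or u s))
  | f_pos (b σ) (f : L.star.F) (a) (i : Fin (L.star.arF f)) (t u) :
      (σ = .pos → b = false) → L.star.otF f i = .pos → a i = .or t u →
      Dist b σ (.fc f a) (.or (.fc f (Function.update a i t)) (.fc f (Function.update a i u)))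
  | f_neg (b σ) (f : L.star.F) (a) (i : Fin (L.star.arF f)) (t u) :
      (σ = .pos → b = false) → L.star.otF f i = .neg → a i = .and t u →
      Dist b σ (.fc f a) (.or (.fc f (Function.update a i t)) (.fc f (Function.update a i u)))
  | g_pos (b σ) (g : L.star.G) (a) (i : Fin (L.star.arG g)) (t u) :
      (σ = .neg → b = false) → L.star.otG g i = .pos → a i = .and t u →
      Dist b σ (.gc g a) (.and (.gc g (Function.update a i t)) (.gc g (Function.update a i u)))
  | g_neg (b σ) (g : L.star.G) (a) (i : Fin (L.star.arG g)) (t u) :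
      (σ = .neg → b = false) → L.star.otG g i = .neg → a i = .or t u →
      Dist b σ (.gc g a) (.and (.gc g (Function.update a i t)) (.gc g (Function.update a i u)))

/-- Rules for the lattice constants: `f'(…, ⊥^{ε(i)}, …)` is replaced by `⊥` for `f' ∈ 𝓕* ∪ {∧}` and
`g'(…, ⊤^{ε(i)}, …)` by `⊤` for `g' ∈ 𝓖* ∪ {∨}`; the member `⊥` of a disjunction and the member `⊤` of
a conjunction are removed. -/
inductive Const : Bool → Pol → STm L → STm L → Prop
  | f (b σ) (f : L.star.F) (a) (i : Fin (L.star.arF f)) :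
      a i = botPow (L.star.otF f i) → Const b σ (.fc f a) .bot
  | g (b σ) (g : L.star.G) (a) (i : Fin (L.star.arG g)) :
      a i = topPow (L.star.otG g i) → Const b σ (.gc g a) .top
  | and_bot (b σ s) : Const b σ (.and s .bot) .bot
  | bot_and (b σ s) : Const b σ (.and .bot s) .bot
  | or_top (b σ s) : Const b σ (.or s .top) .top
  | top_or (b σ s) : Const b σ (.or .top s) .top
  | and_top (b σ s) : Const b σ (.and s .top) s
  | top_and (b σ s) : Const b σ (.and .top s) s
  | or_bot (b σ s) : Const b σ (.or s .bot) s
  | bot_or (b σ s) : Const b σ (.or .bot s) s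

/-- One application of the rewriting rules `R` at some node of the signed tree `σ s`; the flag is set
as soon as the path from the root goes through a node `-f` or `+g`. -/
inductive AtNode (R : Bool → Pol → STm L → STm L → Prop) : Bool → Pol → STm L → STm L → Prop
  | here {b σ s s'} : R b σ s s' → AtNode R b σ s s'
  | and_left {b σ s s'} (t) : AtNode R b σ s s' → AtNode R b σ (.and s t) (.and s' t)
  | and_right {b σ s s'} (t) : AtNode R b σ s s' → AtNode R b σ (.and t s) (.and t s')
  | or_left {b σ s s'} (t) : AtNode R b σ s s' → AtNode R b σ (.or s t) (.or s' t)
  | or_right {b σ s s'} (t) : AtNode R b σ s s' → AtNode R b σ (.or t s) (.or t s')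
  | fc {b σ s'} (f : L.star.F) (a) (i : Fin (L.star.arF f)) :
      AtNode R (b || decide (σ = .neg)) (σ.mul (L.star.otF f i)) (a i) s' →
      AtNode R b σ (.fc f a) (.fc f (Function.update a i s'))
  | gc {b σ s'} (g : L.star.G) (a) (i : Fin (L.star.arG g)) :
      AtNode R (b || decide (σ = .pos)) (σ.mul (L.star.otG g i)) (a i) s' →
      AtNode R b σ (.gc g a) (.gc g (Function.update a i s'))

/-- Splitting rules. -/
inductive Split : SIneq L → List (SIneq L) → Prop
  | meet (α β γ) : Split ⟨α, .and β γ⟩ [⟨α, β⟩, ⟨α, γ⟩]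
  | join (α β γ) : Split ⟨.or α β, γ⟩ [⟨α, γ⟩, ⟨β, γ⟩]

/-- Removal of tautological inequalities. -/
inductive Tautology : SIneq L → Prop
  | bot (t) : Tautology ⟨.bot, t⟩
  | top (s) : Tautology ⟨s, .top⟩

/-- Preprocessing rules: an inequality is replaced by finitely many inequalities. -/
inductive PreStep : SIneq L → List (SIneq L) → Prop
  | dist_left {s s' t} : AtNode Dist false .pos s s' → PreStep ⟨s, t⟩ [⟨s', t⟩]
  | dist_right {s t t'} : AtNode Dist false .neg t t' → PreStep ⟨s, t⟩ [⟨s, t'⟩]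
  | const_left {s s' t} : AtNode Const false .pos s s' → PreStep ⟨s, t⟩ [⟨s', t⟩]
  | const_right {s t t'} : AtNode Const false .neg t t' → PreStep ⟨s, t⟩ [⟨s, t'⟩]
  | split {e es} : Split e es → PreStep e es
  | taut {e} : Tautology e → PreStep e []
  | elim_bot {α β : STm L} (p : ℕ) : α.NegativeIn (.prop p) → β.PositiveIn (.prop p) →
      PreStep ⟨α, β⟩ [⟨Tm.substVar α (.prop p) .bot, Tm.substVar β (.prop p) .bot⟩]
  | elim_top {α β : STm L} (p : ℕ) : β.PositiveIn (.prop p) → α.NegativeIn (.prop p) →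
      PreStep ⟨β, α⟩ [⟨Tm.substVar β (.prop p) .top, Tm.substVar α (.prop p) .top⟩]

/-- Preprocessing: finitely many applications of the preprocessing rules to a finite collection of
inequalities. -/
def Preprocess : List (SIneq L) → List (SIneq L) → Prop :=
  Relation.ReflTransGen fun E E' => ∃ Γ Δ e es, PreStep e es ∧ E = Γ ++ e :: Δ ∧ E' = Γ ++ es ++ Δ

/-- Quasi-inequalities of `L*⁺`. -/
structure QIneq (L : DLESig) where
  prem : List (SIneq L)
  concl : SIneq L

/-- The variable `x` occurs in the quasi-inequality `q`. -/
def QIneq.Occurs (q : QIneq L) (x : Var) : Prop := (∃ e ∈ q.prem, e.Occurs x) ∨ q.concl.Occurs x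

/-- No proposition variable occurs in `q`. -/
def QIneq.Pure (q : QIneq L) : Prop := ∀ p, ¬ q.Occurs (.prop p)

/-- First approximation of `s ≤ t`: the initial system `{𝐢 ≤ s, t ≤ 𝐦}`, that is the quasi-inequality
`𝐢 ≤ s & t ≤ 𝐦 ⇒ 𝐢 ≤ 𝐦`. -/
def firstApprox (e : SIneq L) (i m : ℕ) : QIneq L :=
  ⟨[⟨.var (.nom i), e.lhs⟩, ⟨e.rhs, .var (.conom m)⟩], ⟨.var (.nom i), .var (.conom m)⟩⟩

/-- Residuation rules for the connectives of `L` and for the lattice connectives. -/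
inductive Resid : SIneq L → SIneq L → Prop
  | f_pos (f : L.F) (i : Fin (L.arF f)) (h : L.otF f i = .pos) (a : Fin (L.arF f) → STm L)
      (χ : STm L) :
      Resid ⟨.fc (L := L.star) (FStar.base f) a, χ⟩
        ⟨a i, .gc (L := L.star) (GStar.sharp f i h) (Function.update a i χ)⟩
  | f_neg (f : L.F) (i : Fin (L.arF f)) (h : L.otF f i = .neg) (a : Fin (L.arF f) → STm L)
      (χ : STm L) :
      Resid ⟨.fc (L := L.star) (FStar.base f) a, χ⟩
        ⟨.fc (L := L.star) (FStar.sharp f i h) (Function.update a i χ), a i⟩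
  | g_pos (g : L.G) (i : Fin (L.arG g)) (h : L.otG g i = .pos) (a : Fin (L.arG g) → STm L)
      (χ : STm L) :
      Resid ⟨χ, .gc (L := L.star) (GStar.base g) a⟩
        ⟨.fc (L := L.star) (FStar.flat g i h) (Function.update a i χ), a i⟩
  | g_neg (g : L.G) (i : Fin (L.arG g)) (h : L.otG g i = .neg) (a : Fin (L.arG g) → STm L)
      (χ : STm L) :
      Resid ⟨χ, .gc (L := L.star) (GStar.base g) a⟩
        ⟨a i, .gc (L := L.star) (GStar.flat g i h) (Function.update a i χ)⟩
  | and₁ (α β χ : STm L) :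
      Resid ⟨.and α β, χ⟩ ⟨α, .gc (L := L.star) GStar.andRes₁ (![χ, β] : Fin 2 → STm L)⟩
  | and₂ (α β χ : STm L) :
      Resid ⟨.and α β, χ⟩ ⟨β, .gc (L := L.star) GStar.andRes₂ (![α, χ] : Fin 2 → STm L)⟩
  | or₁ (α β χ : STm L) :
      Resid ⟨χ, .or α β⟩ ⟨.fc (L := L.star) FStar.orRes₁ (![χ, β] : Fin 2 → STm L), α⟩
  | or₂ (α β χ : STm L) :
      Resid ⟨χ, .or α β⟩ ⟨.fc (L := L.star) FStar.orRes₂ (![α, χ] : Fin 2 → STm L), β⟩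

/-- `ApproxAt x σ s τ u s'`: in the tree `σ s`, the subterm `u` occurs with sign `τ` at a node all of
whose proper ancestors are nodes `+∧`, `+f`, `-∨` or `-g`, and `s'` arises from `s` by replacing this
occurrence of `u` by `x`. -/
inductive ApproxAt (x : STm L) : Pol → STm L → Pol → STm L → STm L → Prop
  | here (σ u) : ApproxAt x σ u σ u x
  | and_left {s τ u s'} (t) : ApproxAt x .pos s τ u s' → ApproxAt x .pos (.and s t) τ u (.and s' t)
  | and_right {s τ u s'} (t) : ApproxAt x .pos s τ u s' → ApproxAt x .pos (.and t s) τ u (.and t s')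
  | or_left {s τ u s'} (t) : ApproxAt x .neg s τ u s' → ApproxAt x .neg (.or s t) τ u (.or s' t)
  | or_right {s τ u s'} (t) : ApproxAt x .neg s τ u s' → ApproxAt x .neg (.or t s) τ u (.or t s')
  | fc {τ u s'} (f : L.star.F) (a) (i : Fin (L.star.arF f)) :
      ApproxAt x (L.star.otF f i) (a i) τ u s' →
      ApproxAt x .pos (.fc f a) τ u (.fc f (Function.update a i s'))
  | gc {τ u s'} (g : L.star.G) (a) (i : Fin (L.star.arG g)) :
      ApproxAt x (L.star.otG g i).flip (a i) τ u s' →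
      ApproxAt x .neg (.gc g a) τ u (.gc g (Function.update a i s'))

/-- Finite joins. -/
def bigOr : List (STm L) → STm L
  | [] => .bot
  | [α] => α
  | α :: β :: l => .or α (bigOr (β :: l))

/-- Finite meets. -/
def bigAnd : List (STm L) → STm L
  | [] => .top
  | [α] => α
  | α :: β :: l => .and α (bigAnd (β :: l))

/-- Rules of the reduction-elimination cycle. The premises of a quasi-inequality form a set, so their
order and repetitions are immaterial (`rearrange`). -/
inductive RedStep : QIneq L → QIneq L → Prop
  | rearrange {Γ Δ : List (SIneq L)} {c} : (∀ e, e ∈ Γ ↔ e ∈ Δ) → RedStep ⟨Γ, c⟩ ⟨Δ, c⟩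
  | split {e es Γ c} : Split e es → RedStep ⟨e :: Γ, c⟩ ⟨es ++ Γ, c⟩
  | resid {e e' Γ c} : Resid e e' → RedStep ⟨e :: Γ, c⟩ ⟨e' :: Γ, c⟩
  | const_left {b σ s s' t Γ c} : AtNode Const b σ s s' → RedStep ⟨⟨s, t⟩ :: Γ, c⟩ ⟨⟨s', t⟩ :: Γ, c⟩
  | const_right {b σ s t t' Γ c} : AtNode Const b σ t t' → RedStep ⟨⟨s, t⟩ :: Γ, c⟩ ⟨⟨s, t'⟩ :: Γ, c⟩
  | taut {e Γ c} : Tautology e → RedStep ⟨e :: Γ, c⟩ ⟨Γ, c⟩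
  /-- Approximation rules; the new nominal or conominal is fresh. -/
  | approx_left_nom {i k : ℕ} {s u s' : STm L} {Γ c} :
      ¬ QIneq.Occurs ⟨⟨.var (.nom i), s⟩ :: Γ, c⟩ (.nom k) →
      ApproxAt (.var (.nom k)) .pos s .pos u s' →
      RedStep ⟨⟨.var (.nom i), s⟩ :: Γ, c⟩ ⟨⟨.var (.nom i), s'⟩ :: ⟨.var (.nom k), u⟩ :: Γ, c⟩
  | approx_left_conom {i k : ℕ} {s u s' : STm L} {Γ c} :
      ¬ QIneq.Occurs ⟨⟨.var (.nom i), s⟩ :: Γ, c⟩ (.conom k) →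
      ApproxAt (.var (.conom k)) .pos s .neg u s' →
      RedStep ⟨⟨.var (.nom i), s⟩ :: Γ, c⟩ ⟨⟨.var (.nom i), s'⟩ :: ⟨u, .var (.conom k)⟩ :: Γ, c⟩
  | approx_right_nom {m k : ℕ} {s u s' : STm L} {Γ c} :
      ¬ QIneq.Occurs ⟨⟨s, .var (.conom m)⟩ :: Γ, c⟩ (.nom k) →
      ApproxAt (.var (.nom k)) .neg s .pos u s' →
      RedStep ⟨⟨s, .var (.conom m)⟩ :: Γ, c⟩ ⟨⟨s', .var (.conom m)⟩ :: ⟨.var (.nom k), u⟩ :: Γ, c⟩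
  | approx_right_conom {m k : ℕ} {s u s' : STm L} {Γ c} :
      ¬ QIneq.Occurs ⟨⟨s, .var (.conom m)⟩ :: Γ, c⟩ (.conom k) →
      ApproxAt (.var (.conom k)) .neg s .neg u s' →
      RedStep ⟨⟨s, .var (.conom m)⟩ :: Γ, c⟩ ⟨⟨s', .var (.conom m)⟩ :: ⟨u, .var (.conom k)⟩ :: Γ, c⟩
  /-- Right Ackermann rule. -/
  | ackermann_right {p : ℕ} {αs : List (STm L)} {Γ : List (SIneq L)} {c : SIneq L} :
      (∀ α ∈ αs, ¬ α.Occurs (.prop p)) →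
      (∀ e ∈ Γ, e.lhs.PositiveIn (.prop p) ∧ e.rhs.NegativeIn (.prop p)) →
      ¬ c.Occurs (.prop p) →
      RedStep ⟨αs.map (fun α => ⟨α, .var (.prop p)⟩) ++ Γ, c⟩
        ⟨Γ.map (Ineq.substVar (.prop p) (bigOr αs)), c⟩
  /-- Left Ackermann rule. -/
  | ackermann_left {p : ℕ} {αs : List (STm L)} {Γ : List (SIneq L)} {c : SIneq L} :
      (∀ α ∈ αs, ¬ α.Occurs (.prop p)) →
      (∀ e ∈ Γ, e.lhs.NegativeIn (.prop p) ∧ e.rhs.PositiveIn (.prop p)) →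
      ¬ c.Occurs (.prop p) →
      RedStep ⟨αs.map (fun α => ⟨.var (.prop p), α⟩) ++ Γ, c⟩
        ⟨Γ.map (Ineq.substVar (.prop p) (bigAnd αs)), c⟩

/-- Output: a pure quasi-inequality is rewritten as a pure inequality by reversing the first
approximation, `∀𝐧 [t ≤ 𝐧 ⇒ α ≤ 𝐧]` becoming `α ≤ t` and `∀𝐣 [𝐣 ≤ s ⇒ 𝐣 ≤ β]` becoming `s ≤ β`. -/
inductive OutStep : QIneq L → QIneq L → Prop
  | rearrange {Γ Δ : List (SIneq L)} {c} : (∀ e, e ∈ Γ ↔ e ∈ Δ) → OutStep ⟨Γ, c⟩ ⟨Δ, c⟩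
  | conom {n : ℕ} {t α : STm L} {Γ} : ¬ QIneq.Occurs ⟨Γ, ⟨α, t⟩⟩ (.conom n) →
      OutStep ⟨⟨t, .var (.conom n)⟩ :: Γ, ⟨α, .var (.conom n)⟩⟩ ⟨Γ, ⟨α, t⟩⟩
  | nom {j : ℕ} {s β : STm L} {Γ} : ¬ QIneq.Occurs ⟨Γ, ⟨s, β⟩⟩ (.nom j) →
      OutStep ⟨⟨.var (.nom j), s⟩ :: Γ, ⟨.var (.nom j), β⟩⟩ ⟨Γ, ⟨s, β⟩⟩

/-- `ReducesTo e e'`: first approximation of `e`, followed by a run of the reduction-elimination cycle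
that ends in a quasi-inequality without proposition variables, which is output as the inequality
`e'`. -/
def ReducesTo (e e' : SIneq L) : Prop :=
  ∃ (i m : ℕ) (q : QIneq L), Relation.ReflTransGen RedStep (firstApprox e i m) q ∧ q.Pure ∧
    Relation.ReflTransGen OutStep q ⟨[], e'⟩

/-- `Reduction e E`: some ALBA-reduction transforms the `L`-inequality `e` into the finite collection
`E` of `L*⁺`-inequalities. First `e` is preprocessed, then each of the resulting inequalities is
reduced separately. -/
def Reduction (e : Ineq L ℕ) (E : List (SIneq L)) : Prop :=
  ∃ P : List (SIneq L), Preprocess [e.emb] P ∧ List.Forall₂ ReducesTo P E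

end ALBA

/-! ### Polarities -/

namespace Pol

/-! The two halves of the theorem are order-dual, so everything is proved once for a sign `σ`:
`pineq σ` and `Pol.le σ` read an inequality forwards for `pos` and backwards for `neg`. The sketch
is for `pos`, with head `s` and tail `t`.

Syntax. The head is a Skeleton over critical PIA trees (`Tm.RestrictedAnalytic.skel`). The condition
on maximal uniform subtrees forbids a uniform tree at the top of the PIA part and below a
non-uniform non-SRR node, while goodness of all branches makes the side trees at SRR nodes primitive
of the opposite sign. Distribution moves `+∨` and `-∧` to the root, where splitting removes them,
and leaves inequalities with definite heads (`Skel.exists_preprocess`). For a definite head `d`,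
first approximation gives `𝐢 ≤ d` and `t ≤ 𝐦`. Each critical PIA subtree of `d` is replaced by its
own fresh nominal or conominal, which turns `d` into a pure, scattered, primitive term `h`
(`Definite.approximable`). The new premises `𝐤 ≤ γ` or `γ ≤ 𝐧` are unwound down to the critical
leaves, by splitting at `+∧`, `-∨` and residuation elsewhere (`CritPIA.solvable`). The outcome is a
list of bounds, `α ≤ p` if `ε p = pos` and `p ≤ α` if `ε p = neg`.

The invariant is `Regular`: each `α`, like `t`, is primitive up to stray constants, contains
nominals positively and conominals negatively, and contains each variable `q` with sign `ε q`;
moreover the variables of a bound of `p` are `Ω`-below `p`. This is precisely what the Ackermann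
rules require, and substituting regular bounds preserves it, so the variables can be eliminated in
any order (`exists_eliminate`). There remain `𝐢 ≤ h` and `t' ≤ 𝐦`. Once the constants are cleared
(`exists_const_normal`), the output is `h ≤ t'`, or `h ≤ 𝐦` if `t'` has collapsed to `⊥`
(`exists_output`).

Semantics. Equivalence on perfect DLEs is soundness of the single rules. All connectives of the
expanded language, residuals included, are normal (`Interp.Normal.star`); this yields distribution,
the rules for constants and monotonicity, and monotonicity yields the Ackermann rules
(`valid_ackermann`). Join-generation by primes makes irreducible elements prime and generating on
both sides (`JoinGenerated.irred_prime`, `JoinGenerated.eq_sup_irred`); this yields approximation,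
first approximation and output (`valid_approx`, `valid_output`). -/

@[simp] theorem pos_mul (σ : Pol) : pos.mul σ = σ := rfl

@[simp] theorem neg_mul (σ : Pol) : neg.mul σ = σ.flip := rfl

@[simp] theorem mul_pos (σ : Pol) : σ.mul pos = σ := by cases σ <;> rfl

@[simp] theorem mul_neg (σ : Pol) : σ.mul neg = σ.flip := by cases σ <;> rfl

@[simp] theorem flip_flip (σ : Pol) : σ.flip.flip = σ := by cases σ <;> rfl

@[simp] theorem flip_pos : pos.flip = neg := rfl

@[simp] theorem flip_neg : neg.flip = pos := rfl

theorem mul_flip (σ τ : Pol) : σ.mul τ.flip = (σ.mul τ).flip := by cases σ <;> cases τ <;> rfl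

theorem flip_mul (σ τ : Pol) : σ.flip.mul τ = (σ.mul τ).flip := by cases σ <;> cases τ <;> rfl

theorem mul_assoc (σ τ ρ : Pol) : (σ.mul τ).mul ρ = σ.mul (τ.mul ρ) := by
  cases σ <;> cases τ <;> cases ρ <;> rfl

theorem mul_left_cancel {σ τ ρ : Pol} (h : σ.mul τ = σ.mul ρ) : τ = ρ := by
  cases σ <;> cases τ <;> cases ρ <;> simp_all [mul, flip]

@[simp] theorem mul_self_mul (σ τ : Pol) : σ.mul (σ.mul τ) = τ := by
  cases σ <;> cases τ <;> rfl

theorem flip_injective {σ τ : Pol} (h : σ.flip = τ.flip) : σ = τ := by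
  cases σ <;> cases τ <;> simp_all [flip]

theorem ne_flip (σ : Pol) : σ ≠ σ.flip := by cases σ <;> simp

theorem eq_of_ne_flip {σ τ : Pol} (h : σ ≠ τ.flip) : σ = τ := by
  cases σ <;> cases τ <;> simp_all

end Pol

/-- Sign bookkeeping behind residuation. When the residual in coordinate `i` carries the sign `σ · ε
i` of the argument being isolated, its `i`-th place carries the sign `σ` of the old node, and every
other argument has its sign reversed by changing sides of the inequality. -/
theorem mul_resOT {n : ℕ} (ε : Fin n → Pol) (σ : Pol) (i j : Fin n) :
    (σ.mul (ε i)).mul (resOT ε i j) = if j = i then σ else (σ.mul (ε j)).flip := by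
  unfold resOT
  split_ifs with h
  · cases σ <;> cases ε i <;> rfl
  · cases σ <;> cases ε i <;> cases ε j <;> rfl

/-! ### Occurrences of variables -/

namespace Tm

variable {L : DLESig} {V W : Type}

/-- Signs propagate multiplicatively, so a change of the root sign changes all leaf signs alike.
This allows passing between a tree signed `σ` and the default sign `pos`. -/
theorem occSign_mul (ρ : Pol) (s : Tm L V) (σ : Pol) (v : V) (τ : Pol) :
    s.OccSign (ρ.mul σ) v (ρ.mul τ) ↔ s.OccSign σ v τ := by
  induction s generalizing σ with
  | var w =>
    refine and_congr_right fun _ => ⟨Pol.mul_left_cancel, fun h => by rw [h]⟩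
  | top => rfl
  | bot => rfl
  | and s t hs ht => exact or_congr (hs σ) (ht σ)
  | or s t hs ht => exact or_congr (hs σ) (ht σ)
  | fc f a ih =>
    refine exists_congr fun i => ?_
    rw [Pol.mul_assoc]; exact ih i _
  | gc f a ih =>
    refine exists_congr fun i => ?_
    rw [Pol.mul_assoc]; exact ih i _

theorem occSign_iff_pos (s : Tm L V) (σ : Pol) (v : V) (τ : Pol) :
    s.OccSign σ v τ ↔ s.OccSign .pos v (σ.mul τ) := by
  rw [← occSign_mul σ s σ v τ]
  cases σ <;> rfl

theorem occSign_flip (s : Tm L V) (σ : Pol) (v : V) (τ : Pol) :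
    s.OccSign σ.flip v τ ↔ s.OccSign σ v τ.flip := by
  rw [occSign_iff_pos s σ.flip, occSign_iff_pos s σ, Pol.flip_mul, Pol.mul_flip]

theorem occurs_iff (s : Tm L V) (σ : Pol) (v : V) : s.Occurs v ↔ ∃ τ, s.OccSign σ v τ := by
  constructor
  · rintro ⟨τ, h⟩
    exact ⟨σ.mul τ, by rwa [occSign_iff_pos, Pol.mul_self_mul]⟩
  · rintro ⟨τ, h⟩
    exact ⟨_, (occSign_iff_pos s σ v τ).1 h⟩

theorem OccSign.occurs {s : Tm L V} {σ τ : Pol} {v : V} (h : s.OccSign σ v τ) : s.Occurs v :=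
  (occurs_iff s σ v).2 ⟨τ, h⟩

theorem occSign_subst (θ : V → Tm L W) (s : Tm L V) (σ : Pol) (x : W) (τ : Pol) :
    (s.subst θ).OccSign σ x τ ↔ ∃ w ρ, s.OccSign σ w ρ ∧ (θ w).OccSign ρ x τ := by
  induction s generalizing σ with
  | var w => simp [subst, OccSign]
  | top => simp [subst, OccSign]
  | bot => simp [subst, OccSign]
  | and s t hs ht =>
    simp only [subst, OccSign, hs, ht, or_and_right, exists_or]
  | or s t hs ht =>
    simp only [subst, OccSign, hs, ht, or_and_right, exists_or]
  | fc f a ih =>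
    simp only [subst, OccSign, ih]
    constructor
    · rintro ⟨i, w, ρ, h⟩; exact ⟨w, ρ, ⟨i, h.1⟩, h.2⟩
    · rintro ⟨w, ρ, ⟨i, h⟩, h'⟩; exact ⟨i, w, ρ, h, h'⟩
  | gc f a ih =>
    simp only [subst, OccSign, ih]
    constructor
    · rintro ⟨i, w, ρ, h⟩; exact ⟨w, ρ, ⟨i, h.1⟩, h.2⟩
    · rintro ⟨w, ρ, ⟨i, h⟩, h'⟩; exact ⟨i, w, ρ, h, h'⟩

theorem OccSign.of_substVar [DecidableEq V] {s : Tm L V} {p : V} {α : Tm L V} {σ τ : Pol} {v : V}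
    (h : (s.substVar p α).OccSign σ v τ) :
    (v ≠ p ∧ s.OccSign σ v τ) ∨ ∃ ρ, s.OccSign σ p ρ ∧ α.OccSign ρ v τ := by
  obtain ⟨w, ρ, h1, h2⟩ := (occSign_subst _ s σ v τ).1 h
  by_cases hw : w = p
  · subst hw
    rw [Function.update_self] at h2
    exact .inr ⟨ρ, h1, h2⟩
  · rw [Function.update_of_ne hw] at h2
    obtain ⟨rfl, rfl⟩ := h2
    exact .inl ⟨hw, h1⟩

theorem subst_var (s : Tm L V) : s.subst var = s := by
  induction s with
  | var w => rfl
  | top => rfl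
  | bot => rfl
  | and s t hs ht => simp [subst, hs, ht]
  | or s t hs ht => simp [subst, hs, ht]
  | fc f a ih => simp [subst, ih]
  | gc f a ih => simp [subst, ih]

theorem subst_congr {θ θ' : V → Tm L W} {s : Tm L V} (h : ∀ v, s.Occurs v → θ v = θ' v) :
    s.subst θ = s.subst θ' := by
  simp only [occurs_iff _ .pos] at h
  suffices ∀ σ, (∀ v, (∃ τ, s.OccSign σ v τ) → θ v = θ' v) → s.subst θ = s.subst θ' from
    this _ h
  clear h
  induction s with
  | var w => exact fun σ h => h w ⟨σ, rfl, rfl⟩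
  | top => exact fun _ _ => rfl
  | bot => exact fun _ _ => rfl
  | and s t hs ht =>
    intro σ h
    simp only [subst]
    rw [hs σ fun v ⟨τ, hv⟩ => h v ⟨τ, .inl hv⟩, ht σ fun v ⟨τ, hv⟩ => h v ⟨τ, .inr hv⟩]
  | or s t hs ht =>
    intro σ h
    simp only [subst]
    rw [hs σ fun v ⟨τ, hv⟩ => h v ⟨τ, .inl hv⟩, ht σ fun v ⟨τ, hv⟩ => h v ⟨τ, .inr hv⟩]
  | fc f a ih =>
    intro σ h
    simp only [subst]
    congr 1
    funext i
    exact ih i _ fun v ⟨τ, hv⟩ => h v ⟨τ, i, hv⟩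
  | gc f a ih =>
    intro σ h
    simp only [subst]
    congr 1
    funext i
    exact ih i _ fun v ⟨τ, hv⟩ => h v ⟨τ, i, hv⟩

theorem substVar_of_not_occurs [DecidableEq V] {s : Tm L V} {p : V} (α : Tm L V)
    (h : ¬ s.Occurs p) : s.substVar p α = s := by
  conv_rhs => rw [← subst_var s]
  refine subst_congr fun v hv => Function.update_of_ne (by rintro rfl; exact h hv) _ _

theorem occurs_of_occ_pos [DecidableEq V] {s : Tm L V} {v : V} (h : 0 < occ v s) :
    s.Occurs v := by
  suffices ∀ σ, ∃ τ, s.OccSign σ v τ from (occurs_iff s .pos v).2 (this _)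
  induction s with
  | var w =>
    intro σ
    refine ⟨σ, ?_, rfl⟩
    by_contra hw
    simp [occ, hw] at h
  | top => simp [occ] at h
  | bot => simp [occ] at h
  | and s t hs ht =>
    intro σ
    rcases Nat.add_pos_iff_pos_or_pos.1 h with h | h
    · exact (hs h σ).imp fun _ => .inl
    · exact (ht h σ).imp fun _ => .inr
  | or s t hs ht =>
    intro σ
    rcases Nat.add_pos_iff_pos_or_pos.1 h with h | h
    · exact (hs h σ).imp fun _ => .inl
    · exact (ht h σ).imp fun _ => .inr
  | fc f a ih =>
    intro σ
    obtain ⟨i, -, hi⟩ := Finset.sum_pos_iff.1 h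
    obtain ⟨τ, hτ⟩ := ih i hi (σ.mul (L.otF f i))
    exact ⟨τ, i, hτ⟩
  | gc f a ih =>
    intro σ
    obtain ⟨i, -, hi⟩ := Finset.sum_pos_iff.1 h
    obtain ⟨τ, hτ⟩ := ih i hi (σ.mul (L.otG f i))
    exact ⟨τ, i, hτ⟩

theorem occSign_emb (s : Tm L ℕ) (σ : Pol) (x : Var) (τ : Pol) :
    s.emb.OccSign σ x τ ↔ ∃ p, x = .prop p ∧ s.OccSign σ p τ := by
  induction s generalizing σ with
  | var q =>
    simp only [emb, OccSign]
    constructor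
    · rintro ⟨rfl, rfl⟩; exact ⟨q, rfl, rfl, rfl⟩
    · rintro ⟨p, rfl, rfl, rfl⟩; exact ⟨rfl, rfl⟩
  | top => simp [emb, OccSign]
  | bot => simp [emb, OccSign]
  | and s t hs ht => simp only [emb, OccSign, hs, ht, and_or_left, exists_or]
  | or s t hs ht => simp only [emb, OccSign, hs, ht, and_or_left, exists_or]
  | fc f a ih =>
    constructor
    · rintro ⟨i, h⟩
      obtain ⟨p, rfl, h'⟩ := (ih i _).1 h
      exact ⟨p, rfl, i, h'⟩
    · rintro ⟨p, rfl, i, h⟩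
      exact ⟨i, (ih i _).2 ⟨p, rfl, h⟩⟩
  | gc f a ih =>
    constructor
    · rintro ⟨i, h⟩
      obtain ⟨p, rfl, h'⟩ := (ih i _).1 h
      exact ⟨p, rfl, i, h'⟩
    · rintro ⟨p, rfl, i, h⟩
      exact ⟨i, (ih i _).2 ⟨p, rfl, h⟩⟩

theorem exists_prop_of_occurs_emb {s : Tm L ℕ} {x : Var} (h : s.emb.Occurs x) :
    ∃ p, x = .prop p ∧ s.Occurs p := by
  obtain ⟨τ, h⟩ := h
  obtain ⟨p, rfl, h'⟩ := (occSign_emb s _ x τ).1 h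
  exact ⟨p, rfl, τ, h'⟩

/-! ### Primitive terms with unrestricted constants -/

/-- `PrePrim σ s`: the term `s` is built like a left-primitive (if `σ = pos`) or right-primitive
(if `σ = neg`) term, except that the constants may occur anywhere. -/
def PrePrim : Pol → Tm L V → Prop
  | _, var _ => True
  | _, top => True
  | _, bot => True
  | σ, and s t => PrePrim σ s ∧ PrePrim σ t
  | σ, or s t => PrePrim σ s ∧ PrePrim σ t
  | σ, fc f a => σ = Pol.pos ∧ ∀ i, PrePrim (σ.mul (L.otF f i)) (a i)
  | σ, gc g a => σ = Pol.neg ∧ ∀ i, PrePrim (σ.mul (L.otG g i)) (a i)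

theorem IsPrim.prePrim {σ : Pol} {s : Tm L V} (h : IsPrim σ s) : PrePrim σ s := by
  induction s generalizing σ with
  | var w => trivial
  | top => trivial
  | bot => trivial
  | and s t hs ht => exact ⟨hs h.1, ht h.2⟩
  | or s t hs ht => exact ⟨hs h.1, ht h.2⟩
  | fc f a ih => obtain ⟨rfl, h⟩ := h; exact ⟨rfl, fun i => ih i (h i)⟩
  | gc f a ih => obtain ⟨rfl, h⟩ := h; exact ⟨rfl, fun i => ih i (h i)⟩

theorem PrePrim.emb {σ : Pol} {s : Tm L ℕ} (h : PrePrim σ s) : PrePrim σ s.emb := by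
  induction s generalizing σ with
  | var w => trivial
  | top => trivial
  | bot => trivial
  | and s t hs ht => exact ⟨hs h.1, ht h.2⟩
  | or s t hs ht => exact ⟨hs h.1, ht h.2⟩
  | fc f a ih => exact ⟨h.1, fun i => ih i (h.2 i)⟩
  | gc f a ih => exact ⟨h.1, fun i => ih i (h.2 i)⟩

/-- The grammar of primitive terms follows the signs of the tree. If all leaves `p` have the same
sign `δ`, a term that is primitive for `δ` fits at each of them; this is why uniformity of signs
must be carried along. -/
theorem PrePrim.substVar [DecidableEq V] {σ δ : Pol} {s : Tm L V} {p : V} {α : Tm L V}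
    (h : PrePrim σ s) (hp : ∀ τ, s.OccSign σ p τ → τ = δ) (hα : PrePrim δ α) :
    PrePrim σ (s.substVar p α) := by
  induction s generalizing σ with
  | var w =>
    by_cases hw : w = p
    · subst hw
      have : σ = δ := hp σ ⟨rfl, rfl⟩
      subst this
      simpa [Tm.substVar, subst] using hα
    · simp [Tm.substVar, subst, Function.update_of_ne hw, PrePrim]
  | top => trivial
  | bot => trivial
  | and s t hs ht => exact ⟨hs h.1 fun τ h => hp τ (.inl h), ht h.2 fun τ h => hp τ (.inr h)⟩
  | or s t hs ht => exact ⟨hs h.1 fun τ h => hp τ (.inl h), ht h.2 fun τ h => hp τ (.inr h)⟩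
  | fc f a ih => exact ⟨h.1, fun i => ih i (h.2 i) fun τ h => hp τ ⟨i, h⟩⟩
  | gc f a ih => exact ⟨h.1, fun i => ih i (h.2 i) fun τ h => hp τ ⟨i, h⟩⟩

end Tm

/-! ### Rewriting several arguments of a connective -/

open Relation in
/-- If rewriting any one coordinate of a family lifts to a relation `Q`, then so does rewriting all
coordinates. -/
theorem reflTransGen_of_forall_update {n : ℕ} {T X : Type*} {R : Fin n → T → T → Prop}
    {Q : X → X → Prop} {F : (Fin n → T) → X}
    (hF : ∀ a i x, ReflTransGen (R i) (a i) x → ReflTransGen Q (F a) (F (Function.update a i x)))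
    {a a' : Fin n → T} (h : ∀ i, ReflTransGen (R i) (a i) (a' i)) :
    ReflTransGen Q (F a) (F a') := by
  -- The coordinates are rewritten one at a time; `S` is the set of those already done.
  have key : ∀ S : Finset (Fin n),
      ReflTransGen Q (F a) (F fun i => if i ∈ S then a' i else a i) := by
    intro S
    induction S using Finset.induction_on with
    | empty => simpa using ReflTransGen.refl
    | insert i S hi ih =>
      refine ih.trans ?_
      convert hF (fun i => if i ∈ S then a' i else a i) i (a' i) (by simpa [hi] using h i) using 2
      funext j
      by_cases hj : j = i
      · subst hj; simp
      · simp [hj]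
  simpa using key Finset.univ

namespace ALBA

open Relation

variable {L : DLESig}

section Congruence

variable {R : Bool → Pol → STm L → STm L → Prop} {b : Bool} {σ : Pol}

theorem AtNode.rtg_and {s s' t t' : STm L} (hs : ReflTransGen (AtNode R b σ) s s')
    (ht : ReflTransGen (AtNode R b σ) t t') :
    ReflTransGen (AtNode R b σ) (.and s t) (.and s' t') :=
  (hs.lift (Tm.and · t) fun _ _ h => .and_left t h).trans
    (ht.lift (Tm.and s' ·) fun _ _ h => .and_right s' h)

theorem AtNode.rtg_or {s s' t t' : STm L} (hs : ReflTransGen (AtNode R b σ) s s')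
    (ht : ReflTransGen (AtNode R b σ) t t') :
    ReflTransGen (AtNode R b σ) (.or s t) (.or s' t') :=
  (hs.lift (Tm.or · t) fun _ _ h => .or_left t h).trans
    (ht.lift (Tm.or s' ·) fun _ _ h => .or_right s' h)

theorem AtNode.rtg_fc (f : L.star.F) {a a' : Fin (L.star.arF f) → STm L}
    (h : ∀ i, ReflTransGen (AtNode R (b || decide (σ = .neg)) (σ.mul (L.star.otF f i)))
      (a i) (a' i)) :
    ReflTransGen (AtNode R b σ) (.fc f a) (.fc f a') := by
  refine reflTransGen_of_forall_update (fun a i x hx => ?_) h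
  have := hx.lift (p := AtNode R b σ) (fun y => Tm.fc f (Function.update a i y)) fun y z hyz => by
    simpa using AtNode.fc (b := b) (σ := σ) f (Function.update a i y) i (s' := z) (by simpa using hyz)
  simpa [Function.onFun] using this

theorem AtNode.rtg_gc (g : L.star.G) {a a' : Fin (L.star.arG g) → STm L}
    (h : ∀ i, ReflTransGen (AtNode R (b || decide (σ = .pos)) (σ.mul (L.star.otG g i)))
      (a i) (a' i)) :
    ReflTransGen (AtNode R b σ) (.gc g a) (.gc g a') := by
  refine reflTransGen_of_forall_update (fun a i x hx => ?_) h
  have := hx.lift (p := AtNode R b σ) (fun y => Tm.gc g (Function.update a i y)) fun y z hyz => by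
    simpa using AtNode.gc (b := b) (σ := σ) g (Function.update a i y) i (s' := z) (by simpa using hyz)
  simpa [Function.onFun] using this

end Congruence

/-! ### Elimination of constants -/

theorem botPow_flip (σ : Pol) : botPow (L := L) σ.flip = topPow σ := by cases σ <;> rfl

theorem isPrim_topPow (σ : Pol) : Tm.IsPrim σ (topPow (L := L) σ) := by cases σ <;> rfl

theorem not_occSign_topPow {σ τ ρ : Pol} {v : Var} : ¬ (topPow (L := L) σ).OccSign τ v ρ := by
  cases σ <;> exact id

/-- A conjunction of two terms, each of them `⊥^σ` or primitive, can be rewritten so. -/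
theorem exists_const_and {σ : Pol} {s t : STm L}
    (hs : s = botPow σ ∨ Tm.IsPrim σ s) (ht : t = botPow σ ∨ Tm.IsPrim σ t) :
    ∃ u : STm L, (∀ b τ, ReflTransGen (AtNode Const b τ) (.and s t) u) ∧
      (u = botPow σ ∨ Tm.IsPrim σ u) ∧
      ∀ ρ v τ, u.OccSign ρ v τ → s.OccSign ρ v τ ∨ t.OccSign ρ v τ := by
  rcases hs with rfl | hs
  · cases σ
    · exact ⟨.bot, fun b τ => .single (.here (.bot_and b τ t)), .inl rfl, fun _ _ _ h => h.elim⟩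
    · exact ⟨t, fun b τ => .single (.here (.top_and b τ t)), ht, fun _ _ _ => .inr⟩
  · rcases ht with rfl | ht
    · cases σ
      · exact ⟨.bot, fun b τ => .single (.here (.and_bot b τ s)), .inl rfl, fun _ _ _ h => h.elim⟩
      · exact ⟨s, fun b τ => .single (.here (.and_top b τ s)), .inr hs, fun _ _ _ => .inl⟩
    · exact ⟨.and s t, fun _ _ => .refl, .inr ⟨hs, ht⟩, fun _ _ _ h => h⟩

/-- A disjunction of two terms, each of them `⊥^σ` or primitive, can be rewritten so. -/
theorem exists_const_or {σ : Pol} {s t : STm L}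
    (hs : s = botPow σ ∨ Tm.IsPrim σ s) (ht : t = botPow σ ∨ Tm.IsPrim σ t) :
    ∃ u : STm L, (∀ b τ, ReflTransGen (AtNode Const b τ) (.or s t) u) ∧
      (u = botPow σ ∨ Tm.IsPrim σ u) ∧
      ∀ ρ v τ, u.OccSign ρ v τ → s.OccSign ρ v τ ∨ t.OccSign ρ v τ := by
  rcases hs with rfl | hs
  · cases σ
    · exact ⟨t, fun b τ => .single (.here (.bot_or b τ t)), ht, fun _ _ _ => .inr⟩
    · exact ⟨.top, fun b τ => .single (.here (.top_or b τ t)), .inl rfl, fun _ _ _ h => h.elim⟩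
  · rcases ht with rfl | ht
    · cases σ
      · exact ⟨s, fun b τ => .single (.here (.or_bot b τ s)), .inr hs, fun _ _ _ => .inl⟩
      · exact ⟨.top, fun b τ => .single (.here (.or_top b τ s)), .inl rfl, fun _ _ _ h => h.elim⟩
    · exact ⟨.or s t, fun _ _ => .refl, .inr ⟨hs, ht⟩, fun _ _ _ h => h⟩

/-- A term that is primitive up to constants can be rewritten, by the rules for constants, into
`⊥^σ` or into a primitive term. -/
theorem exists_const_normal {σ : Pol} {s : STm L} (h : Tm.PrePrim σ s) :
    ∃ s' : STm L, (∀ b τ, ReflTransGen (AtNode Const b τ) s s') ∧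
      (s' = botPow σ ∨ Tm.IsPrim σ s') ∧ ∀ ρ v τ, s'.OccSign ρ v τ → s.OccSign ρ v τ := by
  induction s generalizing σ with
  | var w => exact ⟨.var w, fun _ _ => .refl, .inr trivial, fun _ _ _ h => h⟩
  | top =>
    refine ⟨.top, fun _ _ => .refl, ?_, fun _ _ _ h => h⟩
    cases σ
    exacts [.inr rfl, .inl rfl]
  | bot =>
    refine ⟨.bot, fun _ _ => .refl, ?_, fun _ _ _ h => h⟩
    cases σ
    exacts [.inl rfl, .inr rfl]
  | and s t ihs iht =>
    obtain ⟨s', rs, hs, os⟩ := ihs h.1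
    obtain ⟨t', rt, ht, ot⟩ := iht h.2
    obtain ⟨u, ru, hu, ou⟩ := exists_const_and hs ht
    exact ⟨u, fun b τ => (AtNode.rtg_and (rs b τ) (rt b τ)).trans (ru b τ), hu,
      fun ρ v τ h => (ou ρ v τ h).imp (os ρ v τ) (ot ρ v τ)⟩
  | or s t ihs iht =>
    obtain ⟨s', rs, hs, os⟩ := ihs h.1
    obtain ⟨t', rt, ht, ot⟩ := iht h.2
    obtain ⟨u, ru, hu, ou⟩ := exists_const_or hs ht
    exact ⟨u, fun b τ => (AtNode.rtg_or (rs b τ) (rt b τ)).trans (ru b τ), hu,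
      fun ρ v τ h => (ou ρ v τ h).imp (os ρ v τ) (ot ρ v τ)⟩
  | fc f a ih =>
    obtain ⟨rfl, h⟩ := h
    choose a' ra ha oa using fun i => ih i (h i)
    by_cases hbot : ∃ i, a' i = botPow (L.star.otF f i)
    · obtain ⟨i, hi⟩ := hbot
      exact ⟨.bot, fun b τ => (AtNode.rtg_fc f fun j => ra j _ _).tail (.here (.f b τ f a' i hi)),
        .inl rfl, fun _ _ _ h => h.elim⟩
    · push Not at hbot
      exact ⟨.fc f a', fun b τ => AtNode.rtg_fc f fun j => ra j _ _,
        .inr ⟨rfl, fun i => (ha i).resolve_left (hbot i)⟩,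
        fun ρ v τ ⟨i, h⟩ => ⟨i, oa i _ v τ h⟩⟩
  | gc g a ih =>
    obtain ⟨rfl, h⟩ := h
    choose a' ra ha oa using fun i => ih i (h i)
    by_cases hbot : ∃ i, a' i = topPow (L.star.otG g i)
    · obtain ⟨i, hi⟩ := hbot
      exact ⟨.top, fun b τ => (AtNode.rtg_gc g fun j => ra j _ _).tail (.here (.g b τ g a' i hi)),
        .inl rfl, fun _ _ _ h => h.elim⟩
    · push Not at hbot
      refine ⟨.gc g a', fun b τ => AtNode.rtg_gc g fun j => ra j _ _,
        .inr ⟨rfl, fun i => (ha i).resolve_left ?_⟩,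
        fun ρ v τ ⟨i, h⟩ => ⟨i, oa i _ v τ h⟩⟩
      rw [Pol.neg_mul, botPow_flip]
      exact hbot i

end ALBA

/-! ### Polarised order -/

namespace Pol

variable {A : Type*}

/-- The order of `A` if `σ = pos`, and the dual order if `σ = neg`. -/
def le [LE A] : Pol → A → A → Prop
  | pos, a, b => a ≤ b
  | neg, a, b => b ≤ a

/-- The supremum with respect to `σ.le`. -/
def sup [CompleteLattice A] : Pol → Set A → A
  | pos, S => sSup S
  | neg, S => sInf S

theorem le_refl [Preorder A] (σ : Pol) (a : A) : σ.le a a := by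
  cases σ <;> exact _root_.le_refl a

theorem le_trans [Preorder A] {σ : Pol} {a b c : A} (h : σ.le a b) (h' : σ.le b c) :
    σ.le a c := by
  cases σ
  exacts [_root_.le_trans h h', _root_.le_trans h' h]

theorem le_antisymm [PartialOrder A] {σ : Pol} {a b : A} (h : σ.le a b) (h' : σ.le b a) :
    a = b := by
  cases σ
  exacts [_root_.le_antisymm h h', _root_.le_antisymm h' h]

theorem flip_le [LE A] {σ : Pol} {a b : A} : σ.flip.le a b ↔ σ.le b a := by cases σ <;> rfl

section Complete

variable [CompleteLattice A] {σ : Pol} {S : Set A} {a : A}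

theorem le_sup (h : a ∈ S) : σ.le a (σ.sup S) := by
  cases σ
  exacts [le_sSup h, sInf_le h]

theorem sup_le_iff : σ.le (σ.sup S) a ↔ ∀ x ∈ S, σ.le x a := by
  cases σ
  exacts [sSup_le_iff, le_sInf_iff]

theorem le_flip_sup_iff : σ.le a (σ.flip.sup S) ↔ ∀ x ∈ S, σ.le a x := by
  cases σ
  exacts [le_sInf_iff, sSup_le_iff]

theorem sup_pair_of_le {b : A} (h : σ.le a b) : σ.sup {a, b} = b := by
  refine le_antisymm (sup_le_iff.2 ?_) (le_sup (by simp))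
  rintro x (rfl | rfl)
  exacts [h, σ.le_refl _]

end Complete

end Pol

/-! ### Normal operations and their residuals -/

section Residuation

variable {A : Type*} [CompleteLattice A] {n : ℕ}

/-- In each coordinate `i`, the operation `h` turns suprema with respect to `σ · ε i` into suprema
with respect to `σ`. -/
def OpPres (σ : Pol) (ε : Fin n → Pol) (h : (Fin n → A) → A) : Prop :=
  ∀ i a S, h (Function.update a i ((σ.mul (ε i)).sup S)) =
    σ.sup ((fun x => h (Function.update a i x)) '' S)

/-- The residual of an operation in the coordinate `i`. -/
def opResidual (σ : Pol) (ε : Fin n → Pol) (h : (Fin n → A) → A) (i : Fin n) (a : Fin n → A) : A :=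
  (σ.mul (ε i)).sup {x | σ.le (h (Function.update a i x)) (a i)}

variable {σ : Pol} {ε : Fin n → Pol} {h : (Fin n → A) → A}

/-- Comparability of `x` and `y` says that `y` is the supremum of the pair, and suprema of pairs are
preserved. -/
theorem OpPres.mono_update (H : OpPres σ ε h) (a : Fin n → A) (i : Fin n) {x y : A}
    (hxy : (σ.mul (ε i)).le x y) :
    σ.le (h (Function.update a i x)) (h (Function.update a i y)) := by
  have := H i a {x, y}
  rw [Pol.sup_pair_of_le hxy] at this
  rw [this]
  exact Pol.le_sup ⟨x, by simp, rfl⟩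

theorem OpPres.mono (H : OpPres σ ε h) (τ : Pol) {a a' : Fin n → A}
    (haa : ∀ i, (τ.mul (ε i)).le (a i) (a' i)) : τ.le (h a) (h a') := by
  have key : ∀ {a a' : Fin n → A}, (∀ i, (σ.mul (ε i)).le (a i) (a' i)) → σ.le (h a) (h a') := by
    intro a a' haa
    have trans_of : ∀ (τ : Pol) {x y : A}, Relation.ReflTransGen τ.le x y → τ.le x y := by
      intro τ x y hxy
      induction hxy with
      | refl => exact τ.le_refl _
      | tail _ h ih => exact Pol.le_trans ih h
    refine trans_of σ (reflTransGen_of_forall_update (R := fun i => (σ.mul (ε i)).le)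
      (fun a i x hx => .single ?_) fun i => .single (haa i))
    simpa using H.mono_update a i (trans_of _ hx)
  by_cases hτ : τ = σ
  · subst hτ; exact key haa
  · obtain rfl : τ = σ.flip := Pol.eq_of_ne_flip (by simpa using hτ)
    rw [Pol.flip_le]
    exact key fun i => by simpa [Pol.flip_mul, Pol.flip_le] using haa i

/-- The adjunction: the set whose supremum defines the residual is closed under suprema, because the
operation preserves them in coordinate `i`. -/
theorem OpPres.le_residual_iff (H : OpPres σ ε h) (i : Fin n) (a : Fin n → A) (y : A) :
    (σ.mul (ε i)).le y (opResidual σ ε h i a) ↔ σ.le (h (Function.update a i y)) (a i) := by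
  constructor
  · intro hy
    refine Pol.le_trans (H.mono_update a i hy) ?_
    rw [opResidual, H]
    refine Pol.sup_le_iff.2 ?_
    rintro _ ⟨x, hx, rfl⟩
    exact hx
  · exact fun hy => Pol.le_sup hy

/-- Residuals of normal operations are again normal, with the order-type `resOT` read in the
reversed order. Via the adjunction this becomes a statement on the original operation, where in a
coordinate `j ≠ i` its own normality applies. -/
theorem OpPres.residual (H : OpPres σ ε h) (i : Fin n) :
    OpPres (σ.mul (ε i)).flip (resOT ε i) (opResidual σ ε h i) := by
  intro j a S
  have ext : ∀ {δ : Pol} {x y : A}, (∀ z, δ.le z x ↔ δ.le z y) → x = y := fun {δ x y} H =>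
    Pol.le_antisymm ((H x).1 (δ.le_refl x)) ((H y).2 (δ.le_refl y))
  -- Two elements are equal if they have the same lower bounds `z`, and lower bounds of a residual
  -- are described by the adjunction.
  refine ext (δ := σ.mul (ε i)) fun z => ?_
  rw [H.le_residual_iff, Pol.le_flip_sup_iff, Set.forall_mem_image, Pol.flip_mul, mul_resOT]
  simp only [H.le_residual_iff]
  split_ifs with hj
  · subst hj
    simp [Pol.le_flip_sup_iff]
  · simp only [Pol.flip_flip, Function.update_of_ne (Ne.symm hj)]
    simp only [Function.update_comm hj, H j]
    rw [Pol.sup_le_iff, Set.forall_mem_image]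

end Residuation

section Distributive

variable {A : Type*} [CompletelyDistribLattice A]

theorem opPres_sup : OpPres .neg (fun _ => .pos) fun a : Fin 2 → A => a 0 ⊔ a 1 := by
  intro i a S
  fin_cases i
  · simp [Pol.sup, sInf_sup_eq, sInf_image]
  · simp [Pol.sup, sup_sInf_eq, sInf_image]

theorem opPres_inf : OpPres .pos (fun _ => .pos) fun a : Fin 2 → A => a 0 ⊓ a 1 := by
  intro i a S
  fin_cases i
  · simp [Pol.sup, sSup_inf_eq, sSup_image]
  · simp [Pol.sup, inf_sSup_eq, sSup_image]

theorem resOT_pos_zero : resOT (fun _ : Fin 2 => Pol.pos) 0 = ![.pos, .neg] := by decide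

theorem resOT_pos_one : resOT (fun _ : Fin 2 => Pol.pos) 1 = ![.neg, .pos] := by decide

/-- The difference is the residual of `⊔`, so its normality is an instance of `OpPres.residual`. The
same device serves the other residual of `⊔` and, dually, the Heyting implications. -/
theorem opPres_sdiff : OpPres .pos ![.pos, .neg] fun a : Fin 2 → A => a 0 \ a 1 := by
  have := opPres_sup (A := A).residual 0
  rw [resOT_pos_zero] at this
  convert this using 1
  · rfl
  funext a
  have key : {x | a 0 ≤ Function.update a 0 x 0 ⊔ Function.update a 0 x 1} = Set.Ici (a 0 \ a 1) := by
    ext x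
    simp [sup_comm]
  exact csInf_Ici.symm.trans (congrArg _ key.symm)

theorem opPres_sdiff' : OpPres .pos ![.neg, .pos] fun a : Fin 2 → A => a 1 \ a 0 := by
  have := opPres_sup (A := A).residual 1
  rw [resOT_pos_one] at this
  convert this using 1
  · rfl
  funext a
  have key : {x | a 1 ≤ Function.update a 1 x 0 ⊔ Function.update a 1 x 1} = Set.Ici (a 1 \ a 0) := by
    ext x
    simp
  exact csInf_Ici.symm.trans (congrArg _ key.symm)

theorem opPres_himp : OpPres .neg ![.pos, .neg] fun a : Fin 2 → A => a 1 ⇨ a 0 := by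
  have := opPres_inf (A := A).residual 0
  rw [resOT_pos_zero] at this
  convert this using 1
  · rfl
  funext a
  have key : {x | Function.update a 0 x 0 ⊓ Function.update a 0 x 1 ≤ a 0} = Set.Iic (a 1 ⇨ a 0) := by
    ext x
    simp
  exact csSup_Iic.symm.trans (congrArg _ key.symm)

theorem opPres_himp' : OpPres .neg ![.neg, .pos] fun a : Fin 2 → A => a 0 ⇨ a 1 := by
  have := opPres_inf (A := A).residual 1
  rw [resOT_pos_one] at this
  convert this using 1
  · rfl
  funext a
  have key : {x | Function.update a 1 x 0 ⊓ Function.update a 1 x 1 ≤ a 1} = Set.Iic (a 0 ⇨ a 1) := by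
    ext x
    simp [inf_comm]
  exact csSup_Iic.symm.trans (congrArg _ key.symm)

end Distributive

/-! ### Normality of the expanded algebra -/

namespace Interp

variable {L : DLESig} {A : Type*}

/-- The operations preserve or reverse joins and meets as their order-types say. -/
structure Normal [CompleteLattice A] (I : Interp L A) : Prop where
  fop : ∀ f, OpPres .pos (L.otF f) (I.fop f)
  gop : ∀ g, OpPres .neg (L.otG g) (I.gop g)

theorem _root_.IsPerfectDLE.normal [CompletelyDistribLattice A] {I : Interp L A}
    (h : IsPerfectDLE I) : I.Normal where
  fop f i a S := by
    cases hi : L.otF f i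
    · exact h.f_pos f i hi a S
    · exact h.f_neg f i hi a S
  gop g i a S := by
    cases hi : L.otG g i
    · exact h.g_pos g i hi a S
    · exact h.g_neg g i hi a S

/-- Base connectives are normal by assumption and the others are residuals of normal operations.
From here on the old and the new connectives need no separate treatment. -/
theorem Normal.star [CompletelyDistribLattice A] {I : Interp L A} (h : I.Normal) :
    I.star.Normal where
  fop
    | .base f => h.fop f
    | .orRes₁ => opPres_sdiff
    | .orRes₂ => opPres_sdiff'
    | .sharp f i hi => by
      have := (h.fop f).residual i
      unfold opResidual at this
      rw [hi] at this
      exact this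
    | .flat g i hi => by
      have := (h.gop g).residual i
      unfold opResidual at this
      rw [hi] at this
      exact this
  gop
    | .base g => h.gop g
    | .andRes₁ => opPres_himp
    | .andRes₂ => opPres_himp'
    | .sharp f i hi => by
      have := (h.fop f).residual i
      unfold opResidual at this
      rw [hi] at this
      exact this
    | .flat g i hi => by
      have := (h.gop g).residual i
      unfold opResidual at this
      rw [hi] at this
      exact this

end Interp

/-! ### Perfect lattices -/

/-- Completely join-irreducible elements if `σ = pos`, completely meet-irreducible ones if
`σ = neg`. -/
def Pol.Irred {A : Type*} [CompleteLattice A] : Pol → A → Prop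
  | .pos, w => CJoinIrred w
  | .neg, w => CMeetIrred w

section Perfect

variable {A : Type*} [CompleteLattice A]

theorem CJoinPrime.cJoinIrred {j : A} (h : CJoinPrime j) : CJoinIrred j := by
  intro S hS
  obtain ⟨x, hx, hjx⟩ := h S hS.le
  obtain rfl : j = x := le_antisymm hjx (hS ▸ le_sSup hx)
  exact hx

theorem CJoinPrime.not_le_sSup {j : A} (h : CJoinPrime j) : ¬ j ≤ sSup {x | ¬ j ≤ x} := fun hj =>
  let ⟨_, hx, hjx⟩ := h _ hj
  hx hjx

/-- For a completely join-prime `j`, the element `sSup {x | ¬ j ≤ x}` is the largest one not above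
`j`. If it is an infimum, some member of the family is not above `j` either, hence equals it. -/
theorem CJoinPrime.cMeetIrred {j : A} (h : CJoinPrime j) : CMeetIrred (sSup {x | ¬ j ≤ x}) := by
  intro S hS
  by_contra hmem
  refine h.not_le_sSup ?_
  rw [hS]
  refine le_sInf fun x hx => ?_
  by_contra hjx
  have h1 : x ≤ sSup {x | ¬ j ≤ x} := le_sSup hjx
  have h2 : sSup {x | ¬ j ≤ x} ≤ x := hS ▸ sInf_le hx
  exact hmem (le_antisymm h1 h2 ▸ hx)

end Perfect

section Generated

variable {A : Type*} [CompleteLattice A]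

/-- `A` is completely join-generated by its completely join-prime elements. -/
def JoinGenerated (A : Type*) [CompleteLattice A] : Prop :=
  ∀ a : A, a = sSup {j | CJoinPrime j ∧ j ≤ a}

/-- Meet-generation comes for free: for each prime `j` not below `a`, the largest element not above
`j` lies above `a`, and no prime below all these elements can fail to be below `a`. -/
theorem JoinGenerated.eq_sInf (H : JoinGenerated A) (a : A) :
    a = sInf {m | ∃ j, CJoinPrime j ∧ ¬ j ≤ a ∧ m = sSup {x | ¬ j ≤ x}} := by
  refine le_antisymm (le_sInf ?_) ?_
  · rintro _ ⟨j, -, hja, rfl⟩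
    exact le_sSup hja
  · rw [H (sInf _)]
    refine sSup_le ?_
    rintro j ⟨hj, hle⟩
    by_contra hja
    exact hj.not_le_sSup (hle.trans (sInf_le ⟨j, hj, hja, rfl⟩))

/-- An irreducible element is a join of primes, hence is itself a prime. Dually, a meet-irreducible
one is the largest element not above some prime `j`; if no member of `S` lay below it, all of them
would be above `j`, and so would `sInf S`. -/
theorem JoinGenerated.irred_prime (H : JoinGenerated A) {σ : Pol} {w : A} (hw : σ.Irred w)
    {S : Set A} (h : σ.le w (σ.sup S)) : ∃ x ∈ S, σ.le w x := by
  cases σ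
  · exact (hw _ (H w)).1 S h
  · obtain ⟨j, hj, -, rfl⟩ := hw _ (H.eq_sInf w)
    by_contra! hS
    refine hj.not_le_sSup (le_trans (le_sInf fun x hx => ?_) h)
    by_contra hjx
    exact hS x hx (le_sSup hjx)

theorem JoinGenerated.eq_sup_irred (H : JoinGenerated A) (τ : Pol) (u : A) :
    u = τ.sup {w | τ.Irred w ∧ τ.le w u} := by
  refine Pol.le_antisymm (σ := τ) ?_ (Pol.sup_le_iff.2 fun x hx => hx.2)
  cases τ
  · conv_lhs => rw [H u]
    exact sSup_le_sSup fun j hj => ⟨hj.1.cJoinIrred, hj.2⟩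
  · show sInf _ ≤ u
    conv_rhs => rw [H.eq_sInf u]
    refine sInf_le_sInf ?_
    rintro _ ⟨j, hj, hja, rfl⟩
    exact ⟨hj.cMeetIrred, le_sSup hja⟩

/-- Without irreducibles every element would be the supremum of the empty set. -/
theorem JoinGenerated.exists_irred [Nontrivial A] (H : JoinGenerated A) (σ : Pol) :
    ∃ w : A, σ.Irred w := by
  by_contra! h
  have key : ∀ a : A, a = σ.sup ∅ := fun a => by
    conv_lhs => rw [H.eq_sup_irred σ a]
    congr 1
    ext w
    simp [h w]
  obtain ⟨a, b, hab⟩ := exists_pair_ne A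
  exact hab ((key a).trans (key b).symm)

end Generated

/-! ### Values of terms -/

namespace Tm

variable {L : DLESig} {V W : Type} {A : Type*} [CompletelyDistribLattice A]

/-- Terms are monotone or antitone in each variable according to the signs of its leaves. Only
leaves that do occur constrain the two assignments, so independence of variables that do not occur
is a special case. -/
theorem eval_mono {I : Interp L A} (hI : I.Normal) {s : Tm L V} (σ : Pol) {v v' : V → A}
    (h : ∀ x τ, s.OccSign σ x τ → τ.le (v x) (v' x)) : σ.le (s.eval I v) (s.eval I v') := by
  induction s generalizing σ with
  | var w => exact h w σ ⟨rfl, rfl⟩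
  | top => exact σ.le_refl _
  | bot => exact σ.le_refl _
  | and s t hs ht =>
    have h1 := hs σ fun x τ hx => h x τ (.inl hx)
    have h2 := ht σ fun x τ hx => h x τ (.inr hx)
    cases σ
    exacts [inf_le_inf h1 h2, inf_le_inf h1 h2]
  | or s t hs ht =>
    have h1 := hs σ fun x τ hx => h x τ (.inl hx)
    have h2 := ht σ fun x τ hx => h x τ (.inr hx)
    cases σ
    exacts [sup_le_sup h1 h2, sup_le_sup h1 h2]
  | fc f a ih => exact (hI.fop f).mono σ fun i => ih i _ fun x τ hx => h x τ ⟨i, hx⟩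
  | gc g a ih => exact (hI.gop g).mono σ fun i => ih i _ fun x τ hx => h x τ ⟨i, hx⟩

theorem eval_congr {I : Interp L A} (hI : I.Normal) {s : Tm L V} {v v' : V → A}
    (h : ∀ x, s.Occurs x → v x = v' x) : s.eval I v = s.eval I v' :=
  Pol.le_antisymm (σ := .pos)
    (eval_mono hI .pos fun x τ hx => h x hx.occurs ▸ τ.le_refl _)
    (eval_mono hI .pos fun x τ hx => h x hx.occurs ▸ τ.le_refl _)

theorem eval_update_of_not_occurs {I : Interp L A} (hI : I.Normal) [DecidableEq V] {s : Tm L V}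
    {x : V} (h : ¬ s.Occurs x) (v : V → A) (w : A) :
    s.eval I (Function.update v x w) = s.eval I v :=
  eval_congr hI fun y hy => Function.update_of_ne (by rintro rfl; exact h hy) _ _

theorem eval_subst (I : Interp L A) (θ : V → Tm L W) (s : Tm L V) (v : W → A) :
    (s.subst θ).eval I v = s.eval I fun x => (θ x).eval I v := by
  induction s with
  | var w => rfl
  | top => rfl
  | bot => rfl
  | and s t hs ht => simp [subst, eval, hs, ht]
  | or s t hs ht => simp [subst, eval, hs, ht]
  | fc f a ih => simp [subst, eval, ih]
  | gc f a ih => simp [subst, eval, ih]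

theorem eval_substVar (I : Interp L A) [DecidableEq V] (s : Tm L V) (p : V) (α : Tm L V)
    (v : V → A) :
    (s.substVar p α).eval I v = s.eval I (Function.update v p (α.eval I v)) := by
  rw [substVar, eval_subst]
  congr 1
  funext x
  by_cases hx : x = p
  · subst hx; simp
  · simp [Function.update_of_ne hx, eval]

theorem eval_update_arg (I : Interp L A) {n : ℕ} (a : Fin n → Tm L V) (i : Fin n) (t : Tm L V)
    (v : V → A) :
    (fun j => (Function.update a i t j).eval I v) =
      Function.update (fun j => (a j).eval I v) i (t.eval I v) := by
  funext j
  by_cases hj : j = i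
  · subst hj; simp
  · simp [Function.update_of_ne hj]

theorem eval_emb (I : Interp L A) (s : Tm L ℕ) (v : Var → A) :
    s.emb.eval I.star v = s.eval I fun p => v (.prop p) := by
  induction s with
  | var w => rfl
  | top => rfl
  | bot => rfl
  | and s t hs ht => simp [emb, eval, hs, ht]
  | or s t hs ht => simp [emb, eval, hs, ht]
  | fc f a ih => exact congrArg (I.fop f) (funext ih)
  | gc f a ih => exact congrArg (I.gop f) (funext ih)

end Tm

namespace ALBA

open Relation

variable {L : DLESig} {A : Type*} [CompletelyDistribLattice A] {I : Interp L A}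

/-! ### Soundness of the rules -/

theorem eval_botPow (σ : Pol) (v : Var → A) : (botPow (L := L) σ).eval I.star v = σ.sup ∅ := by
  cases σ <;> simp [botPow, Tm.eval, Pol.sup]

theorem eval_topPow (σ : Pol) (v : Var → A) :
    (topPow (L := L) σ).eval I.star v = σ.flip.sup ∅ := by
  rw [← botPow_flip, eval_botPow]

/-- Normality for the empty family; this is what makes the rules for constants sound. The companion
for a pair gives the distribution rules. -/
theorem _root_.OpPres.eq_of_bot {n : ℕ} {σ : Pol} {ε : Fin n → Pol} {h : (Fin n → A) → A}
    (H : OpPres σ ε h) {a : Fin n → A} {i : Fin n} (hi : a i = (σ.mul (ε i)).sup ∅) :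
    h a = σ.sup ∅ := by
  have := H i a ∅
  rwa [← hi, Function.update_eq_self, Set.image_empty] at this

theorem _root_.OpPres.eq_of_pair {n : ℕ} {σ : Pol} {ε : Fin n → Pol} {h : (Fin n → A) → A}
    (H : OpPres σ ε h) {a : Fin n → A} {i : Fin n} {x y : A}
    (hi : a i = (σ.mul (ε i)).sup {x, y}) :
    h a = σ.sup {h (Function.update a i x), h (Function.update a i y)} := by
  have := H i a {x, y}
  rwa [← hi, Function.update_eq_self, Set.image_pair] at this

theorem Const.eval_eq (hI : I.Normal) {b : Bool} {σ : Pol} {s s' : STm L} (h : Const b σ s s')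
    (v : Var → A) : s.eval I.star v = s'.eval I.star v := by
  cases h with
  | f f a i hi =>
    refine ((hI.star.fop f).eq_of_bot (i := i) ?_).trans sSup_empty
    simp [hi, eval_botPow]
  | g g a i hi =>
    refine ((hI.star.gop g).eq_of_bot (i := i) ?_).trans sInf_empty
    simp [hi, eval_topPow]
  | _ => simp [Tm.eval]

theorem Dist.eval_eq (hI : I.Normal) {b : Bool} {σ : Pol} {s s' : STm L} (h : Dist b σ s s')
    (v : Var → A) : s.eval I.star v = s'.eval I.star v := by
  cases h with
  | f_pos _ _ f a i t u _ hf hi =>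
    simp only [Tm.eval, Tm.eval_update_arg]
    refine ((hI.star.fop f).eq_of_pair (i := i) ?_).trans sSup_pair
    simp [hi, hf, Tm.eval, Pol.sup]
  | f_neg _ _ f a i t u _ hf hi =>
    simp only [Tm.eval, Tm.eval_update_arg]
    refine ((hI.star.fop f).eq_of_pair (i := i) ?_).trans sSup_pair
    simp [hi, hf, Tm.eval, Pol.sup]
  | g_pos _ _ g a i t u _ hg hi =>
    simp only [Tm.eval, Tm.eval_update_arg]
    refine ((hI.star.gop g).eq_of_pair (i := i) ?_).trans sInf_pair
    simp [hi, hg, Tm.eval, Pol.sup]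
  | g_neg _ _ g a i t u _ hg hi =>
    simp only [Tm.eval, Tm.eval_update_arg]
    refine ((hI.star.gop g).eq_of_pair (i := i) ?_).trans sInf_pair
    simp [hi, hg, Tm.eval, Pol.sup]
  | and_skel s t u | and_pia s t u => exact inf_sup_left _ _ _
  | and_skel' s t u | and_pia' s t u => exact inf_sup_right _ _ _
  | or_skel s t u | or_pia s t u => exact sup_inf_left _ _ _
  | or_skel' s t u | or_pia' s t u => exact sup_inf_right _ _ _

theorem AtNode.eval_eq {R : Bool → Pol → STm L → STm L → Prop} {v : Var → A}
    (hR : ∀ b σ s s', R b σ s s' → s.eval I.star v = s'.eval I.star v) {b : Bool} {σ : Pol}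
    {s s' : STm L} (h : AtNode R b σ s s') : s.eval I.star v = s'.eval I.star v := by
  induction h with
  | here h => exact hR _ _ _ _ h
  | and_left t _ ih => simp [Tm.eval, ih]
  | and_right t _ ih => simp [Tm.eval, ih]
  | or_left t _ ih => simp [Tm.eval, ih]
  | or_right t _ ih => simp [Tm.eval, ih]
  | fc f a i _ ih => simp [Tm.eval, Tm.eval_update_arg, ← ih]
  | gc f a i _ ih => simp [Tm.eval, Tm.eval_update_arg, ← ih]

/-- The inequality holds under the assignment `v`. -/
def Holds (I : Interp L A) (v : Var → A) (e : SIneq L) : Prop :=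
  e.lhs.eval I.star v ≤ e.rhs.eval I.star v

/-- Assignments sending nominals to completely join-irreducible elements and conominals to completely
meet-irreducible ones. -/
def Admissible (v : Var → A) : Prop :=
  (∀ n, CJoinIrred (v (Var.nom n))) ∧ ∀ n, CMeetIrred (v (Var.conom n))

theorem sValid_iff {e : SIneq L} : e.SValid I ↔ ∀ v, Admissible v → Holds I v e :=
  ⟨fun h v hv => h v hv.1 hv.2, fun h v h1 h2 => h v ⟨h1, h2⟩⟩

theorem Admissible.update_prop {v : Var → A} (hv : Admissible v) (p : ℕ) (w : A) :
    Admissible (Function.update v (.prop p) w) :=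
  ⟨fun n => by simpa using hv.1 n, fun n => by simpa using hv.2 n⟩

theorem holds_substVar (v : Var → A) (p : Var) (α : STm L) (e : SIneq L) :
    Holds I v (e.substVar p α) ↔ Holds I (Function.update v p (α.eval I.star v)) e := by
  simp [Holds, Ineq.substVar, Tm.eval_substVar]

theorem Holds.mono (hI : I.Normal) {v v' : Var → A} {e : SIneq L}
    (h : ∀ x τ, e.lhs.OccSign .pos x τ → τ.le (v' x) (v x))
    (h' : ∀ x τ, e.rhs.OccSign .pos x τ → τ.le (v x) (v' x)) (he : Holds I v e) :
    Holds I v' e :=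
  (Tm.eval_mono hI.star .pos h : _ ≤ _).trans
    (he.trans (Tm.eval_mono hI.star .pos h' : _ ≤ _))

theorem Split.holds {e : SIneq L} {es : List (SIneq L)} (h : Split e es) (v : Var → A) :
    (∀ e' ∈ es, Holds I v e') ↔ Holds I v e := by
  cases h <;> simp [Holds, Tm.eval]

theorem Tautology.holds {e : SIneq L} (h : Tautology e) (v : Var → A) : Holds I v e := by
  cases h <;> simp [Holds, Tm.eval]

theorem PreStep.sValid (hI : I.Normal) {e : SIneq L} {es : List (SIneq L)} (h : PreStep e es) :
    (∀ e' ∈ es, e'.SValid I) ↔ e.SValid I := by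
  simp only [sValid_iff]
  cases h with
  | dist_left h =>
    simp [Holds, h.eval_eq fun _ _ _ _ h => Dist.eval_eq hI h _]
  | dist_right h =>
    simp [Holds, h.eval_eq fun _ _ _ _ h => Dist.eval_eq hI h _]
  | const_left h =>
    simp [Holds, h.eval_eq fun _ _ _ _ h => Const.eval_eq hI h _]
  | const_right h =>
    simp [Holds, h.eval_eq fun _ _ _ _ h => Const.eval_eq hI h _]
  | split h =>
    refine ⟨fun H v hv => (h.holds v).1 fun e' he' => H e' he' v hv,
      fun H e' he' v hv => (h.holds v).2 (H v hv) e' he'⟩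
  | taut h => exact ⟨fun _ v _ => h.holds v, fun _ _ h => by simp at h⟩
  | @elim_bot α β p hα hβ =>
    simp only [List.mem_singleton, forall_eq]
    constructor
    · intro H v hv
      -- The left side is antitone and the right side monotone in `p`, so `p = ⊥` is the hardest
      -- instance and implies all others.
      refine ((holds_substVar v (.prop p) .bot ⟨α, β⟩).1 (H v hv)).mono hI ?_ ?_
      · intro x τ hx
        by_cases hxp : x = .prop p
        · subst hxp
          obtain rfl := hα τ hx
          simp [Pol.le, Tm.eval]
        · simpa [Function.update_of_ne hxp] using τ.le_refl _
      · intro x τ hx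
        by_cases hxp : x = .prop p
        · subst hxp
          obtain rfl := hβ τ hx
          simp [Pol.le, Tm.eval]
        · simpa [Function.update_of_ne hxp] using τ.le_refl _
    · exact fun H v hv => (holds_substVar v (.prop p) .bot ⟨α, β⟩).2 (H _ (hv.update_prop p _))
  | @elim_top β α p hβ hα =>
    simp only [List.mem_singleton, forall_eq]
    constructor
    · intro H v hv
      refine ((holds_substVar v (.prop p) .top ⟨α, β⟩).1 (H v hv)).mono hI ?_ ?_
      · intro x τ hx
        by_cases hxp : x = .prop p
        · subst hxp
          obtain rfl := hβ τ hx
          simp [Pol.le, Tm.eval]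
        · simpa [Function.update_of_ne hxp] using τ.le_refl _
      · intro x τ hx
        by_cases hxp : x = .prop p
        · subst hxp
          obtain rfl := hα τ hx
          simp [Pol.le, Tm.eval]
        · simpa [Function.update_of_ne hxp] using τ.le_refl _
    · exact fun H v hv => (holds_substVar v (.prop p) .top ⟨α, β⟩).2 (H _ (hv.update_prop p _))

theorem Preprocess.sValid (hI : I.Normal) {E E' : List (SIneq L)} (h : Preprocess E E') :
    (∀ e ∈ E', e.SValid I) ↔ ∀ e ∈ E, e.SValid I := by
  induction h with
  | refl => rfl
  | tail _ h ih =>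
    obtain ⟨Γ, Δ, e, es, hs, rfl, rfl⟩ := h
    rw [← ih]
    have := hs.sValid hI
    simp only [List.mem_append, List.mem_cons, or_imp, forall_and, forall_eq, ← this]
    tauto

/-- The embedded inequality ignores nominals and conominals, so it suffices that some admissible
values for them exist. -/
theorem sValid_emb (hA : JoinGenerated A) {e : Ineq L ℕ} : e.emb.SValid I ↔ e.Valid I := by
  rw [sValid_iff]
  simp only [Holds, Ineq.emb, Tm.eval_emb]
  refine ⟨fun h v => ?_, fun h v _ => h _⟩
  -- The one-element algebra has no irreducibles and hence no admissible assignment, but there every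
  -- inequality holds.
  rcases subsingleton_or_nontrivial A with hs | hn
  · exact (Subsingleton.elim _ _).le
  · obtain ⟨j, hj⟩ := hA.exists_irred .pos
    obtain ⟨m, hm⟩ := hA.exists_irred .neg
    exact h (fun | .nom _ => j | .conom _ => m | .prop p => v p) ⟨fun _ => hj, fun _ => hm⟩

end ALBA

/-! ### Polarised inequalities; residuation and approximation -/

namespace ALBA

open Relation

variable {L : DLESig}

/-- The inequality `a ≤ b` if `σ = pos`, and `b ≤ a` if `σ = neg`. -/
def pineq (σ : Pol) (a b : STm L) : SIneq L :=
  match σ with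
  | .pos => ⟨a, b⟩
  | .neg => ⟨b, a⟩

/-- The `k`-th nominal if `σ = pos`, and the `k`-th conominal if `σ = neg`. -/
def apv : Pol → ℕ → Var
  | .pos, k => .nom k
  | .neg, k => .conom k

theorem pineq_flip (σ : Pol) (a b : STm L) : pineq σ.flip a b = pineq σ b a := by cases σ <;> rfl

theorem occurs_pineq {σ : Pol} {a b : STm L} {x : Var} :
    (pineq σ a b).Occurs x ↔ a.Occurs x ∨ b.Occurs x := by
  cases σ
  · rfl
  · exact or_comm

theorem apv_inj {σ τ : Pol} {k l : ℕ} : apv σ k = apv τ l ↔ σ = τ ∧ k = l := by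
  cases σ <;> cases τ <;> simp [apv]

@[simp] theorem apv_ne_prop {σ : Pol} {k p : ℕ} : apv σ k ≠ .prop p := by cases σ <;> simp [apv]

variable {A : Type*} [CompletelyDistribLattice A] {I : Interp L A}

theorem holds_pineq {v : Var → A} {σ : Pol} {a b : STm L} :
    Holds I v (pineq σ a b) ↔ σ.le (a.eval I.star v) (b.eval I.star v) := by cases σ <;> rfl

theorem Admissible.apv {v : Var → A} (hv : Admissible v) (σ : Pol) (k : ℕ) :
    σ.Irred (v (apv σ k)) := by
  cases σ
  exacts [hv.1 k, hv.2 k]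

theorem Admissible.update {v : Var → A} (hv : Admissible v) {σ : Pol} {w : A} (hw : σ.Irred w)
    (k : ℕ) : Admissible (Function.update v (ALBA.apv σ k) w) := by
  cases σ
  · refine ⟨fun n => ?_, fun n => by simpa [ALBA.apv] using hv.2 n⟩
    by_cases hn : n = k
    · subst hn; simpa [ALBA.apv, Pol.Irred] using hw
    · rw [Function.update_of_ne (by simpa [ALBA.apv] using hn)]
      exact hv.1 n
  · refine ⟨fun n => by simpa [ALBA.apv] using hv.1 n, fun n => ?_⟩
    by_cases hn : n = k
    · subst hn; simpa [ALBA.apv, Pol.Irred] using hw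
    · rw [Function.update_of_ne (by simpa [ALBA.apv] using hn)]
      exact hv.2 n

theorem _root_.OpPres.le_residual_eval {n : ℕ} {σ δ : Pol} {ε : Fin n → Pol}
    {h : (Fin n → A) → A} (H : OpPres σ ε h) {i : Fin n} (hδ : σ.mul (ε i) = δ)
    (a : Fin n → STm L) (χ : STm L) (v : Var → A) :
    δ.le ((a i).eval I.star v)
      (δ.sup {x | σ.le (h (Function.update (fun j => (Function.update a i χ j).eval I.star v) i x))
        ((Function.update a i χ i).eval I.star v)}) ↔
      σ.le (h fun j => (a j).eval I.star v) (χ.eval I.star v) := by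
  subst hδ
  have := H.le_residual_iff i (fun j => (Function.update a i χ j).eval I.star v)
    ((a i).eval I.star v)
  unfold opResidual at this
  rw [this, Tm.eval_update_arg, Function.update_idem,
    Function.update_eq_self (a := i) (f := fun j => (a j).eval I.star v), Function.update_self]

theorem Resid.holds (hI : I.Normal) {e e' : SIneq L} (h : Resid e e') (v : Var → A) :
    Holds I v e' ↔ Holds I v e := by
  cases h with
  | f_pos f i hf a χ => exact (hI.fop f).le_residual_eval (δ := .pos) hf a χ v
  | f_neg f i hf a χ => exact (hI.fop f).le_residual_eval (δ := .neg) hf a χ v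
  | g_pos g i hg a χ => exact (hI.gop g).le_residual_eval (δ := .neg) (by rw [hg]; rfl) a χ v
  | g_neg g i hg a χ => exact (hI.gop g).le_residual_eval (δ := .pos) (by rw [hg]; rfl) a χ v
  | and₁ α β χ => exact le_himp_iff
  | and₂ α β χ => exact le_himp_iff'
  | or₁ α β χ => exact sdiff_le_iff'
  | or₂ α β χ => exact sdiff_le_iff

/-- Approximation introduces no variable besides the fresh one: leaves of the extracted subterm keep
their signs from the original tree, and the next lemma accounts for the leaves of the result. -/
theorem ApproxAt.occSign_of_subterm {x : STm L} {σ τ : Pol} {s u s' : STm L}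
    (h : ApproxAt x σ s τ u s') {y : Var} {ρ : Pol} (hy : u.OccSign τ y ρ) : s.OccSign σ y ρ := by
  induction h with
  | here σ u => exact hy
  | and_left t _ ih | or_left t _ ih => exact .inl (ih hy)
  | and_right t _ ih | or_right t _ ih => exact .inr (ih hy)
  | fc f a i _ ih => exact ⟨i, ih hy⟩
  | gc g a i _ ih => exact ⟨i, ih hy⟩

theorem ApproxAt.occSign_of_result {x : STm L} {σ τ : Pol} {s u s' : STm L}
    (h : ApproxAt x σ s τ u s') {y : Var} {ρ : Pol} (hy : s'.OccSign σ y ρ) :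
    s.OccSign σ y ρ ∨ x.OccSign τ y ρ := by
  induction h with
  | here σ u => exact .inr hy
  | and_left t _ ih | or_left t _ ih =>
    rcases hy with hy | hy
    exacts [(ih hy).imp_left .inl, .inl (.inr hy)]
  | and_right t _ ih | or_right t _ ih =>
    rcases hy with hy | hy
    exacts [.inl (.inl hy), (ih hy).imp_left .inr]
  | fc f a i _ ih =>
    obtain ⟨j, hy⟩ := hy
    by_cases hj : j = i
    · subst hj
      rw [Function.update_self] at hy
      exact (ih hy).imp_left fun h => ⟨j, h⟩
    · rw [Function.update_of_ne hj] at hy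
      exact .inl ⟨j, hy⟩
  | gc g a i _ ih =>
    obtain ⟨j, hy⟩ := hy
    by_cases hj : j = i
    · subst hj
      rw [Function.update_self] at hy
      exact (ih hy).imp_left fun h => ⟨j, h⟩
    · rw [Function.update_of_ne hj] at hy
      exact .inl ⟨j, hy⟩

/-- The path to the placeholder passes only through nodes that preserve suprema of the appropriate
sign. Since `y` does not occur in `s`, the placeholder is the only place where `y` occurs in `s'`,
so the whole context preserves suprema. -/
theorem ApproxAt.eval_sup (hI : I.Normal) {y : Var} {σ τ : Pol} {s u s' : STm L}
    (h : ApproxAt (.var y) σ s τ u s') (hy : ¬ s.Occurs y) (v : Var → A) (S : Set A) :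
    s'.eval I.star (Function.update v y (τ.sup S)) =
      σ.sup ((fun w => s'.eval I.star (Function.update v y w)) '' S) := by
  induction h with
  | here σ u => simp [Tm.eval]
  | and_left t _ ih =>
    have ht : ¬ t.Occurs y := fun ⟨τ, h⟩ => hy ⟨τ, .inr h⟩
    have := ih fun ⟨τ, h⟩ => hy ⟨τ, .inl h⟩
    simp only [Tm.eval, this, Tm.eval_update_of_not_occurs hI.star ht]
    simp only [Pol.sup, sSup_image, iSup_inf_eq]
  | and_right t _ ih =>
    have ht : ¬ t.Occurs y := fun ⟨τ, h⟩ => hy ⟨τ, .inl h⟩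
    have := ih fun ⟨τ, h⟩ => hy ⟨τ, .inr h⟩
    simp only [Tm.eval, this, Tm.eval_update_of_not_occurs hI.star ht]
    simp only [Pol.sup, sSup_image, inf_iSup_eq]
  | or_left t _ ih =>
    have ht : ¬ t.Occurs y := fun ⟨τ, h⟩ => hy ⟨τ, .inr h⟩
    have := ih fun ⟨τ, h⟩ => hy ⟨τ, .inl h⟩
    simp only [Tm.eval, this, Tm.eval_update_of_not_occurs hI.star ht]
    simp only [Pol.sup, sInf_image, iInf_sup_eq]
  | or_right t _ ih =>
    have ht : ¬ t.Occurs y := fun ⟨τ, h⟩ => hy ⟨τ, .inl h⟩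
    have := ih fun ⟨τ, h⟩ => hy ⟨τ, .inr h⟩
    simp only [Tm.eval, this, Tm.eval_update_of_not_occurs hI.star ht]
    simp only [Pol.sup, sInf_image, sup_iInf_eq]
  | @fc τ u s' f a i _ ih =>
    have ha : ∀ j, ¬ (a j).Occurs y := fun j h =>
      let ⟨ρ, h⟩ := (Tm.occurs_iff _ (Pol.pos.mul (L.star.otF f j)) _).1 h
      hy ⟨ρ, j, h⟩
    have key : ∀ w, (fun j => (Function.update a i s' j).eval I.star (Function.update v y w)) =
        Function.update (fun j => (a j).eval I.star v) i
          (s'.eval I.star (Function.update v y w)) := fun w => by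
      rw [Tm.eval_update_arg]
      congr 1
      funext j
      exact Tm.eval_update_of_not_occurs hI.star (ha j) v w
    simp only [Tm.eval, key]
    rw [ih (ha i)]
    exact ((hI.star.fop f) i _ _).trans (by rw [Set.image_image])
  | @gc τ u s' g a i _ ih =>
    have ha : ∀ j, ¬ (a j).Occurs y := fun j h =>
      let ⟨ρ, h⟩ := (Tm.occurs_iff _ (Pol.pos.mul (L.star.otG g j)) _).1 h
      hy ⟨ρ, j, h⟩
    have key : ∀ w, (fun j => (Function.update a i s' j).eval I.star (Function.update v y w)) =
        Function.update (fun j => (a j).eval I.star v) i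
          (s'.eval I.star (Function.update v y w)) := fun w => by
      rw [Tm.eval_update_arg]
      congr 1
      funext j
      exact Tm.eval_update_of_not_occurs hI.star (ha j) v w
    simp only [Tm.eval, key]
    rw [ih (ha i)]
    exact ((hI.star.gop g) i _ _).trans (by rw [Set.image_image])

theorem ApproxAt.eval_eq (hI : I.Normal) {y : Var} {σ τ : Pol} {s u s' : STm L}
    (h : ApproxAt (.var y) σ s τ u s') (hy : ¬ s.Occurs y) (v : Var → A) :
    s'.eval I.star (Function.update v y (u.eval I.star v)) = s.eval I.star v := by
  induction h with
  | here σ u => simp [Tm.eval]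
  | and_left t _ ih =>
    have ht : ¬ t.Occurs y := fun ⟨τ, h⟩ => hy ⟨τ, .inr h⟩
    have := ih fun ⟨τ, h⟩ => hy ⟨τ, .inl h⟩
    simp only [Tm.eval, this, Tm.eval_update_of_not_occurs hI.star ht]
  | and_right t _ ih =>
    have ht : ¬ t.Occurs y := fun ⟨τ, h⟩ => hy ⟨τ, .inl h⟩
    have := ih fun ⟨τ, h⟩ => hy ⟨τ, .inr h⟩
    simp only [Tm.eval, this, Tm.eval_update_of_not_occurs hI.star ht]
  | or_left t _ ih =>
    have ht : ¬ t.Occurs y := fun ⟨τ, h⟩ => hy ⟨τ, .inr h⟩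
    have := ih fun ⟨τ, h⟩ => hy ⟨τ, .inl h⟩
    simp only [Tm.eval, this, Tm.eval_update_of_not_occurs hI.star ht]
  | or_right t _ ih =>
    have ht : ¬ t.Occurs y := fun ⟨τ, h⟩ => hy ⟨τ, .inl h⟩
    have := ih fun ⟨τ, h⟩ => hy ⟨τ, .inr h⟩
    simp only [Tm.eval, this, Tm.eval_update_of_not_occurs hI.star ht]
  | @fc τ u s' f a i _ ih =>
    have ha : ∀ j, ¬ (a j).Occurs y := fun j h =>
      let ⟨ρ, h⟩ := (Tm.occurs_iff _ (Pol.pos.mul (L.star.otF f j)) _).1 h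
      hy ⟨ρ, j, h⟩
    simp only [Tm.eval, Tm.eval_update_arg, Tm.eval_update_of_not_occurs hI.star (ha _), ih (ha i)]
    rw [Function.update_eq_self (a := i) (f := fun j => (a j).eval I.star v)]
  | @gc τ u s' g a i _ ih =>
    have ha : ∀ j, ¬ (a j).Occurs y := fun j h =>
      let ⟨ρ, h⟩ := (Tm.occurs_iff _ (Pol.pos.mul (L.star.otG g j)) _).1 h
      hy ⟨ρ, j, h⟩
    simp only [Tm.eval, Tm.eval_update_arg, Tm.eval_update_of_not_occurs hI.star (ha _), ih (ha i)]
    rw [Function.update_eq_self (a := i) (f := fun j => (a j).eval I.star v)]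

theorem eval_bigOr_le {l : List (STm L)} {v : Var → A} {b : A} :
    (bigOr l).eval I.star v ≤ b ↔ ∀ α ∈ l, α.eval I.star v ≤ b := by
  induction l using bigOr.induct with
  | case1 => simp [bigOr, Tm.eval]
  | case2 α => simp [bigOr]
  | case3 α β l ih => simp [bigOr, Tm.eval, ih]

theorem le_eval_bigAnd {l : List (STm L)} {v : Var → A} {b : A} :
    b ≤ (bigAnd l).eval I.star v ↔ ∀ α ∈ l, b ≤ α.eval I.star v := by
  induction l using bigAnd.induct with
  | case1 => simp [bigAnd, Tm.eval]
  | case2 α => simp [bigAnd]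
  | case3 α β l ih => simp [bigAnd, Tm.eval, ih]

/-- Finite joins if `σ = pos` and finite meets if `σ = neg`. -/
def bigOp : Pol → List (STm L) → STm L
  | .pos => bigOr
  | .neg => bigAnd

theorem bigOp_le {σ : Pol} {l : List (STm L)} {v : Var → A} {b : A} :
    σ.le ((bigOp σ l).eval I.star v) b ↔ ∀ α ∈ l, σ.le (α.eval I.star v) b := by
  cases σ
  exacts [eval_bigOr_le, le_eval_bigAnd]

/-! ### Soundness for quasi-inequalities -/

/-- Validity of a quasi-inequality. -/
def QIneq.Valid (I : Interp L A) (q : QIneq L) : Prop :=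
  ∀ v, Admissible v → (∀ e ∈ q.prem, Holds I v e) → Holds I v q.concl

theorem QIneq.Valid.congr_prem {Γ Δ : List (SIneq L)} {c : SIneq L}
    (h : ∀ v : Var → A, (∀ e ∈ Γ, Holds I v e) ↔ ∀ e ∈ Δ, Holds I v e) :
    QIneq.Valid I ⟨Γ, c⟩ ↔ QIneq.Valid I ⟨Δ, c⟩ := by
  simp only [QIneq.Valid, h]

theorem holds_update_of_not_occurs (hI : I.Normal) {e : SIneq L} {x : Var} (hx : ¬ e.Occurs x)
    (v : Var → A) (w : A) : Holds I (Function.update v x w) e ↔ Holds I v e := by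
  unfold Holds
  rw [Tm.eval_update_of_not_occurs hI.star fun h => hx (.inl h),
    Tm.eval_update_of_not_occurs hI.star fun h => hx (.inr h)]

/-- Write the old premise as `𝐢 ≤ C(u)` with a context `C` that preserves suprema. As `u` is the
supremum of the irreducibles below it and the value of `𝐢` is prime, one irreducible `w ≤ u` already
satisfies `𝐢 ≤ C(w)`, and it can interpret the fresh symbol. The other direction is monotonicity of
`C`. -/
theorem valid_approx (hI : I.Normal) (hA : JoinGenerated A) {σ τ : Pol} {l k : ℕ}
    {s u s' : STm L} {Γ : List (SIneq L)} {c : SIneq L}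
    (hk : ¬ QIneq.Occurs ⟨pineq σ (.var (apv σ l)) s :: Γ, c⟩ (apv τ k))
    (h : ApproxAt (.var (apv τ k)) σ s τ u s') :
    QIneq.Valid I ⟨pineq σ (.var (apv σ l)) s :: Γ, c⟩ ↔
      QIneq.Valid I ⟨pineq σ (.var (apv σ l)) s' :: pineq τ (.var (apv τ k)) u :: Γ, c⟩ := by
  set y := apv τ k
  have hs : ¬ s.Occurs y := fun h => hk (.inl ⟨_, List.mem_cons_self, occurs_pineq.2 (.inr h)⟩)
  have hu : ¬ u.Occurs y := fun hy =>
    let ⟨_, hy⟩ := (Tm.occurs_iff u τ y).1 hy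
    hs (h.occSign_of_subterm hy).occurs
  have hΓ : ∀ e ∈ Γ, ¬ e.Occurs y := fun e he hy => hk (.inl ⟨e, List.mem_cons_of_mem _ he, hy⟩)
  have hc : ¬ c.Occurs y := fun hy => hk (.inr hy)
  have hl : apv σ l ≠ y := fun hy =>
    hk (.inl ⟨_, List.mem_cons_self, occurs_pineq.2 (.inl ⟨.pos, hy, rfl⟩)⟩)
  simp only [QIneq.Valid, List.forall_mem_cons, holds_pineq]
  constructor
  · rintro H v hv ⟨h1, h2, h3⟩
    refine H v hv ⟨Pol.le_trans h1 ?_, h3⟩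
    rw [← h.eval_eq hI hs v]
    -- Monotonicity of the context, extracted from preservation of the supremum of a comparable
    -- pair.
    have := h.eval_sup hI hs v {v y, u.eval I.star v}
    rw [Pol.sup_pair_of_le (σ := τ) (a := v y) h2] at this
    rw [this]
    exact Pol.le_sup ⟨v y, by simp, by simp⟩
  · rintro H v hv ⟨h1, h2⟩
    rw [← h.eval_eq hI hs v, hA.eq_sup_irred τ (u.eval I.star v), h.eval_sup hI hs] at h1
    obtain ⟨_, ⟨w, hw, rfl⟩, hle⟩ := hA.irred_prime (hv.apv σ l) h1
    refine (holds_update_of_not_occurs hI hc v w).1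
      (H (Function.update v y w) (hv.update hw.1 k) ⟨?_, ?_, fun e he => ?_⟩)
    · simpa [Tm.eval, Function.update_of_ne hl] using hle
    · simpa [Tm.eval, Tm.eval_update_of_not_occurs hI.star hu, y] using hw.2
    · exact (holds_update_of_not_occurs hI (hΓ e he) v w).2 (h2 e he)

/-- The join of the lower bounds is the least admissible value of `p`, and the remaining premises
are easiest to satisfy there by their monotonicity. With no bounds this value is `⊥`; for `σ = neg`
all is dual. -/
theorem valid_ackermann (hI : I.Normal) {σ : Pol} {p : ℕ} {αs : List (STm L)}
    {Γ : List (SIneq L)} {c : SIneq L} (hα : ∀ α ∈ αs, ¬ α.Occurs (.prop p))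
    (hΓ : ∀ e ∈ Γ, (∀ τ, e.lhs.OccSign .pos (.prop p) τ → τ = σ) ∧
      ∀ τ, e.rhs.OccSign .pos (.prop p) τ → τ = σ.flip)
    (hc : ¬ c.Occurs (.prop p)) :
    QIneq.Valid I ⟨αs.map (fun α => pineq σ α (.var (.prop p))) ++ Γ, c⟩ ↔
      QIneq.Valid I ⟨Γ.map (Ineq.substVar (.prop p) (bigOp σ αs)), c⟩ := by
  simp only [QIneq.Valid, List.forall_mem_append, List.forall_mem_map, holds_pineq, holds_substVar]
  constructor
  · intro H v hv hv'
    refine (holds_update_of_not_occurs hI hc v _).1 (H _ (hv.update_prop p _) ⟨fun α hα' => ?_, hv'⟩)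
    rw [Tm.eval_update_of_not_occurs hI.star (hα α hα')]
    simpa [Tm.eval] using bigOp_le.1 (σ.le_refl _) α hα'
  · rintro H v hv ⟨h1, h2⟩
    refine H v hv fun e he => (h2 e he).mono hI ?_ ?_
    · intro x τ hx
      by_cases hxp : x = .prop p
      · subst hxp
        obtain rfl := (hΓ e he).1 τ hx
        simpa [Tm.eval] using bigOp_le.2 h1
      · simpa [Function.update_of_ne hxp] using τ.le_refl _
    · intro x τ hx
      by_cases hxp : x = .prop p
      · subst hxp
        obtain rfl := (hΓ e he).2 τ hx
        simpa [Pol.flip_le, Tm.eval] using bigOp_le.2 h1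
      · simpa [Function.update_of_ne hxp] using τ.le_refl _

theorem RedStep.valid (hI : I.Normal) (hA : JoinGenerated A) {q q' : QIneq L}
    (h : RedStep q q') : q.Valid I ↔ q'.Valid I := by
  cases h with
  | rearrange h => exact QIneq.Valid.congr_prem fun v => by simp only [h]
  | split h =>
    exact QIneq.Valid.congr_prem fun v => by
      simp only [List.mem_append, List.mem_cons, or_imp, forall_and, forall_eq, h.holds v]
  | resid h =>
    exact QIneq.Valid.congr_prem fun v => by simp [h.holds hI v]
  | const_left h =>
    exact QIneq.Valid.congr_prem fun v => by
      simp [Holds, h.eval_eq fun _ _ _ _ h => Const.eval_eq hI h _]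
  | const_right h =>
    exact QIneq.Valid.congr_prem fun v => by
      simp [Holds, h.eval_eq fun _ _ _ _ h => Const.eval_eq hI h _]
  | taut h =>
    exact QIneq.Valid.congr_prem fun v => by simp [h.holds v]
  | approx_left_nom hk h => exact valid_approx (σ := .pos) (τ := .pos) hI hA hk h
  | approx_left_conom hk h => exact valid_approx (σ := .pos) (τ := .neg) hI hA hk h
  | approx_right_nom hk h => exact valid_approx (σ := .neg) (τ := .pos) hI hA hk h
  | approx_right_conom hk h => exact valid_approx (σ := .neg) (τ := .neg) hI hA hk h
  | ackermann_right hα hΓ hc => exact valid_ackermann (σ := .pos) hI hα hΓ hc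
  | ackermann_left hα hΓ hc => exact valid_ackermann (σ := .neg) hI hα hΓ hc

/-- The symbol eliminated occurs nowhere else, so it ranges freely over the irreducibles below `s`,
whose supremum is `s`. -/
theorem valid_output (hI : I.Normal) (hA : JoinGenerated A) {σ : Pol} {n : ℕ} {s t : STm L}
    {Γ : List (SIneq L)} (hn : ¬ QIneq.Occurs ⟨Γ, pineq σ s t⟩ (apv σ n)) :
    QIneq.Valid I ⟨pineq σ (.var (apv σ n)) s :: Γ, pineq σ (.var (apv σ n)) t⟩ ↔
      QIneq.Valid I ⟨Γ, pineq σ s t⟩ := by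
  have hs : ¬ s.Occurs (apv σ n) := fun h => hn (.inr (occurs_pineq.2 (.inl h)))
  have ht : ¬ t.Occurs (apv σ n) := fun h => hn (.inr (occurs_pineq.2 (.inr h)))
  have hΓ : ∀ e ∈ Γ, ¬ e.Occurs (apv σ n) := fun e he h => hn (.inl ⟨e, he, h⟩)
  simp only [QIneq.Valid, List.forall_mem_cons, holds_pineq]
  constructor
  · intro H v hv h
    rw [hA.eq_sup_irred σ (s.eval I.star v), Pol.sup_le_iff]
    rintro w ⟨hw, hws⟩
    have := H (Function.update v (apv σ n) w) (hv.update hw n)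
      ⟨by simpa [Tm.eval, Tm.eval_update_of_not_occurs hI.star hs] using hws,
        fun e he => (holds_update_of_not_occurs hI (hΓ e he) v w).2 (h e he)⟩
    simpa [Tm.eval, Tm.eval_update_of_not_occurs hI.star ht] using this
  · exact fun H v hv h => Pol.le_trans h.1 (H v hv h.2)

theorem OutStep.valid (hI : I.Normal) (hA : JoinGenerated A) {q q' : QIneq L}
    (h : OutStep q q') : q.Valid I ↔ q'.Valid I := by
  cases h with
  | rearrange h => exact QIneq.Valid.congr_prem fun v => by simp only [h]
  | conom hn => exact valid_output (σ := .neg) hI hA hn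
  | nom hn => exact valid_output (σ := .pos) hI hA hn

/-- First approximation is two output steps read backwards, one for the conominal and one for the
nominal. -/
theorem valid_firstApprox (hI : I.Normal) (hA : JoinGenerated A) {e : SIneq L} {i m : ℕ}
    (hi : ¬ e.Occurs (.nom i)) (hm : ¬ e.Occurs (.conom m)) :
    (firstApprox e i m).Valid I ↔ e.SValid I := by
  have hmi : ¬ (Tm.var (Var.nom i) : STm L).Occurs (.conom m) := by simp [Tm.Occurs, Tm.OccSign]
  have h1 := valid_output (σ := .neg) (n := m) (s := e.rhs) (t := .var (.nom i))
    (Γ := [⟨.var (.nom i), e.lhs⟩]) hI hA (by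
      rintro (⟨_, he, h⟩ | h | h)
      · rw [List.mem_singleton] at he
        subst he
        exact h.elim hmi fun h => hm (.inl h)
      · exact hmi h
      · exact hm (.inr h))
  have h2 := valid_output (σ := .pos) (n := i) (s := e.lhs) (t := e.rhs) (Γ := []) hI hA (by
      rintro (⟨_, he, h⟩ | h)
      · simp at he
      · exact hi h)
  refine Iff.trans ?_ (h1.trans (h2.trans ?_))
  · exact QIneq.Valid.congr_prem fun v => by simp [pineq, apv, and_comm]
  · rw [sValid_iff]
    simp [QIneq.Valid, pineq]

/-- Soundness of a reduction of an inequality in which the nominal and the conominal of the first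
approximation do not occur. -/
theorem sValid_of_steps (hI : I.Normal) (hA : JoinGenerated A) {e e' : SIneq L} {i m : ℕ}
    {q : QIneq L} (hi : ¬ e.Occurs (.nom i)) (hm : ¬ e.Occurs (.conom m))
    (h : ReflTransGen RedStep (firstApprox e i m) q) (h' : ReflTransGen OutStep q ⟨[], e'⟩) :
    e'.SValid I ↔ e.SValid I := by
  have h1 : (firstApprox e i m).Valid I ↔ q.Valid I := by
    clear h'
    induction h with
    | refl => rfl
    | tail _ h ih => exact ih.trans (h.valid hI hA)
  have h2 : q.Valid I ↔ QIneq.Valid I ⟨[], e'⟩ := by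
    clear h h1
    induction h' using ReflTransGen.head_induction_on with
    | refl => rfl
    | head h _ ih => exact (h.valid hI hA).trans ih
  rw [← valid_firstApprox hI hA hi hm, h1, h2, sValid_iff]
  simp [QIneq.Valid]

end ALBA

namespace Tm

variable {L : DLESig} {V : Type}

/-! ### Positions in signed generation trees -/

theorem nodeAt_cons {σ τ : Pol} {s u : Tm L V} {k : ℕ} (h : s.child k = some (τ, u))
    (π : List ℕ) : nodeAt σ s (k :: π) = nodeAt (σ.mul τ) u π := by
  simp only [nodeAt, h]

theorem child_fc (f : L.F) (a : Fin (L.arF f) → Tm L V) (i : Fin (L.arF f)) :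
    (fc f a).child i = some (L.otF f i, a i) := by
  simp [child]

theorem child_gc (g : L.G) (a : Fin (L.arG g) → Tm L V) (i : Fin (L.arG g)) :
    (gc g a).child i = some (L.otG g i, a i) := by
  simp [child]

theorem occSign_of_child {σ τ ρ : Pol} {s u : Tm L V} {k : ℕ} {v : V}
    (h : s.child k = some (τ, u)) (hv : u.OccSign (σ.mul τ) v ρ) : s.OccSign σ v ρ := by
  cases s with
  | var w => simp [child] at h
  | top => simp [child] at h
  | bot => simp [child] at h
  | and s t =>
    match k with
    | 0 => simp only [child, Option.some.injEq, Prod.mk.injEq] at h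
           obtain ⟨rfl, rfl⟩ := h; exact .inl (by simpa using hv)
    | 1 => simp only [child, Option.some.injEq, Prod.mk.injEq] at h
           obtain ⟨rfl, rfl⟩ := h; exact .inr (by simpa using hv)
    | k + 2 => simp [child] at h
  | or s t =>
    match k with
    | 0 => simp only [child, Option.some.injEq, Prod.mk.injEq] at h
           obtain ⟨rfl, rfl⟩ := h; exact .inl (by simpa using hv)
    | 1 => simp only [child, Option.some.injEq, Prod.mk.injEq] at h
           obtain ⟨rfl, rfl⟩ := h; exact .inr (by simpa using hv)
    | k + 2 => simp [child] at h
  | fc f a =>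
    simp only [child] at h
    split_ifs at h with hk
    simp only [Option.some.injEq, Prod.mk.injEq] at h
    obtain ⟨rfl, rfl⟩ := h
    exact ⟨_, hv⟩
  | gc g a =>
    simp only [child] at h
    split_ifs at h with hk
    simp only [Option.some.injEq, Prod.mk.injEq] at h
    obtain ⟨rfl, rfl⟩ := h
    exact ⟨_, hv⟩

theorem nodeAt_append {σ τ : Pol} {s u : Tm L V} {ρ : List ℕ} (h : nodeAt σ s ρ = some (τ, u))
    (π : List ℕ) : nodeAt σ s (ρ ++ π) = nodeAt τ u π := by
  induction ρ generalizing σ s with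
  | nil =>
    simp only [nodeAt, Option.some.injEq, Prod.mk.injEq] at h
    obtain ⟨rfl, rfl⟩ := h
    rfl
  | cons k ρ ih =>
    cases hk : s.child k with
    | none => simp [nodeAt, hk] at h
    | some c =>
      obtain ⟨τ', u'⟩ := c
      rw [nodeAt_cons hk] at h
      rw [List.cons_append, nodeAt_cons hk, ih h]

theorem Uniform.of_nodeAt {ε : V → Pol} {σ τ : Pol} {s u : Tm L V} (hs : Uniform ε σ s)
    {π : List ℕ} (h : nodeAt σ s π = some (τ, u)) : Uniform ε τ u := by
  induction π generalizing σ s with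
  | nil =>
    simp only [nodeAt, Option.some.injEq, Prod.mk.injEq] at h
    obtain ⟨rfl, rfl⟩ := h
    exact hs
  | cons k ρ ih =>
    cases hk : s.child k with
    | none => simp [nodeAt, hk] at h
    | some c =>
      obtain ⟨τ', u'⟩ := c
      rw [nodeAt_cons hk] at h
      exact ih (fun v ρ hv => hs v ρ (occSign_of_child hk hv)) h

theorem OccSign.exists_nodeAt {σ τ : Pol} {s : Tm L V} {v : V} (h : s.OccSign σ v τ) :
    ∃ π, nodeAt σ s π = some (τ, var v) := by
  induction s generalizing σ with
  | var w => obtain ⟨rfl, rfl⟩ := h; exact ⟨[], rfl⟩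
  | top => exact h.elim
  | bot => exact h.elim
  | and s t hs ht =>
    rcases h with h | h
    · obtain ⟨π, hπ⟩ := hs h
      exact ⟨0 :: π, by rw [nodeAt_cons (τ := .pos) (u := s) rfl]; simpa using hπ⟩
    · obtain ⟨π, hπ⟩ := ht h
      exact ⟨1 :: π, by rw [nodeAt_cons (τ := .pos) (u := t) rfl]; simpa using hπ⟩
  | or s t hs ht =>
    rcases h with h | h
    · obtain ⟨π, hπ⟩ := hs h
      exact ⟨0 :: π, by rw [nodeAt_cons (τ := .pos) (u := s) rfl]; simpa using hπ⟩
    · obtain ⟨π, hπ⟩ := ht h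
      exact ⟨1 :: π, by rw [nodeAt_cons (τ := .pos) (u := t) rfl]; simpa using hπ⟩
  | fc f a ih =>
    obtain ⟨i, h⟩ := h
    obtain ⟨π, hπ⟩ := ih i h
    exact ⟨i :: π, by rwa [nodeAt_cons (child_fc f a i)]⟩
  | gc g a ih =>
    obtain ⟨i, h⟩ := h
    obtain ⟨π, hπ⟩ := ih i h
    exact ⟨i :: π, by rwa [nodeAt_cons (child_gc g a i)]⟩

theorem IsLeaf.cons {σ τ : Pol} {s u : Tm L V} {k : ℕ} (h : s.child k = some (τ, u))
    {π : List ℕ} (hπ : IsLeaf (σ.mul τ) u π) : IsLeaf σ s (k :: π) := by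
  obtain ⟨τ', u', h1, h2⟩ := hπ
  exact ⟨τ', u', by rwa [nodeAt_cons h], h2⟩

theorem exists_isLeaf (σ : Pol) (s : Tm L V) : ∃ π, IsLeaf σ s π := by
  induction s generalizing σ with
  | var w => exact ⟨[], σ, _, rfl, fun _ => rfl⟩
  | top => exact ⟨[], σ, _, rfl, fun _ => rfl⟩
  | bot => exact ⟨[], σ, _, rfl, fun _ => rfl⟩
  | and s t hs ht => exact (hs (σ.mul .pos)).imp' (0 :: ·) fun _ h => h.cons rfl
  | or s t hs ht => exact (hs (σ.mul .pos)).imp' (0 :: ·) fun _ h => h.cons rfl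
  | fc f a ih =>
    rcases Nat.eq_zero_or_pos (L.arF f) with h0 | h0
    · exact ⟨[], σ, _, rfl, fun k => by simp [child, h0]⟩
    · exact (ih ⟨0, h0⟩ (σ.mul (L.otF f ⟨0, h0⟩))).imp' (0 :: ·) fun _ h =>
        h.cons (child_fc f a ⟨0, h0⟩)
  | gc g a ih =>
    rcases Nat.eq_zero_or_pos (L.arG g) with h0 | h0
    · exact ⟨[], σ, _, rfl, fun k => by simp [child, h0]⟩
    · exact (ih ⟨0, h0⟩ (σ.mul (L.otG g ⟨0, h0⟩))).imp' (0 :: ·) fun _ h =>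
        h.cons (child_gc g a ⟨0, h0⟩)

/-! ### Hereditary form of restricted analyticity -/

/-- The hereditary part of the requirements on restricted analytic inductive trees: in `inner`, the
requirement on maximal uniform subtrees is applied to the children of a non-uniform PIA node. -/
structure AnalyticTree (S : Set (List ℕ)) (Ω : V → V → Prop) (ε : V → Pol) (σ : Pol) (s : Tm L V) :
    Prop where
  closed : ∀ π ∈ S, ∀ ρ, ρ <+: π → ρ ∈ S
  good : ∀ π, IsLeaf σ s π → GoodBranch S σ s π
  srr : ∀ π p, IsCritical ε σ s π p →
    ∀ ρ, ρ <+: π → ρ ∉ S → ∀ τ u, nodeAt σ s ρ = some (τ, u) → IsSRR τ u →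
      ∀ h, ¬ (ρ ++ [h] <+: π) → ∀ τ' γ, nodeAt σ s (ρ ++ [h]) = some (τ', γ) →
        Uniform (fun v => (ε v).flip) τ' γ ∧ ∀ q, γ.Occurs q → Ω q p
  inner : ∀ ρ, ρ ∉ S → ∀ τ u, nodeAt σ s ρ = some (τ, u) → ¬ Uniform (fun v => (ε v).flip) τ u →
    ¬ IsSRR τ u → ∀ h τ' γ, nodeAt σ s (ρ ++ [h]) = some (τ', γ) →
      ¬ Uniform (fun v => (ε v).flip) τ' γ

/-- The topmost nodes of the PIA part are not uniform. -/
def RootsCritical (S : Set (List ℕ)) (ε : V → Pol) (σ : Pol) (s : Tm L V) : Prop :=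
  ∀ π, π ∉ S → (∀ ρ, ρ <+: π → ρ ≠ π → ρ ∈ S) → ∀ τ γ, nodeAt σ s π = some (τ, γ) →
    ¬ Uniform (fun v => (ε v).flip) τ γ

/-- The maximality condition is not inherited by subtrees, so it is replaced by two consequences
that can be used in an induction on the tree. -/
theorem RestrictedAnalytic.exists_analyticTree {Ω : V → V → Prop} {ε : V → Pol} {σ : Pol}
    {s : Tm L V} (h : RestrictedAnalytic Ω ε σ s) :
    ∃ S, AnalyticTree S Ω ε σ s ∧ RootsCritical S ε σ s := by
  obtain ⟨S, closed, ind, good, max⟩ := h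
  refine ⟨S, ⟨closed, good, ind.srr, ?_⟩, ?_⟩
  · intro ρ hρ τ u hu hnu hsrr h τ' γ hγ hun
    -- A uniform child of a non-uniform PIA node is maximal, since a uniform ancestor would make its
    -- parent uniform. The SRR node supplied by the condition then has to be this parent.
    obtain ⟨ρ', h', τ'', u', heq, -, hu', hsrr', -⟩ := max (ρ ++ [h]) τ' γ
      (fun hmem => hρ (closed _ hmem _ (List.prefix_append _ _))) hγ hun (by
        intro ρ' hpre hne hS τ'' u' hu' hun'
        rcases List.prefix_concat_iff.1 hpre with rfl | ⟨δ, rfl⟩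
        · exact hne rfl
        · rw [nodeAt_append hu'] at hu
          exact hnu (hun'.of_nodeAt hu))
    obtain ⟨rfl, -⟩ := List.append_inj' heq rfl
    rw [hu] at hu'
    obtain ⟨rfl, rfl⟩ := Prod.mk.inj (Option.some.inj hu')
    exact hsrr hsrr'
  · intro π hπ hpre τ γ hγ hun
    -- At a topmost PIA node maximality is vacuous, and the required SRR parent in the PIA part
    -- cannot exist.
    obtain ⟨ρ, h, -, -, rfl, hρ, -⟩ := max π τ γ hπ hγ hun
      fun ρ h1 h2 h3 => absurd (hpre ρ h1 h2) h3
    exact hρ (hpre ρ (List.prefix_append _ _) (by simp))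

section Child

variable {S : Set (List ℕ)} {Ω : V → V → Prop} {ε : V → Pol} {σ τ : Pol} {s u : Tm L V} {k : ℕ}

theorem AnalyticTree.child (H : AnalyticTree S Ω ε σ s) (hk : s.child k = some (τ, u)) :
    AnalyticTree {π | k :: π ∈ S} Ω ε (σ.mul τ) u where
  closed π hπ ρ hρ := H.closed _ hπ _ (List.cons_prefix_cons.2 ⟨rfl, hρ⟩)
  good π hπ ρ hρ τ' u' hu' :=
    H.good _ (hπ.cons hk) (k :: ρ) (List.cons_prefix_cons.2 ⟨rfl, hρ⟩) τ' u'
      (by rwa [nodeAt_cons hk])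
  srr π p hπ ρ hρ hS τ' u' hu' hsrr h hh τ'' γ hγ :=
    H.srr (k :: π) p (by rwa [IsCritical, nodeAt_cons hk]) (k :: ρ)
      (List.cons_prefix_cons.2 ⟨rfl, hρ⟩) hS τ' u' (by rwa [nodeAt_cons hk]) hsrr h
      (fun h' => hh (List.cons_prefix_cons.1 h').2) τ'' γ
      (by rwa [List.cons_append, nodeAt_cons hk])
  inner ρ hρ τ' u' hu' hun hsrr h τ'' γ hγ :=
    H.inner (k :: ρ) hρ τ' u' (by rwa [nodeAt_cons hk]) hun hsrr h τ'' γ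
      (by rwa [List.cons_append, nodeAt_cons hk])

theorem RootsCritical.child (H : RootsCritical S ε σ s) (hS : [] ∈ S)
    (hk : s.child k = some (τ, u)) : RootsCritical {π | k :: π ∈ S} ε (σ.mul τ) u := by
  intro π hπ hpre τ' γ hγ
  refine H (k :: π) hπ ?_ τ' γ (by rwa [nodeAt_cons hk])
  intro ρ hρ hne
  cases ρ with
  | nil => exact hS
  | cons l ρ =>
    obtain ⟨rfl, hρ'⟩ := List.cons_prefix_cons.1 hρ
    exact hpre ρ hρ' (by rintro rfl; exact hne rfl)

theorem AnalyticTree.root (H : AnalyticTree S Ω ε σ s) :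
    ([] ∈ S → IsSkeleton σ s) ∧ ([] ∉ S → IsVar s ∨ IsPIA σ s) := by
  obtain ⟨π, hπ⟩ := exists_isLeaf σ s
  exact H.good π hπ [] List.nil_prefix σ s rfl

/-- With an empty Skeleton part, goodness of all branches allows only `+g`, `-f`, lattice nodes and
leaves. This is the grammar of primitive terms for the opposite sign. -/
theorem AnalyticTree.prePrim (H : AnalyticTree ∅ Ω ε σ s) : PrePrim σ.flip s := by
  have hroot := H.root.2 (Set.notMem_empty _)
  induction s generalizing σ with
  | var w => trivial
  | top => trivial
  | bot => trivial
  | and s t hs ht =>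
    have h1 := H.child (k := 0) (τ := .pos) (u := s) rfl
    have h2 := H.child (k := 1) (τ := .pos) (u := t) rfl
    rw [Pol.mul_pos] at h1 h2
    exact ⟨hs h1 (h1.root.2 (Set.notMem_empty _)), ht h2 (h2.root.2 (Set.notMem_empty _))⟩
  | or s t hs ht =>
    have h1 := H.child (k := 0) (τ := .pos) (u := s) rfl
    have h2 := H.child (k := 1) (τ := .pos) (u := t) rfl
    rw [Pol.mul_pos] at h1 h2
    exact ⟨hs h1 (h1.root.2 (Set.notMem_empty _)), ht h2 (h2.root.2 (Set.notMem_empty _))⟩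
  | fc f a ih =>
    obtain rfl : σ = .neg := hroot.resolve_left id
    refine ⟨rfl, fun i => ?_⟩
    have h1 := H.child (child_fc f a i)
    have := ih i h1 (h1.root.2 (Set.notMem_empty _))
    simpa using this
  | gc g a ih =>
    obtain rfl : σ = .pos := hroot.resolve_left id
    refine ⟨rfl, fun i => ?_⟩
    have h1 := H.child (child_gc g a i)
    have := ih i h1 (h1.root.2 (Set.notMem_empty _))
    simpa using this

end Child

end Tm

/-! ### From signed trees to Skeletons over critical PIA trees -/

namespace ALBA

variable {L : DLESig}

/-- The extension of an order-type to nominals (positive) and conominals (negative). -/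
def extPol (ε : ℕ → Pol) : Var → Pol
  | .nom _ => .pos
  | .conom _ => .neg
  | .prop p => ε p

/-- The signed tree `τ u` may occur next to the critical tree `σ s` below an SRR node. -/
structure Side (Ω : ℕ → ℕ → Prop) (ε : ℕ → Pol) (σ : Pol) (s : STm L) (τ : Pol) (u : STm L) :
    Prop where
  prePrim : Tm.PrePrim τ.flip u
  prop_of_occurs : ∀ x, u.Occurs x → ∃ p, x = .prop p
  uniform : Tm.Uniform (fun v => (extPol ε v).flip) τ u
  below : ∀ p, s.OccSign σ (.prop p) (ε p) → ∀ q, u.Occurs (.prop q) → Ω q p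

/-- Critical PIA trees: each node `+∧`, `-∨` has two critical subtrees, and each other node, apart
from variables, exactly one. -/
inductive CritPIA (Ω : ℕ → ℕ → Prop) (ε : ℕ → Pol) : Pol → STm L → Prop
  | var (p) : CritPIA Ω ε (ε p) (.var (.prop p))
  | and_pos {s t} : CritPIA Ω ε .pos s → CritPIA Ω ε .pos t → CritPIA Ω ε .pos (.and s t)
  | or_neg {s t} : CritPIA Ω ε .neg s → CritPIA Ω ε .neg t → CritPIA Ω ε .neg (.or s t)
  | and_left {s t} : CritPIA Ω ε .neg s → Side Ω ε .neg s .neg t → CritPIA Ω ε .neg (.and s t)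
  | and_right {s t} : CritPIA Ω ε .neg t → Side Ω ε .neg t .neg s → CritPIA Ω ε .neg (.and s t)
  | or_left {s t} : CritPIA Ω ε .pos s → Side Ω ε .pos s .pos t → CritPIA Ω ε .pos (.or s t)
  | or_right {s t} : CritPIA Ω ε .pos t → Side Ω ε .pos t .pos s → CritPIA Ω ε .pos (.or s t)
  | fc (f : L.F) (a : Fin (L.arF f) → STm L) (i) : CritPIA Ω ε (L.otF f i).flip (a i) →
      (∀ j, j ≠ i → Side Ω ε (L.otF f i).flip (a i) (L.otF f j).flip (a j)) →
      CritPIA Ω ε .neg (.fc (L := L.star) (FStar.base f) a)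
  | gc (g : L.G) (a : Fin (L.arG g) → STm L) (i) : CritPIA Ω ε (L.otG g i) (a i) →
      (∀ j, j ≠ i → Side Ω ε (L.otG g i) (a i) (L.otG g j) (a j)) →
      CritPIA Ω ε .pos (.gc (L := L.star) (GStar.base g) a)

/-- Trees consisting of a Skeleton part above critical PIA trees. -/
inductive Skel (Ω : ℕ → ℕ → Prop) (ε : ℕ → Pol) : Pol → STm L → Prop
  | pia {σ s} : CritPIA Ω ε σ s → Skel Ω ε σ s
  | top (σ) : Skel Ω ε σ .top
  | bot (σ) : Skel Ω ε σ .bot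
  | and {σ s t} : Skel Ω ε σ s → Skel Ω ε σ t → Skel Ω ε σ (.and s t)
  | or {σ s t} : Skel Ω ε σ s → Skel Ω ε σ t → Skel Ω ε σ (.or s t)
  | fc (f : L.star.F) (a : Fin (L.star.arF f) → STm L) : (∀ i, Skel Ω ε (L.star.otF f i) (a i)) →
      Skel Ω ε .pos (.fc f a)
  | gc (g : L.star.G) (a : Fin (L.star.arG g) → STm L) :
      (∀ i, Skel Ω ε (L.star.otG g i).flip (a i)) → Skel Ω ε .neg (.gc g a)

section Extraction

open Tm

variable {Ω : ℕ → ℕ → Prop} {ε : ℕ → Pol} {σ : Pol} {s : Tm L ℕ}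

/-- The condition on SRR nodes speaks about one critical branch at a time. Non-uniformity of `u`
provides at least one such branch, which forces uniformity of the sibling; the order condition is
then used for every critical leaf of `u`. -/
theorem _root_.Tm.AnalyticTree.side {k l : ℕ} {τ τ' : Pol} {u γ : Tm L ℕ}
    (H : AnalyticTree ∅ Ω ε σ s) (hs : IsSRR σ s) (hk : s.child k = some (τ, u))
    (hu : ¬ Uniform (fun v => (ε v).flip) (σ.mul τ) u) (hl : s.child l = some (τ', γ))
    (hkl : l ≠ k) : Side Ω ε (σ.mul τ) u.emb (σ.mul τ') γ.emb := by
  have key : ∀ p, u.OccSign (σ.mul τ) p (ε p) →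
      Uniform (fun v => (ε v).flip) (σ.mul τ') γ ∧ ∀ q, γ.Occurs q → Ω q p := by
    intro p hp
    obtain ⟨π, hπ⟩ := hp.exists_nodeAt
    refine H.srr (k :: π) p (by rwa [IsCritical, nodeAt_cons hk]) [] List.nil_prefix
      (Set.notMem_empty _) σ s rfl hs l ?_ (σ.mul τ') γ ?_
    · intro h
      exact hkl (List.cons_prefix_cons.1 h).1
    · exact nodeAt_cons hl []
  refine ⟨(H.child hl).prePrim.emb, fun x hx => ?_, fun x ρ hx => ?_, fun p hp q hq => ?_⟩
  · exact (exists_prop_of_occurs_emb hx).imp fun _ => And.left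
  · obtain ⟨p, rfl, hx'⟩ := (occSign_emb _ _ _ _).1 hx
    simp only [Uniform, not_forall] at hu
    obtain ⟨v, ρ', hv, hne⟩ := hu
    obtain rfl := Pol.eq_of_ne_flip hne
    exact (key v hv).1 p ρ hx'
  · obtain ⟨_, h, hp⟩ := (occSign_emb _ _ _ _).1 hp
    cases h
    obtain ⟨_, h, hq⟩ := exists_prop_of_occurs_emb hq
    cases h
    exact (key p hp).2 q hq

/-- At `+∧` and `-∨`, which are not SRR, no child may be uniform. At any other inner node a
non-uniform child exists, and its siblings are side trees. -/
theorem _root_.Tm.AnalyticTree.critPIA (H : AnalyticTree ∅ Ω ε σ s)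
    (hs : ¬ Uniform (fun v => (ε v).flip) σ s) : CritPIA Ω ε σ s.emb := by
  have hroot := H.root.2 (Set.notMem_empty _)
  induction s generalizing σ with
  | var p =>
    simp only [Uniform, OccSign, not_forall] at hs
    obtain ⟨_, _, ⟨rfl, rfl⟩, hne⟩ := hs
    obtain rfl := Pol.eq_of_ne_flip hne
    exact .var p
  | top => exact (hs fun _ _ h => h.elim).elim
  | bot => exact (hs fun _ _ h => h.elim).elim
  | and s t ihs iht =>
    have h1 := H.child (k := 0) (τ := .pos) (u := s) rfl
    have h2 := H.child (k := 1) (τ := .pos) (u := t) rfl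
    have s1 := fun hσ hu => H.side hσ (k := 0) (τ := .pos) (u := s) rfl hu (l := 1) rfl one_ne_zero
    have s2 := fun hσ hu => H.side hσ (k := 1) (τ := .pos) (u := t) rfl hu (l := 0) rfl zero_ne_one
    rw [Pol.mul_pos] at h1 h2 s1 s2
    have i1 := fun hu => ihs h1 hu (h1.root.2 (Set.notMem_empty _))
    have i2 := fun hu => iht h2 hu (h2.root.2 (Set.notMem_empty _))
    cases σ with
    | pos =>
      have inner := H.inner [] (Set.notMem_empty _) .pos _ rfl hs (by simp [IsSRR])
      exact .and_pos (i1 (inner 0 _ s rfl)) (i2 (inner 1 _ t rfl))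
    | neg =>
      by_cases hu : Uniform (fun v => (ε v).flip) .neg s
      · have hu' : ¬ Uniform (fun v => (ε v).flip) .neg t := fun hu' =>
          hs fun v τ h => h.elim (hu v τ) (hu' v τ)
        exact .and_right (i2 hu') (s2 rfl hu')
      · exact .and_left (i1 hu) (s1 rfl hu)
  | or s t ihs iht =>
    have h1 := H.child (k := 0) (τ := .pos) (u := s) rfl
    have h2 := H.child (k := 1) (τ := .pos) (u := t) rfl
    have s1 := fun hσ hu => H.side hσ (k := 0) (τ := .pos) (u := s) rfl hu (l := 1) rfl one_ne_zero
    have s2 := fun hσ hu => H.side hσ (k := 1) (τ := .pos) (u := t) rfl hu (l := 0) rfl zero_ne_one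
    rw [Pol.mul_pos] at h1 h2 s1 s2
    have i1 := fun hu => ihs h1 hu (h1.root.2 (Set.notMem_empty _))
    have i2 := fun hu => iht h2 hu (h2.root.2 (Set.notMem_empty _))
    cases σ with
    | neg =>
      have inner := H.inner [] (Set.notMem_empty _) .neg _ rfl hs (by simp [IsSRR])
      exact .or_neg (i1 (inner 0 _ s rfl)) (i2 (inner 1 _ t rfl))
    | pos =>
      by_cases hu : Uniform (fun v => (ε v).flip) .pos s
      · have hu' : ¬ Uniform (fun v => (ε v).flip) .pos t := fun hu' =>
          hs fun v τ h => h.elim (hu v τ) (hu' v τ)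
        exact .or_right (i2 hu') (s2 rfl hu')
      · exact .or_left (i1 hu) (s1 rfl hu)
  | fc f a ih =>
    obtain rfl : σ = .neg := hroot.resolve_left id
    obtain ⟨i, hi⟩ : ∃ i, ¬ Uniform (fun v => (ε v).flip) (Pol.neg.mul (L.otF f i)) (a i) := by
      by_contra! hu
      exact hs fun v τ ⟨i, h⟩ => hu i v τ h
    have h1 := H.child (child_fc f a i)
    refine .fc f (fun j => (a j).emb) i (ih i h1 hi (h1.root.2 (Set.notMem_empty _)))
      fun j hj => ?_
    refine H.side ⟨rfl, ?_⟩ (child_fc f a i) hi (child_fc f a j) (by simpa [Fin.ext_iff] using hj)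
    -- A sibling `j ≠ i` exists only if the arity is at least two, which is what makes the node SRR.
    have := i.2; have := j.2
    rw [Ne, Fin.ext_iff] at hj
    omega
  | gc g a ih =>
    obtain rfl : σ = .pos := hroot.resolve_left id
    obtain ⟨i, hi⟩ : ∃ i, ¬ Uniform (fun v => (ε v).flip) (Pol.pos.mul (L.otG g i)) (a i) := by
      by_contra! hu
      exact hs fun v τ ⟨i, h⟩ => hu i v τ h
    have h1 := H.child (child_gc g a i)
    refine .gc g (fun j => (a j).emb) i (ih i h1 hi (h1.root.2 (Set.notMem_empty _)))
      fun j hj => ?_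
    refine H.side ⟨rfl, ?_⟩ (child_gc g a i) hi (child_gc g a j) (by simpa [Fin.ext_iff] using hj)
    have := i.2; have := j.2
    rw [Ne, Fin.ext_iff] at hj
    omega

/-- If the root is outside the Skeleton part, closure under prefixes makes that part empty, and the
root is itself a topmost PIA node, hence not uniform. -/
theorem _root_.Tm.AnalyticTree.skel_of_notMem {S : Set (List ℕ)} (H : AnalyticTree S Ω ε σ s)
    (hr : RootsCritical S ε σ s) (hS : [] ∉ S) : Skel Ω ε σ s.emb := by
  obtain rfl : S = ∅ :=
    Set.eq_empty_of_forall_notMem fun π hπ => hS (H.closed π hπ [] List.nil_prefix)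
  refine .pia (H.critPIA (hr [] hS (fun ρ hρ hne => ?_) σ s rfl))
  exact absurd (List.prefix_nil.1 hρ) hne

theorem _root_.Tm.AnalyticTree.skel {S : Set (List ℕ)} (H : AnalyticTree S Ω ε σ s)
    (hr : RootsCritical S ε σ s) : Skel Ω ε σ s.emb := by
  induction s generalizing σ S with
  -- A variable is not a Skeleton node, so this leaf is in the PIA part and, being topmost there, is
  -- critical.
  | var p => exact H.skel_of_notMem hr fun hS => H.root.1 hS
  | top => exact .top σ
  | bot => exact .bot σ
  | and s t ihs iht =>
    by_cases hS : [] ∈ S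
    · have h1 := H.child (k := 0) (τ := .pos) (u := s) rfl
      have h2 := H.child (k := 1) (τ := .pos) (u := t) rfl
      have r1 := hr.child hS (k := 0) (τ := .pos) (u := s) rfl
      have r2 := hr.child hS (k := 1) (τ := .pos) (u := t) rfl
      rw [Pol.mul_pos] at h1 h2 r1 r2
      exact .and (ihs h1 r1) (iht h2 r2)
    · exact H.skel_of_notMem hr hS
  | or s t ihs iht =>
    by_cases hS : [] ∈ S
    · have h1 := H.child (k := 0) (τ := .pos) (u := s) rfl
      have h2 := H.child (k := 1) (τ := .pos) (u := t) rfl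
      have r1 := hr.child hS (k := 0) (τ := .pos) (u := s) rfl
      have r2 := hr.child hS (k := 1) (τ := .pos) (u := t) rfl
      rw [Pol.mul_pos] at h1 h2 r1 r2
      exact .or (ihs h1 r1) (iht h2 r2)
    · exact H.skel_of_notMem hr hS
  | fc f a ih =>
    by_cases hS : [] ∈ S
    · obtain rfl : σ = .pos := H.root.1 hS
      refine .fc (FStar.base f) (fun i => (a i).emb) fun i => ?_
      have h1 := H.child (child_fc f a i)
      have r1 := hr.child hS (child_fc f a i)
      exact ih i h1 r1
    · exact H.skel_of_notMem hr hS
  | gc g a ih =>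
    by_cases hS : [] ∈ S
    · obtain rfl : σ = .neg := H.root.1 hS
      refine .gc (GStar.base g) (fun i => (a i).emb) fun i => ?_
      have h1 := H.child (child_gc g a i)
      have r1 := hr.child hS (child_gc g a i)
      exact ih i h1 r1
    · exact H.skel_of_notMem hr hS

theorem _root_.Tm.RestrictedAnalytic.skel (h : RestrictedAnalytic Ω ε σ s) :
    Skel Ω ε σ s.emb := by
  obtain ⟨S, H, hr⟩ := h.exists_analyticTree
  exact H.skel hr

end Extraction

end ALBA

/-! ### Distribution: from Skeletons to definite terms -/

namespace ALBA

open Relation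

variable {L : DLESig} {Ω : ℕ → ℕ → Prop} {ε : ℕ → Pol}

/-- Skeletons without nodes `+∨`, `-∧`, `+⊥`, `-⊤` above critical PIA trees. -/
inductive Definite (Ω : ℕ → ℕ → Prop) (ε : ℕ → Pol) : Pol → STm L → Prop
  | pia {σ s} : CritPIA Ω ε σ s → Definite Ω ε σ s
  | const (σ) : Definite Ω ε σ (topPow σ)
  | and {s t} : Definite Ω ε .pos s → Definite Ω ε .pos t → Definite Ω ε .pos (.and s t)
  | or {s t} : Definite Ω ε .neg s → Definite Ω ε .neg t → Definite Ω ε .neg (.or s t)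
  | fc (f : L.star.F) (a : Fin (L.star.arF f) → STm L) :
      (∀ i, Definite Ω ε (L.star.otF f i) (a i)) → Definite Ω ε .pos (.fc f a)
  | gc (g : L.star.G) (a : Fin (L.star.arG g) → STm L) :
      (∀ i, Definite Ω ε (L.star.otG g i).flip (a i)) → Definite Ω ε .neg (.gc g a)

/-- `DefiniteJoin Ω ε σ s n`: the term `s` is a join (a meet if `σ = neg`) of `n` definite terms. -/
inductive DefiniteJoin (Ω : ℕ → ℕ → Prop) (ε : ℕ → Pol) : Pol → STm L → ℕ → Prop
  | single {σ s} : Definite Ω ε σ s → DefiniteJoin Ω ε σ s 1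
  | or {s t m n} : DefiniteJoin Ω ε .pos s m → DefiniteJoin Ω ε .pos t n →
      DefiniteJoin Ω ε .pos (.or s t) (m + n)
  | and {s t m n} : DefiniteJoin Ω ε .neg s m → DefiniteJoin Ω ε .neg t n →
      DefiniteJoin Ω ε .neg (.and s t) (m + n)

theorem DefiniteJoin.pos {σ : Pol} {s : STm L} {n : ℕ} (h : DefiniteJoin Ω ε σ s n) : 0 < n := by
  induction h with
  | single => exact one_pos
  | or _ _ h _ => exact Nat.add_pos_left h _
  | and _ _ h _ => exact Nat.add_pos_left h _

/-- Distribution rules and rules for constants. -/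
def DistConst (b : Bool) (σ : Pol) (s s' : STm L) : Prop := Dist b σ s s' ∨ Const b σ s s'

/-- Rewriting the signed tree `σ s` in its Skeleton part. -/
abbrev SkelRewrite (σ : Pol) : STm L → STm L → Prop := ReflTransGen (AtNode DistConst false σ)

/-- Below `+f` the scope flag stays `false`, and likewise below `-g`, so the Skeleton distribution
rules remain available at every depth. -/
theorem skelRewrite_fc (f : L.star.F) {a a' : Fin (L.star.arF f) → STm L}
    (h : ∀ i, SkelRewrite (L.star.otF f i) (a i) (a' i)) :
    SkelRewrite .pos (.fc f a) (.fc f a') :=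
  AtNode.rtg_fc f h

theorem skelRewrite_gc (g : L.star.G) {a a' : Fin (L.star.arG g) → STm L}
    (h : ∀ i, SkelRewrite (L.star.otG g i).flip (a i) (a' i)) :
    SkelRewrite .neg (.gc g a) (.gc g a') :=
  AtNode.rtg_gc g h

/-- Double induction: distribute over the joins on the left, then over those on the right, until
both conjuncts are definite. -/
theorem DefiniteJoin.exists_and {s t : STm L} {m n : ℕ} (hs : DefiniteJoin Ω ε .pos s m)
    (ht : DefiniteJoin Ω ε .pos t n) :
    ∃ u k, SkelRewrite .pos (.and s t) u ∧ DefiniteJoin Ω ε .pos u k := by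
  generalize hσ : Pol.pos = σ at hs ht
  induction hs generalizing t n with
  | @single σ s hs =>
    induction ht with
    | @single σ t ht => subst hσ; exact ⟨_, _, .refl, .single (.and hs ht)⟩
    | or _ _ ih1 ih2 =>
      obtain ⟨u, k, hu, hu'⟩ := ih1 hs rfl
      obtain ⟨w, l, hw, hw'⟩ := ih2 hs rfl
      exact ⟨_, _, .head (.here (.inl (.and_skel _ _ _))) (AtNode.rtg_or hu hw), .or hu' hw'⟩
    | and => cases hσ
  | or _ _ ih1 ih2 =>
    obtain ⟨u, k, hu, hu'⟩ := ih1 rfl ht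
    obtain ⟨w, l, hw, hw'⟩ := ih2 rfl ht
    exact ⟨_, _, .head (.here (.inl (.and_skel' _ _ _))) (AtNode.rtg_or hu hw), .or hu' hw'⟩
  | and => cases hσ

theorem DefiniteJoin.exists_or {s t : STm L} {m n : ℕ} (hs : DefiniteJoin Ω ε .neg s m)
    (ht : DefiniteJoin Ω ε .neg t n) :
    ∃ u k, SkelRewrite .neg (.or s t) u ∧ DefiniteJoin Ω ε .neg u k := by
  generalize hσ : Pol.neg = σ at hs ht
  induction hs generalizing t n with
  | @single σ s hs =>
    induction ht with
    | @single σ t ht => subst hσ; exact ⟨_, _, .refl, .single (.or hs ht)⟩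
    | and _ _ ih1 ih2 =>
      obtain ⟨u, k, hu, hu'⟩ := ih1 hs rfl
      obtain ⟨w, l, hw, hw'⟩ := ih2 hs rfl
      exact ⟨_, _, .head (.here (.inl (.or_skel _ _ _))) (AtNode.rtg_and hu hw), .and hu' hw'⟩
    | or => cases hσ
  | and _ _ ih1 ih2 =>
    obtain ⟨u, k, hu, hu'⟩ := ih1 rfl ht
    obtain ⟨w, l, hw, hw'⟩ := ih2 rfl ht
    exact ⟨_, _, .head (.here (.inl (.or_skel' _ _ _))) (AtNode.rtg_and hu hw), .and hu' hw'⟩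
  | or => cases hσ

/-- Replacing one number in a family by a smaller one makes the sum smaller. -/
theorem sum_update_lt {ι : Type*} [Fintype ι] [DecidableEq ι] (n : ι → ℕ) (i : ι) {k : ℕ}
    (h : k < n i) : ∑ j, Function.update n i k j < ∑ j, n j := by
  refine Finset.sum_lt_sum (fun j _ => ?_) ⟨i, Finset.mem_univ i, by simpa using h⟩
  by_cases hj : j = i
  · subst hj; simpa using h.le
  · simp [hj]

theorem forall_update {ι : Type*} [DecidableEq ι] {T : Type*} {P : ι → T → ℕ → Prop}
    {a : ι → T} {n : ι → ℕ} (h : ∀ j, P j (a j) (n j)) {i : ι} {t : T} {k : ℕ} (ht : P i t k) :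
    ∀ j, P j (Function.update a i t j) (Function.update n i k j) := by
  intro j
  by_cases hj : j = i
  · subst hj; simpa using ht
  · simpa [hj] using h j

/-- Induction on the total number of definite components of all arguments. A distribution step
duplicates the other arguments but splits a count `k + k'` into `k` and `k'`, both positive, so this
total drops in each of the two resulting terms. -/
theorem DefiniteJoin.exists_fc (f : L.star.F) (N : ℕ) (a : Fin (L.star.arF f) → STm L)
    (n : Fin (L.star.arF f) → ℕ) (h : ∀ i, DefiniteJoin Ω ε (L.star.otF f i) (a i) (n i))
    (hN : ∑ i, n i = N) :
    ∃ u k, SkelRewrite .pos (.fc f a) u ∧ DefiniteJoin Ω ε .pos u k := by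
  induction N using Nat.strong_induction_on generalizing a n with
  | _ N IH =>
    subst hN
    by_cases hall : ∀ i, Definite Ω ε (L.star.otF f i) (a i)
    · exact ⟨_, _, .refl, .single (.fc f a hall)⟩
    · push Not at hall
      obtain ⟨i, hi⟩ := hall
      have key : ∀ t t' k k', DefiniteJoin Ω ε (L.star.otF f i) t k →
          DefiniteJoin Ω ε (L.star.otF f i) t' k' → n i = k + k' →
          Dist false .pos (.fc f a)
            (.or (.fc f (Function.update a i t)) (.fc f (Function.update a i t'))) →
          ∃ u k, SkelRewrite .pos (.fc f a) u ∧ DefiniteJoin Ω ε .pos u k := by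
        intro t t' k k' ht ht' hk hdist
        have := ht.pos
        have := ht'.pos
        obtain ⟨u, l, hu, hu'⟩ := IH _ (sum_update_lt n i (k := k) (by omega)) _ _
          (forall_update (P := fun j => DefiniteJoin Ω ε (L.star.otF f j)) h ht) rfl
        obtain ⟨w, m, hw, hw'⟩ := IH _ (sum_update_lt n i (k := k') (by omega)) _ _
          (forall_update (P := fun j => DefiniteJoin Ω ε (L.star.otF f j)) h ht') rfl
        exact ⟨_, _, .head (.here (.inl hdist)) (AtNode.rtg_or hu hw), .or hu' hw'⟩
      have hai := h i
      generalize hσ : L.star.otF f i = σ at hai hi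
      generalize hs : a i = s at hai hi
      generalize hm : n i = m at hai
      cases hai with
      | single h => exact absurd h hi
      | @or t t' k k' h1 h2 =>
        rw [hσ] at key
        exact key t t' k k' h1 h2 hm (.f_pos _ _ f a i t t' (fun _ => rfl) hσ hs)
      | @and t t' k k' h1 h2 =>
        rw [hσ] at key
        exact key t t' k k' h1 h2 hm (.f_neg _ _ f a i t t' (fun _ => rfl) hσ hs)

theorem DefiniteJoin.exists_gc (g : L.star.G) (N : ℕ) (a : Fin (L.star.arG g) → STm L)
    (n : Fin (L.star.arG g) → ℕ) (h : ∀ i, DefiniteJoin Ω ε (L.star.otG g i).flip (a i) (n i))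
    (hN : ∑ i, n i = N) :
    ∃ u k, SkelRewrite .neg (.gc g a) u ∧ DefiniteJoin Ω ε .neg u k := by
  induction N using Nat.strong_induction_on generalizing a n with
  | _ N IH =>
    subst hN
    by_cases hall : ∀ i, Definite Ω ε (L.star.otG g i).flip (a i)
    · exact ⟨_, _, .refl, .single (.gc g a hall)⟩
    · push Not at hall
      obtain ⟨i, hi⟩ := hall
      have key : ∀ t t' k k', DefiniteJoin Ω ε (L.star.otG g i).flip t k →
          DefiniteJoin Ω ε (L.star.otG g i).flip t' k' → n i = k + k' →
          Dist false .neg (.gc g a)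
            (.and (.gc g (Function.update a i t)) (.gc g (Function.update a i t'))) →
          ∃ u k, SkelRewrite .neg (.gc g a) u ∧ DefiniteJoin Ω ε .neg u k := by
        intro t t' k k' ht ht' hk hdist
        have := ht.pos
        have := ht'.pos
        obtain ⟨u, l, hu, hu'⟩ := IH _ (sum_update_lt n i (k := k) (by omega)) _ _
          (forall_update (P := fun j => DefiniteJoin Ω ε (L.star.otG g j).flip) h ht) rfl
        obtain ⟨w, m, hw, hw'⟩ := IH _ (sum_update_lt n i (k := k') (by omega)) _ _
          (forall_update (P := fun j => DefiniteJoin Ω ε (L.star.otG g j).flip) h ht') rfl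
        exact ⟨_, _, .head (.here (.inl hdist)) (AtNode.rtg_and hu hw), .and hu' hw'⟩
      have hai := h i
      generalize hσ : (L.star.otG g i).flip = σ at hai hi
      generalize hs : a i = s at hai hi
      generalize hm : n i = m at hai
      cases hai with
      | single h => exact absurd h hi
      | @or t t' k k' h1 h2 =>
        rw [hσ] at key
        exact key t t' k k' h1 h2 hm
          (.g_neg _ _ g a i t t' (fun _ => rfl) (Pol.flip_injective hσ) hs)
      | @and t t' k k' h1 h2 =>
        rw [hσ] at key
        exact key t t' k k' h1 h2 hm
          (.g_pos _ _ g a i t t' (fun _ => rfl) (Pol.flip_injective hσ) hs)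

/-- A Skeleton over critical PIA trees can be rewritten into `⊥^σ` or into a join (meet) of definite
terms. -/
theorem Skel.exists_definiteJoin {σ : Pol} {s : STm L} (h : Skel Ω ε σ s) :
    SkelRewrite σ s (botPow σ) ∨ ∃ s' n, SkelRewrite σ s s' ∧ DefiniteJoin Ω ε σ s' n := by
  induction h with
  | pia h => exact .inr ⟨_, _, .refl, .single (.pia h)⟩
  | top σ =>
    cases σ
    exacts [.inr ⟨_, _, .refl, .single (.const .pos)⟩, .inl .refl]
  | bot σ =>
    cases σ
    exacts [.inl .refl, .inr ⟨_, _, .refl, .single (.const .neg)⟩]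
  | @and σ s t _ _ ihs iht =>
    cases σ with
    | pos =>
      rcases ihs with ihs | ⟨s', m, hs, hs'⟩
      · exact .inl ((AtNode.rtg_and ihs .refl).tail (.here (.inr (.bot_and _ _ _))))
      rcases iht with iht | ⟨t', n, ht, ht'⟩
      · exact .inl ((AtNode.rtg_and .refl iht).tail (.here (.inr (.and_bot _ _ _))))
      obtain ⟨u, k, hu, hu'⟩ := hs'.exists_and ht'
      exact .inr ⟨u, k, (AtNode.rtg_and hs ht).trans hu, hu'⟩
    | neg =>
      rcases ihs with ihs | ⟨s', m, hs, hs'⟩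
      · have := (AtNode.rtg_and ihs (.refl (a := t))).tail (.here (.inr (.top_and _ _ _)))
        exact iht.imp this.trans fun ⟨t', n, ht, ht'⟩ => ⟨t', n, this.trans ht, ht'⟩
      rcases iht with iht | ⟨t', n, ht, ht'⟩
      · exact .inr ⟨s', m, (AtNode.rtg_and hs iht).tail (.here (.inr (.and_top _ _ _))), hs'⟩
      exact .inr ⟨_, _, AtNode.rtg_and hs ht, .and hs' ht'⟩
  | @or σ s t _ _ ihs iht =>
    cases σ with
    | neg =>
      rcases ihs with ihs | ⟨s', m, hs, hs'⟩
      · exact .inl ((AtNode.rtg_or ihs .refl).tail (.here (.inr (.top_or _ _ _))))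
      rcases iht with iht | ⟨t', n, ht, ht'⟩
      · exact .inl ((AtNode.rtg_or .refl iht).tail (.here (.inr (.or_top _ _ _))))
      obtain ⟨u, k, hu, hu'⟩ := hs'.exists_or ht'
      exact .inr ⟨u, k, (AtNode.rtg_or hs ht).trans hu, hu'⟩
    | pos =>
      rcases ihs with ihs | ⟨s', m, hs, hs'⟩
      · have := (AtNode.rtg_or ihs (.refl (a := t))).tail (.here (.inr (.bot_or _ _ _)))
        exact iht.imp this.trans fun ⟨t', n, ht, ht'⟩ => ⟨t', n, this.trans ht, ht'⟩
      rcases iht with iht | ⟨t', n, ht, ht'⟩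
      · exact .inr ⟨s', m, (AtNode.rtg_or hs iht).tail (.here (.inr (.or_bot _ _ _))), hs'⟩
      exact .inr ⟨_, _, AtNode.rtg_or hs ht, .or hs' ht'⟩
  | fc f a _ ih =>
    -- An argument reducing to its own bottom annihilates the whole term; otherwise every argument
    -- has a definite form.
    by_cases hbot : ∃ i, SkelRewrite (L.star.otF f i) (a i) (botPow (L.star.otF f i))
    · obtain ⟨i, hi⟩ := hbot
      left
      refine (skelRewrite_fc f (a' := Function.update a i (botPow (L.star.otF f i)))
        fun j => ?_).tail (.here (.inr (.f _ _ f _ i (by simp))))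
      by_cases hj : j = i
      · subst hj; simpa using hi
      · simpa [hj] using .refl
    · push Not at hbot
      choose a' n ha ha' using fun i => (ih i).resolve_left (hbot i)
      obtain ⟨u, k, hu, hu'⟩ := DefiniteJoin.exists_fc f _ a' n ha' rfl
      exact .inr ⟨u, k, (skelRewrite_fc f ha).trans hu, hu'⟩
  | gc g a _ ih =>
    by_cases hbot : ∃ i, SkelRewrite (L.star.otG g i).flip (a i) (topPow (L.star.otG g i))
    · obtain ⟨i, hi⟩ := hbot
      left
      refine (skelRewrite_gc g (a' := Function.update a i (topPow (L.star.otG g i)))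
        fun j => ?_).tail (.here (.inr (.g _ _ g _ i (by simp))))
      by_cases hj : j = i
      · subst hj; simpa using hi
      · simpa [hj] using .refl
    · push Not at hbot
      simp only [botPow_flip] at ih
      choose a' n ha ha' using fun i => (ih i).resolve_left (hbot i)
      obtain ⟨u, k, hu, hu'⟩ := DefiniteJoin.exists_gc g _ a' n ha' rfl
      exact .inr ⟨u, k, (skelRewrite_gc g ha).trans hu, hu'⟩

/-! ### Preprocessing -/

theorem AtNode.or_iff {R R' : Bool → Pol → STm L → STm L → Prop} {b : Bool} {σ : Pol}
    {s s' : STm L} (h : AtNode (fun b σ s s' => R b σ s s' ∨ R' b σ s s') b σ s s') :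
    AtNode R b σ s s' ∨ AtNode R' b σ s s' := by
  induction h with
  | here h => exact h.imp .here .here
  | and_left t _ ih => exact ih.imp (.and_left t) (.and_left t)
  | and_right t _ ih => exact ih.imp (.and_right t) (.and_right t)
  | or_left t _ ih => exact ih.imp (.or_left t) (.or_left t)
  | or_right t _ ih => exact ih.imp (.or_right t) (.or_right t)
  | fc f a i _ ih => exact ih.imp (.fc f a i) (.fc f a i)
  | gc g a i _ ih => exact ih.imp (.gc g a i) (.gc g a i)

theorem Preprocess.of_step {e : SIneq L} {es : List (SIneq L)} (h : PreStep e es) :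
    Preprocess [e] es :=
  .single ⟨[], [], e, es, h, rfl, by simp⟩

theorem Preprocess.append_right {E E' : List (SIneq L)} (h : Preprocess E E')
    (Δ : List (SIneq L)) : Preprocess (E ++ Δ) (E' ++ Δ) := by
  refine h.lift (· ++ Δ) ?_
  rintro _ _ ⟨Γ, Δ', e, es, h, rfl, rfl⟩
  exact ⟨Γ, Δ' ++ Δ, e, es, h, by simp, by simp⟩

theorem Preprocess.append_left {E E' : List (SIneq L)} (h : Preprocess E E')
    (Γ : List (SIneq L)) : Preprocess (Γ ++ E) (Γ ++ E') := by
  refine h.lift (Γ ++ ·) ?_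
  rintro _ _ ⟨Γ', Δ, e, es, h, rfl, rfl⟩
  exact ⟨Γ ++ Γ', Δ, e, es, h, by simp, by simp⟩

theorem preprocess_of_skelRewrite {σ : Pol} {s s' : STm L} (h : SkelRewrite σ s s') (t : STm L) :
    Preprocess [pineq σ s t] [pineq σ s' t] := by
  induction h with
  | refl => exact .refl
  | tail _ h ih =>
    refine ih.trans (Preprocess.of_step ?_)
    rcases AtNode.or_iff h with h | h <;> cases σ
    exacts [.dist_left h, .dist_right h, .const_left h, .const_right h]

theorem preprocess_of_definiteJoin {σ : Pol} {s : STm L} {n : ℕ} (h : DefiniteJoin Ω ε σ s n)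
    (t : STm L) :
    ∃ ss : List (STm L), (∀ s' ∈ ss, Definite Ω ε σ s') ∧
      Preprocess [pineq σ s t] (ss.map fun s' => pineq σ s' t) := by
  have join : ∀ {σ : Pol} {s s₁ s₂ : STm L},
      PreStep (pineq σ s t) [pineq σ s₁ t, pineq σ s₂ t] →
      (∃ ss : List (STm L), (∀ s' ∈ ss, Definite Ω ε σ s') ∧
        Preprocess [pineq σ s₁ t] (ss.map fun s' => pineq σ s' t)) →
      (∃ ss : List (STm L), (∀ s' ∈ ss, Definite Ω ε σ s') ∧
        Preprocess [pineq σ s₂ t] (ss.map fun s' => pineq σ s' t)) →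
      ∃ ss : List (STm L), (∀ s' ∈ ss, Definite Ω ε σ s') ∧
        Preprocess [pineq σ s t] (ss.map fun s' => pineq σ s' t) := by
    rintro σ s s₁ s₂ hstep ⟨l₁, h₁, p₁⟩ ⟨l₂, h₂, p₂⟩
    refine ⟨l₁ ++ l₂, fun s' hs' => (List.mem_append.1 hs').elim (h₁ s') (h₂ s'), ?_⟩
    rw [List.map_append]
    exact (Preprocess.of_step hstep).trans
      ((p₁.append_right [pineq σ s₂ t]).trans (p₂.append_left _))
  induction h with
  | @single σ s h => exact ⟨[s], by simpa using h, .refl⟩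
  | or _ _ ih1 ih2 => exact join (.split (.join _ _ _)) ih1 ih2
  | and _ _ ih1 ih2 => exact join (.split (.meet _ _ _)) ih1 ih2

/-- Preprocessing an inequality whose head is a Skeleton over critical PIA trees. -/
theorem Skel.exists_preprocess {σ : Pol} {s : STm L} (h : Skel Ω ε σ s) (t : STm L) :
    ∃ ss : List (STm L), (∀ s' ∈ ss, Definite Ω ε σ s') ∧
      Preprocess [pineq σ s t] (ss.map fun s' => pineq σ s' t) := by
  rcases h.exists_definiteJoin with h | ⟨s', n, h, h'⟩
  · refine ⟨[], by simp, (preprocess_of_skelRewrite h t).trans (Preprocess.of_step (.taut ?_))⟩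
    cases σ
    exacts [.bot t, .top t]
  · obtain ⟨ss, hss, h''⟩ := preprocess_of_definiteJoin h' t
    exact ⟨ss, hss, (preprocess_of_skelRewrite h t).trans h''⟩

end ALBA

namespace ALBA

open Relation

variable {L : DLESig} {Ω : ℕ → ℕ → Prop} {ε : ℕ → Pol}

/-! ### Approximation of the critical PIA trees -/

/-- One approximation step on a signed tree; the state also records the next unused index and the
premises produced so far. -/
inductive ApproxStep (σ : Pol) : STm L × ℕ × List (SIneq L) → STm L × ℕ × List (SIneq L) → Prop
  | mk {τ s u s' n Γ} : ApproxAt (.var (apv τ n)) σ s τ u s' →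
      ApproxStep σ (s, n, Γ) (s', n + 1, pineq τ (.var (apv τ n)) u :: Γ)

theorem ApproxStep.lift {σ δ : Pol} {F : STm L → STm L}
    (hF : ∀ x τ s u s', ApproxAt x δ s τ u s' → ApproxAt x σ (F s) τ u (F s'))
    {s s' : STm L} {n n' : ℕ} {Γ Γ' : List (SIneq L)}
    (h : ReflTransGen (ApproxStep δ) (s, n, Γ) (s', n', Γ')) :
    ReflTransGen (ApproxStep σ) (F s, n, Γ) (F s', n', Γ') :=
  h.lift (fun st => (F st.1, st.2)) fun _ _ ⟨h⟩ => ⟨hF _ _ _ _ _ h⟩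

/-- The nominals (for positive `ρ`) and conominals (for negative `ρ`) with index in `[n, n')`. -/
def Named (n n' : ℕ) (v : Var) (ρ : Pol) : Prop := ∃ k, n ≤ k ∧ k < n' ∧ v = apv ρ k

theorem Named.mono {n n' m m' : ℕ} {v : Var} {ρ : Pol} (h : Named n n' v ρ) (hm : m ≤ n)
    (hm' : n' ≤ m') : Named m m' v ρ :=
  let ⟨k, h1, h2, h3⟩ := h
  ⟨k, hm.trans h1, h2.trans_le hm', h3⟩

/-- The premises produced by approximating a critical PIA tree. -/
def CritPremise (Ω : ℕ → ℕ → Prop) (ε : ℕ → Pol) (n : ℕ) (e : SIneq L) : Prop :=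
  ∃ τ k γ, n ≤ k ∧ e = pineq τ (.var (apv τ k)) γ ∧ CritPIA Ω ε τ γ

theorem CritPremise.mono {n m : ℕ} {e : SIneq L} (h : CritPremise Ω ε n e) (hm : m ≤ n) :
    CritPremise Ω ε m e :=
  let ⟨τ, k, γ, h1, h2⟩ := h
  ⟨τ, k, γ, hm.trans h1, h2⟩

/-- Approximating the critical PIA trees of `σ s` leads to a scattered primitive term. -/
def Approximable (Ω : ℕ → ℕ → Prop) (ε : ℕ → Pol) (σ : Pol) (s : STm L) : Prop :=
  ∀ (n : ℕ) (Γ : List (SIneq L)), ∃ s' n' Δ,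
    ReflTransGen (ApproxStep σ) (s, n, Γ) (s', n', Δ ++ Γ) ∧ n ≤ n' ∧ s'.IsPrim σ ∧
    (∀ v ρ, s'.OccSign σ v ρ → Named n n' v ρ) ∧ s'.Scattered ∧ ∀ e ∈ Δ, CritPremise Ω ε n e

/-- The arguments are approximated one after the other while the counter runs on. Different
arguments thus receive symbols from disjoint index intervals, which keeps the compound term
scattered. -/
theorem exists_approx_family {m : ℕ} {δ : Fin m → Pol} {σ : Pol} (F : (Fin m → STm L) → STm L)
    (hF : ∀ a i x τ u s', ApproxAt x (δ i) (a i) τ u s' →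
      ApproxAt x σ (F a) τ u (F (Function.update a i s')))
    {a : Fin m → STm L} (ha : ∀ i, Approximable Ω ε (δ i) (a i)) (n : ℕ) (Γ : List (SIneq L)) :
    ∃ a' n' Δ, ReflTransGen (ApproxStep σ) (F a, n, Γ) (F a', n', Δ ++ Γ) ∧ n ≤ n' ∧
      (∀ i, (a' i).IsPrim (δ i)) ∧ (∀ i v ρ, (a' i).OccSign (δ i) v ρ → Named n n' v ρ) ∧
      (∀ v, ∑ i, (a' i).occ v ≤ 1) ∧ ∀ e ∈ Δ, CritPremise Ω ε n e := by
  have key : ∀ S : Finset (Fin m), ∃ a' n' Δ,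
      ReflTransGen (ApproxStep σ) (F a, n, Γ) (F a', n', Δ ++ Γ) ∧ n ≤ n' ∧
      (∀ i ∉ S, a' i = a i) ∧ (∀ i ∈ S, (a' i).IsPrim (δ i)) ∧
      (∀ i ∈ S, ∀ v ρ, (a' i).OccSign (δ i) v ρ → Named n n' v ρ) ∧
      (∀ v, ∑ i ∈ S, (a' i).occ v ≤ 1) ∧ ∀ e ∈ Δ, CritPremise Ω ε n e := by
    intro S
    induction S using Finset.induction_on with
    | empty => exact ⟨a, n, [], .refl, le_rfl, by simp, by simp, by simp, by simp, by simp⟩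
    | insert i S hi ih =>
      obtain ⟨a', n', Δ, h1, h2, h3, h4, h5, h6, h7⟩ := ih
      obtain ⟨x, n'', Δ', g1, g2, g3, g4, g5, g6⟩ := ha i n' (Δ ++ Γ)
      have hne : ∀ j ∈ S, j ≠ i := fun j hj hji => hi (hji ▸ hj)
      refine ⟨Function.update a' i x, n'', Δ' ++ Δ, ?_, h2.trans g2, ?_, ?_, ?_, ?_, ?_⟩
      · rw [← h3 i hi] at g1
        have := ApproxStep.lift (σ := σ) (F := fun y => F (Function.update a' i y))
          (fun x τ s u s' h => by simpa using hF (Function.update a' i s) i x τ u s' (by simpa using h)) g1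
        rw [Function.update_eq_self] at this
        rw [List.append_assoc]
        exact h1.trans this
      · intro j hj
        simp only [Finset.mem_insert, not_or] at hj
        rw [Function.update_of_ne hj.1, h3 j hj.2]
      · intro j hj
        rcases Finset.mem_insert.1 hj with rfl | hj
        · simpa using g3
        · rw [Function.update_of_ne (hne j hj)]
          exact h4 j hj
      · intro j hj v ρ
        rcases Finset.mem_insert.1 hj with rfl | hj
        · rw [Function.update_self]
          exact fun h => (g4 v ρ h).mono h2 le_rfl
        · rw [Function.update_of_ne (hne j hj)]
          exact fun h => (h5 j hj v ρ h).mono le_rfl g2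
      · intro v
        rw [Finset.sum_insert hi, Function.update_self,
          Finset.sum_congr rfl fun j hj => by rw [Function.update_of_ne (hne j hj)]]
        -- A variable shared by the new argument and an earlier one would have an index both at
        -- least `n'` and below `n'`.
        by_contra! hlt
        have hx := g5 v
        have hS := h6 v
        have hx0 : 0 < x.occ v := by omega
        have hS0 : 0 < ∑ j ∈ S, (a' j).occ v := by omega
        obtain ⟨j, hj, hj0⟩ := Finset.sum_pos_iff.1 hS0
        obtain ⟨ρ, hρ⟩ := (Tm.occurs_iff _ (δ i) v).1 (Tm.occurs_of_occ_pos hx0)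
        obtain ⟨ρ', hρ'⟩ := (Tm.occurs_iff _ (δ j) v).1 (Tm.occurs_of_occ_pos hj0)
        obtain ⟨k, hk, -, hv⟩ := g4 v ρ hρ
        obtain ⟨k', -, hk', hv'⟩ := h5 j hj v ρ' hρ'
        have := (apv_inj.1 (hv.symm.trans hv')).2
        omega
      · intro e he
        rcases List.mem_append.1 he with he | he
        · exact (g6 e he).mono h2
        · exact h7 e he
  obtain ⟨a', n', Δ, h1, h2, -, h4, h5, h6, h7⟩ := key Finset.univ
  exact ⟨a', n', Δ, h1, h2, fun i => h4 i (Finset.mem_univ i), fun i => h5 i (Finset.mem_univ i),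
    h6, h7⟩

/-- Only critical PIA trees are replaced, each by a single symbol. The Skeleton nodes left above
them are those of a primitive term of sign `σ`. -/
theorem Definite.approximable {σ : Pol} {s : STm L} (h : Definite Ω ε σ s) :
    Approximable Ω ε σ s := by
  induction h with
  | @pia σ s h =>
    intro n Γ
    refine ⟨.var (apv σ n), n + 1, [pineq σ (.var (apv σ n)) s], .single ⟨.here σ s⟩, by omega,
      trivial, ?_, ?_, ?_⟩
    · rintro v ρ ⟨rfl, rfl⟩
      exact ⟨n, le_rfl, by omega, rfl⟩
    · intro v
      simp only [Tm.occ]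
      split_ifs <;> simp
    · simp only [List.mem_singleton, forall_eq]
      exact ⟨σ, n, s, le_rfl, rfl, h⟩
  | const σ =>
    intro n Γ
    refine ⟨topPow σ, n, [], .refl, le_rfl, isPrim_topPow σ,
      fun v ρ h => (not_occSign_topPow h).elim, fun v => ?_, by simp⟩
    cases σ <;> simp [topPow, Tm.occ]
  | @and s t _ _ ihs iht =>
    intro n Γ
    obtain ⟨a', n', Δ, h1, h2, h3, h4, h5, h6⟩ := exists_approx_family (σ := .pos)
      (δ := fun _ : Fin 2 => .pos) (fun a => .and (a 0) (a 1)) (by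
        intro a i x τ u s' h
        fin_cases i
        · exact .and_left _ h
        · exact .and_right _ h) (a := ![s, t]) (Fin.forall_fin_two.2 ⟨ihs, iht⟩) n Γ
    exact ⟨_, n', Δ, h1, h2, ⟨h3 0, h3 1⟩, fun v ρ h => h.elim (h4 0 v ρ) (h4 1 v ρ),
      fun v => by simpa [Tm.occ, Fin.sum_univ_two] using h5 v, h6⟩
  | @or s t _ _ ihs iht =>
    intro n Γ
    obtain ⟨a', n', Δ, h1, h2, h3, h4, h5, h6⟩ := exists_approx_family (σ := .neg)
      (δ := fun _ : Fin 2 => .neg) (fun a => .or (a 0) (a 1)) (by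
        intro a i x τ u s' h
        fin_cases i
        · exact .or_left _ h
        · exact .or_right _ h) (a := ![s, t]) (Fin.forall_fin_two.2 ⟨ihs, iht⟩) n Γ
    exact ⟨_, n', Δ, h1, h2, ⟨h3 0, h3 1⟩, fun v ρ h => h.elim (h4 0 v ρ) (h4 1 v ρ),
      fun v => by simpa [Tm.occ, Fin.sum_univ_two] using h5 v, h6⟩
  | fc f a _ ih =>
    intro n Γ
    obtain ⟨a', n', Δ, h1, h2, h3, h4, h5, h6⟩ := exists_approx_family (σ := .pos)
      (δ := L.star.otF f) (fun a => .fc f a) (fun a i x τ u s' h => .fc f a i h) ih n Γ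
    exact ⟨_, n', Δ, h1, h2, ⟨rfl, h3⟩, fun v ρ ⟨i, h⟩ => h4 i v ρ h, h5, h6⟩
  | gc g a _ ih =>
    intro n Γ
    obtain ⟨a', n', Δ, h1, h2, h3, h4, h5, h6⟩ := exists_approx_family (σ := .neg)
      (δ := fun i => (L.star.otG g i).flip) (fun a => .gc g a)
      (fun a i x τ u s' h => .gc g a i h) ih n Γ
    exact ⟨_, n', Δ, h1, h2, ⟨rfl, h3⟩, fun v ρ ⟨i, h⟩ => h4 i v ρ h, h5, h6⟩

/-- All nominals and conominals of the quasi-inequality have an index below `n`. -/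
def QIneq.Bounded (q : QIneq L) (n : ℕ) : Prop := ∀ σ k, q.Occurs (apv σ k) → k < n

theorem RedStep.approx {σ τ : Pol} {l k : ℕ} {s u s' : STm L} {Γ : List (SIneq L)} {c : SIneq L}
    (hk : ¬ QIneq.Occurs ⟨pineq σ (.var (apv σ l)) s :: Γ, c⟩ (apv τ k))
    (h : ApproxAt (.var (apv τ k)) σ s τ u s') :
    RedStep ⟨pineq σ (.var (apv σ l)) s :: Γ, c⟩
      ⟨pineq σ (.var (apv σ l)) s' :: pineq τ (.var (apv τ k)) u :: Γ, c⟩ := by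
  cases σ <;> cases τ
  exacts [.approx_left_nom hk h, .approx_left_conom hk h, .approx_right_nom hk h,
    .approx_right_conom hk h]

/-- The counter bounds all indices in use, which is the invariant that supplies the freshness side
condition of the approximation rules. -/
theorem redSteps_of_approxSteps {σ : Pol} {l : ℕ} {c : SIneq L}
    {x y : STm L × ℕ × List (SIneq L)} (h : ReflTransGen (ApproxStep σ) x y)
    (hb : QIneq.Bounded ⟨pineq σ (.var (apv σ l)) x.1 :: x.2.2, c⟩ x.2.1) :
    ReflTransGen RedStep ⟨pineq σ (.var (apv σ l)) x.1 :: x.2.2, c⟩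
      ⟨pineq σ (.var (apv σ l)) y.1 :: y.2.2, c⟩ := by
  induction h using ReflTransGen.head_induction_on with
  | refl => exact .refl
  | head h _ ih =>
    obtain @⟨τ, s, u, s', n, Γ, h⟩ := h
    refine .head (.approx (fun hk => lt_irrefl _ (hb _ _ hk)) h) (ih ?_)
    have hvar : ∀ {τ k ρ j}, (Tm.var (apv τ k) : STm L).Occurs (apv ρ j) → k = j := by
      rintro τ k ρ j ⟨_, h, -⟩
      exact (apv_inj.1 h).2
    rintro ρ j (⟨e, he, hj⟩ | hj)
    · rcases List.mem_cons.1 he with rfl | he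
      · rcases occurs_pineq.1 hj with hj | hj
        · exact (hb ρ j (.inl ⟨_, List.mem_cons_self, occurs_pineq.2 (.inl hj)⟩)).trans
            (Nat.lt_succ_self _)
        · obtain ⟨θ, hj⟩ := (Tm.occurs_iff _ σ _).1 hj
          rcases h.occSign_of_result hj with hj | hj
          · exact (hb ρ j (.inl ⟨_, List.mem_cons_self, occurs_pineq.2 (.inr hj.occurs)⟩)).trans
              (Nat.lt_succ_self _)
          · exact (hvar hj.occurs).symm ▸ Nat.lt_succ_self _
      · rcases List.mem_cons.1 he with rfl | he
        · rcases occurs_pineq.1 hj with hj | hj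
          · exact (hvar hj).symm ▸ Nat.lt_succ_self _
          · obtain ⟨θ, hj⟩ := (Tm.occurs_iff _ τ _).1 hj
            exact (hb ρ j (.inl ⟨_, List.mem_cons_self, occurs_pineq.2
              (.inr (h.occSign_of_subterm hj).occurs)⟩)).trans (Nat.lt_succ_self _)
        · exact (hb ρ j (.inl ⟨e, List.mem_cons_of_mem _ he, hj⟩)).trans (Nat.lt_succ_self _)
    · exact (hb ρ j (.inr hj)).trans (Nat.lt_succ_self _)

end ALBA

namespace ALBA

open Relation

variable {L : DLESig} {Ω : ℕ → ℕ → Prop} {ε : ℕ → Pol}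

/-! ### Residuation -/

/-- Terms that are primitive of sign `δ` up to constants, in which nominals occur positively,
conominals negatively and variables as `ε` says, and which avoid the nominal and the conominal of the
first approximation. -/
structure Regular (ε : ℕ → Pol) (δ : Pol) (X : STm L) : Prop where
  prePrim : X.PrePrim δ
  uniform : Tm.Uniform (extPol ε) δ X
  not_zero : ∀ ρ, ¬ X.Occurs (apv ρ 0)

/-- The variables of `X` are below all critical variables of `σ γ`. -/
def VarsBelow (Ω : ℕ → ℕ → Prop) (ε : ℕ → Pol) (X : STm L) (σ : Pol) (γ : STm L) : Prop :=
  ∀ p, γ.OccSign σ (.prop p) (ε p) → ∀ q, X.Occurs (.prop q) → Ω q p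

theorem Side.regular {σ τ : Pol} {s u : STm L} (h : Side Ω ε σ s τ u) : Regular ε τ.flip u where
  prePrim := h.prePrim
  uniform v ρ hv := Pol.flip_injective (h.uniform v _ ((Tm.occSign_flip u τ v ρ).1 hv))
  not_zero ρ hρ := by
    obtain ⟨p, hp⟩ := h.prop_of_occurs _ hρ
    exact apv_ne_prop hp

/-- A premise by which the variable `p` is bounded. -/
def solvedPremise (ε : ℕ → Pol) (x : STm L × ℕ) : SIneq L :=
  pineq (ε x.2) x.1 (.var (.prop x.2))

/-- The term bounding a variable is regular and contains only smaller variables. -/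
def Solution (Ω : ℕ → ℕ → Prop) (ε : ℕ → Pol) (x : STm L × ℕ) : Prop :=
  Regular ε (ε x.2) x.1 ∧ ∀ q, x.1.Occurs (.prop q) → Ω q x.2

theorem RedStep.resid_pineq {σ τ : Pol} {a b a' b' : STm L} {Γ : List (SIneq L)} {c : SIneq L}
    (h : Resid (pineq σ a b) (pineq τ a' b')) :
    RedStep ⟨pineq σ a b :: Γ, c⟩ ⟨pineq τ a' b' :: Γ, c⟩ :=
  .resid h

/-- The premise with a term `X` of sign `σ` on one side and a critical PIA tree on the other one can be
transformed into premises bounding variables. -/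
def Solvable (Ω : ℕ → ℕ → Prop) (ε : ℕ → Pol) (σ : Pol) (γ : STm L) : Prop :=
  ∀ X, Regular ε σ X → VarsBelow Ω ε X σ γ → ∃ l : List (STm L × ℕ), (∀ x ∈ l, Solution Ω ε x) ∧
    ∀ Γ c, ReflTransGen RedStep ⟨pineq σ X γ :: Γ, c⟩ ⟨l.map (solvedPremise ε) ++ Γ, c⟩

/-- The bounding term is copied into both premises; copying is harmless because scatteredness is
required of the head only. -/
theorem Solvable.split {σ : Pol} {γ γ₁ γ₂ : STm L} (h₁ : Solvable Ω ε σ γ₁)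
    (h₂ : Solvable Ω ε σ γ₂)
    (hγ : ∀ v ρ, γ.OccSign σ v ρ ↔ γ₁.OccSign σ v ρ ∨ γ₂.OccSign σ v ρ)
    (hs : ∀ X, Split (pineq σ X γ) [pineq σ X γ₁, pineq σ X γ₂]) : Solvable Ω ε σ γ := by
  intro X hX hb
  obtain ⟨l₁, s₁, r₁⟩ := h₁ X hX fun p hp => hb p ((hγ _ _).2 (.inl hp))
  obtain ⟨l₂, s₂, r₂⟩ := h₂ X hX fun p hp => hb p ((hγ _ _).2 (.inr hp))
  refine ⟨l₂ ++ l₁, fun x hx => (List.mem_append.1 hx).elim (s₂ x) (s₁ x), fun Γ c => ?_⟩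
  refine .head (.split (hs X)) ((r₁ (pineq σ X γ₂ :: Γ) c).trans ?_)
  refine .head (.rearrange (Δ := pineq σ X γ₂ :: (l₁.map (solvedPremise ε) ++ Γ)) fun e => ?_) ?_
  · simp only [List.mem_append, List.mem_cons]
    tauto
  · rw [List.map_append, List.append_assoc]
    exact r₂ _ c

/-- Residuation in the `i`-th coordinate of an SRR node: the term `T X` is built by a residual from
`X` in the coordinate `i` and the side trees in the other ones. -/
theorem Solvable.residuate {m : ℕ} {σ σ' : Pol} {γ s : STm L} (δ : Fin m → Pol)
    (b : STm L → Fin m → STm L) (T : STm L → STm L) (hs : Solvable Ω ε σ' s)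
    (hprim : ∀ X, (∀ j, (b X j).PrePrim (δ j)) → (T X).PrePrim σ')
    (hocc : ∀ X v ρ, (T X).OccSign σ' v ρ → ∃ j, (b X j).OccSign (δ j) v ρ)
    (hb : ∀ X j, (b X j = X ∧ δ j = σ) ∨ ∃ τ, δ j = τ.flip ∧ Side Ω ε σ' s τ (b X j))
    (hγ : ∀ v ρ, s.OccSign σ' v ρ → γ.OccSign σ v ρ)
    (hr : ∀ X, Resid (pineq σ X γ) (pineq σ' (T X) s)) : Solvable Ω ε σ γ := by
  intro X hX hX'
  have key : ∀ j, Regular ε (δ j) (b X j) ∧ VarsBelow Ω ε (b X j) σ' s := by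
    intro j
    rcases hb X j with ⟨h1, h2⟩ | ⟨τ, h1, h2⟩
    · rw [h1, h2]
      exact ⟨hX, fun p hp => hX' p (hγ _ _ hp)⟩
    · rw [h1]
      exact ⟨h2.regular, h2.below⟩
  have hT : ∀ v, (T X).Occurs v → ∃ j, (b X j).Occurs v := by
    intro v hv
    obtain ⟨ρ, hv⟩ := (Tm.occurs_iff _ σ' v).1 hv
    obtain ⟨j, hj⟩ := hocc X v ρ hv
    exact ⟨j, hj.occurs⟩
  obtain ⟨l, h1, h2⟩ := hs (T X) ⟨hprim X fun j => (key j).1.prePrim, fun v ρ hv =>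
    let ⟨j, hj⟩ := hocc X v ρ hv
    (key j).1.uniform v ρ hj, fun ρ hρ =>
    let ⟨j, hj⟩ := hT _ hρ
    (key j).1.not_zero ρ hj⟩ fun p hp q hq =>
    let ⟨j, hj⟩ := hT _ hq
    (key j).2 p hp q hj
  exact ⟨l, h1, fun Γ c => .head (.resid_pineq (hr X)) (h2 Γ c)⟩

/-- Induction down the critical tree: the collected term grows by one residual at each node until a
critical leaf is reached. A residual belongs to `𝓕*` or to `𝓖*` according to the sign of the
argument it isolates, so the collected term stays primitive, and the side trees it absorbs are
regular by `Side.regular`. -/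
theorem CritPIA.solvable {σ : Pol} {γ : STm L} (h : CritPIA Ω ε σ γ) : Solvable Ω ε σ γ := by
  induction h with
  | var p =>
    intro X hX hb
    refine ⟨[(X, p)], ?_, fun Γ c => .refl⟩
    simp only [List.mem_singleton, forall_eq]
    exact ⟨hX, fun q hq => hb p ⟨rfl, rfl⟩ q hq⟩
  | and_pos _ _ ih1 ih2 => exact .split ih1 ih2 (fun _ _ => Iff.rfl) fun X => .meet X _ _
  | or_neg _ _ ih1 ih2 => exact .split ih1 ih2 (fun _ _ => Iff.rfl) fun X => .join _ _ X
  | @and_left s t _ hside ih =>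
    refine ih.residuate (m := 2) ![.neg, .pos] (fun X => ![X, t])
      (fun X => .gc (L := L.star) GStar.andRes₁ (![X, t] : Fin 2 → STm L)) ?_ ?_ ?_ ?_ ?_
    · exact fun X hX => ⟨rfl, Fin.forall_fin_two.2 ⟨hX 0, hX 1⟩⟩
    · exact fun X v ρ ⟨j, hj⟩ => ⟨j, by revert j; exact Fin.forall_fin_two.2 ⟨id, id⟩⟩
    · exact fun X => Fin.forall_fin_two.2 ⟨.inl ⟨rfl, rfl⟩, .inr ⟨.neg, rfl, hside⟩⟩
    · exact fun v ρ => .inl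
    · exact fun X => .and₁ s t X
  | @and_right s t _ hside ih =>
    refine ih.residuate (m := 2) ![.pos, .neg] (fun X => ![s, X])
      (fun X => .gc (L := L.star) GStar.andRes₂ (![s, X] : Fin 2 → STm L)) ?_ ?_ ?_ ?_ ?_
    · exact fun X hX => ⟨rfl, Fin.forall_fin_two.2 ⟨hX 0, hX 1⟩⟩
    · exact fun X v ρ ⟨j, hj⟩ => ⟨j, by revert j; exact Fin.forall_fin_two.2 ⟨id, id⟩⟩
    · exact fun X => Fin.forall_fin_two.2 ⟨.inr ⟨.neg, rfl, hside⟩, .inl ⟨rfl, rfl⟩⟩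
    · exact fun v ρ => .inr
    · exact fun X => .and₂ s t X
  | @or_left s t _ hside ih =>
    refine ih.residuate (m := 2) ![.pos, .neg] (fun X => ![X, t])
      (fun X => .fc (L := L.star) FStar.orRes₁ (![X, t] : Fin 2 → STm L)) ?_ ?_ ?_ ?_ ?_
    · exact fun X hX => ⟨rfl, Fin.forall_fin_two.2 ⟨hX 0, hX 1⟩⟩
    · exact fun X v ρ ⟨j, hj⟩ => ⟨j, by revert j; exact Fin.forall_fin_two.2 ⟨id, id⟩⟩
    · exact fun X => Fin.forall_fin_two.2 ⟨.inl ⟨rfl, rfl⟩, .inr ⟨.pos, rfl, hside⟩⟩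
    · exact fun v ρ => .inl
    · exact fun X => .or₁ s t X
  | @or_right s t _ hside ih =>
    refine ih.residuate (m := 2) ![.neg, .pos] (fun X => ![s, X])
      (fun X => .fc (L := L.star) FStar.orRes₂ (![s, X] : Fin 2 → STm L)) ?_ ?_ ?_ ?_ ?_
    · exact fun X hX => ⟨rfl, Fin.forall_fin_two.2 ⟨hX 0, hX 1⟩⟩
    · exact fun X v ρ ⟨j, hj⟩ => ⟨j, by revert j; exact Fin.forall_fin_two.2 ⟨id, id⟩⟩
    · exact fun X => Fin.forall_fin_two.2 ⟨.inr ⟨.pos, rfl, hside⟩, .inl ⟨rfl, rfl⟩⟩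
    · exact fun v ρ => .inr
    · exact fun X => .or₂ s t X
  | fc f a i _ hside ih =>
    -- The residual puts `X` at place `i` with the sign of the old node, and the side trees
    -- elsewhere with flipped sign, as `Solvable.residuate` expects.
    have hres := mul_resOT (L.otF f) .neg i
    have hb : ∀ X j, (Function.update a i X j = X ∧
        (Pol.neg.mul (L.otF f i)).mul (resOT (L.otF f) i j) = .neg) ∨
        ∃ τ, (Pol.neg.mul (L.otF f i)).mul (resOT (L.otF f) i j) = τ.flip ∧
          Side Ω ε (L.otF f i).flip (a i) τ (Function.update a i X j) := by
      intro X j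
      rw [hres j]
      by_cases hj : j = i
      · subst hj
        exact .inl ⟨Function.update_self .., if_pos rfl⟩
      · rw [if_neg hj, Function.update_of_ne hj]
        exact .inr ⟨_, rfl, hside j hj⟩
    cases hi : L.otF f i with
    | pos =>
      rw [hi] at ih hb
      exact ih.residuate (fun j => Pol.neg.mul (resOT (L.otF f) i j)) (fun X => Function.update a i X)
        (fun X => .gc (L := L.star) (GStar.sharp f i hi) (Function.update a i X))
        (fun X hX => ⟨rfl, hX⟩) (fun X v ρ h => h) hb
        (fun v ρ h => ⟨i, by
          show (a i).OccSign (Pol.neg.mul (L.otF f i)) v ρ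
          rw [hi]; exact h⟩) fun X => .f_pos f i hi a X
    | neg =>
      rw [hi] at ih hb
      exact ih.residuate (fun j => Pol.pos.mul (resOT (L.otF f) i j)) (fun X => Function.update a i X)
        (fun X => .fc (L := L.star) (FStar.sharp f i hi) (Function.update a i X))
        (fun X hX => ⟨rfl, hX⟩) (fun X v ρ h => h) hb
        (fun v ρ h => ⟨i, by
          show (a i).OccSign (Pol.neg.mul (L.otF f i)) v ρ
          rw [hi]; exact h⟩) fun X => .f_neg f i hi a X
  | gc g a i _ hside ih =>
    have hres := mul_resOT (L.otG g) .pos i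
    have hb : ∀ X j, (Function.update a i X j = X ∧
        (Pol.pos.mul (L.otG g i)).mul (resOT (L.otG g) i j) = .pos) ∨
        ∃ τ, (Pol.pos.mul (L.otG g i)).mul (resOT (L.otG g) i j) = τ.flip ∧
          Side Ω ε (L.otG g i) (a i) τ (Function.update a i X j) := by
      intro X j
      rw [hres j]
      by_cases hj : j = i
      · subst hj
        exact .inl ⟨Function.update_self .., if_pos rfl⟩
      · rw [if_neg hj, Function.update_of_ne hj]
        exact .inr ⟨_, rfl, hside j hj⟩
    cases hi : L.otG g i with
    | pos =>
      rw [hi] at ih hb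
      exact ih.residuate (fun j => Pol.pos.mul (resOT (L.otG g) i j)) (fun X => Function.update a i X)
        (fun X => .fc (L := L.star) (FStar.flat g i hi) (Function.update a i X))
        (fun X hX => ⟨rfl, hX⟩) (fun X v ρ h => h) hb
        (fun v ρ h => ⟨i, by
          show (a i).OccSign (Pol.pos.mul (L.otG g i)) v ρ
          rw [hi]; exact h⟩) fun X => .g_pos g i hi a X
    | neg =>
      rw [hi] at ih hb
      exact ih.residuate (fun j => Pol.neg.mul (resOT (L.otG g) i j)) (fun X => Function.update a i X)
        (fun X => .gc (L := L.star) (GStar.flat g i hi) (Function.update a i X))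
        (fun X hX => ⟨rfl, hX⟩) (fun X v ρ h => h) hb
        (fun v ρ h => ⟨i, by
          show (a i).OccSign (Pol.pos.mul (L.otG g i)) v ρ
          rw [hi]; exact h⟩) fun X => .g_neg g i hi a X

theorem regular_apv {ρ : Pol} {k : ℕ} (hk : k ≠ 0) : Regular ε ρ (.var (apv ρ k) : STm L) where
  prePrim := trivial
  uniform := by
    rintro v τ ⟨rfl, rfl⟩
    cases ρ <;> rfl
  not_zero := by
    rintro τ ⟨_, h, -⟩
    exact hk (apv_inj.1 h).2

/-- All premises arising by approximation are transformed into premises bounding variables. -/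
theorem exists_solve_premises (Δ : List (SIneq L)) (h : ∀ e ∈ Δ, CritPremise Ω ε 1 e) :
    ∃ l : List (STm L × ℕ), (∀ x ∈ l, Solution Ω ε x) ∧
      ∀ Γ c, ReflTransGen RedStep ⟨Δ ++ Γ, c⟩ ⟨l.map (solvedPremise ε) ++ Γ, c⟩ := by
  induction Δ with
  | nil => exact ⟨[], by simp, fun Γ c => .refl⟩
  | cons e Δ ih =>
    obtain ⟨l, h1, h2⟩ := ih fun e he => h e (List.mem_cons_of_mem _ he)
    obtain ⟨τ, k, γ, hk, rfl, hγ⟩ := h e List.mem_cons_self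
    obtain ⟨l', h1', h2'⟩ := hγ.solvable (.var (apv τ k)) (regular_apv (by omega)) (by
      rintro p - q ⟨_, h, -⟩
      exact (apv_ne_prop h).elim)
    refine ⟨l ++ l', fun x hx => (List.mem_append.1 hx).elim (h1 x) (h1' x), fun Γ c => ?_⟩
    refine (h2' (Δ ++ Γ) c).trans ?_
    refine .head (.rearrange (Δ := Δ ++ (l'.map (solvedPremise ε) ++ Γ)) fun e => ?_) ?_
    · simp only [List.mem_append]
      tauto
    · rw [List.map_append, List.append_assoc]
      exact h2 _ c

/-! ### Elimination of the variables -/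

theorem occSign_bigOp {σ τ ρ : Pol} {l : List (STm L)} {v : Var}
    (h : (bigOp σ l).OccSign τ v ρ) : ∃ α ∈ l, α.OccSign τ v ρ := by
  cases σ
  · induction l using bigOr.induct with
    | case1 => exact h.elim
    | case2 α => exact ⟨α, by simp, h⟩
    | case3 α β l ih =>
      rcases h with h | h
      · exact ⟨α, by simp, h⟩
      · obtain ⟨γ, hγ, h⟩ := ih h
        exact ⟨γ, List.mem_cons_of_mem _ hγ, h⟩
  · induction l using bigAnd.induct with
    | case1 => exact h.elim
    | case2 α => exact ⟨α, by simp, h⟩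
    | case3 α β l ih =>
      rcases h with h | h
      · exact ⟨α, by simp, h⟩
      · obtain ⟨γ, hγ, h⟩ := ih h
        exact ⟨γ, List.mem_cons_of_mem _ hγ, h⟩

theorem prePrim_bigOp {σ τ : Pol} {l : List (STm L)} (h : ∀ α ∈ l, α.PrePrim τ) :
    (bigOp σ l).PrePrim τ := by
  cases σ
  · induction l using bigOr.induct with
    | case1 => trivial
    | case2 α => exact h α (by simp)
    | case3 α β l ih => exact ⟨h α (by simp), ih fun γ hγ => h γ (List.mem_cons_of_mem _ hγ)⟩
  · induction l using bigAnd.induct with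
    | case1 => trivial
    | case2 α => exact h α (by simp)
    | case3 α β l ih => exact ⟨h α (by simp), ih fun γ hγ => h γ (List.mem_cons_of_mem _ hγ)⟩

theorem occurs_bigOp {σ : Pol} {l : List (STm L)} {v : Var} (h : (bigOp σ l).Occurs v) :
    ∃ α ∈ l, α.Occurs v :=
  let ⟨_, h⟩ := h
  let ⟨α, hα, h⟩ := occSign_bigOp h
  ⟨α, hα, h.occurs⟩

theorem regular_bigOp {σ τ : Pol} {l : List (STm L)} (h : ∀ α ∈ l, Regular ε τ α) :
    Regular ε τ (bigOp σ l) where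
  prePrim := prePrim_bigOp fun α hα => (h α hα).prePrim
  uniform v ρ hv :=
    let ⟨α, hα, hv⟩ := occSign_bigOp hv
    (h α hα).uniform v ρ hv
  not_zero ρ hρ :=
    let ⟨α, hα, hρ⟩ := occurs_bigOp hρ
    (h α hα).not_zero ρ hρ

theorem occurs_substVar {X α : STm L} {p v : Var} (h : (X.substVar p α).Occurs v) :
    (v ≠ p ∧ X.Occurs v) ∨ (X.Occurs p ∧ α.Occurs v) := by
  obtain ⟨τ, h⟩ := h
  rcases h.of_substVar with h | ⟨ρ, h1, h2⟩
  exacts [.inl ⟨h.1, h.2.occurs⟩, .inr ⟨h1.occurs, h2.occurs⟩]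

/-- Uniformity gives every leaf `p` the sign `ε p`, which is the sign for which the bound of `p` is
regular. -/
theorem Regular.substVar {δ : Pol} {X α : STm L} {p : ℕ} (hX : Regular ε δ X)
    (hα : Regular ε (ε p) α) : Regular ε δ (X.substVar (.prop p) α) where
  prePrim := hX.prePrim.substVar (hX.uniform (.prop p)) hα.prePrim
  uniform v τ hv := by
    rcases hv.of_substVar with hv | ⟨ρ, h1, h2⟩
    · exact hX.uniform v τ hv.2
    · obtain rfl := hX.uniform _ ρ h1
      exact hα.uniform v τ h2
  not_zero ρ hρ := by
    rcases occurs_substVar hρ with h | h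
    exacts [hX.not_zero ρ h.2, hα.not_zero ρ h.2]

/-- All premises in play carry `p` only on the side that is signed `σ`, and there with sign `δ`.
Expressed by signs, the polarity conditions of both Ackermann rules become the same. -/
theorem RedStep.ackermann {δ : Pol} {p : ℕ} {αs : List (STm L)} {Γ : List (SIneq L)} {c : SIneq L}
    (hα : ∀ α ∈ αs, ¬ α.Occurs (.prop p))
    (hΓ : ∀ e ∈ Γ, ∃ σ a b, e = pineq σ a b ∧ (∀ τ, a.OccSign σ (.prop p) τ → τ = δ) ∧
      ¬ b.Occurs (.prop p))
    (hc : ¬ c.Occurs (.prop p)) :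
    RedStep ⟨αs.map (fun α => pineq δ α (.var (.prop p))) ++ Γ, c⟩
      ⟨Γ.map (Ineq.substVar (.prop p) (bigOp δ αs)), c⟩ := by
  have key : ∀ e ∈ Γ, (∀ τ, e.lhs.OccSign .pos (.prop p) τ → τ = δ) ∧
      ∀ τ, e.rhs.OccSign .pos (.prop p) τ → τ = δ.flip := by
    intro e he
    obtain ⟨σ, a, b, rfl, h1, h2⟩ := hΓ e he
    cases σ with
    | pos => exact ⟨h1, fun τ h => (h2 ⟨τ, h⟩).elim⟩
    | neg =>
      refine ⟨fun τ h => (h2 ⟨τ, h⟩).elim, fun τ h => ?_⟩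
      rw [← h1 τ.flip ((Tm.occSign_flip a .pos _ _).2 (by rw [Pol.flip_flip]; exact h)), Pol.flip_flip]
  cases δ
  exacts [.ackermann_right hα key hc, .ackermann_left hα key hc]

theorem substVar_pineq (p : Var) (α : STm L) (σ : Pol) (a b : STm L) :
    (pineq σ a b).substVar p α = pineq σ (a.substVar p α) (b.substVar p α) := by
  cases σ <;> rfl

theorem not_occurs_apv_prop {ρ : Pol} {k p : ℕ} : ¬ (Tm.var (apv ρ k) : STm L).Occurs (.prop p) := by
  rintro ⟨_, h, -⟩
  exact apv_ne_prop h

/-- Elimination of all variables by the Ackermann rules. -/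
theorem exists_eliminate (hirr : ∀ p, ¬ Ω p p) (htrans : ∀ p q r, Ω p q → Ω q r → Ω p r)
    {σ : Pol} {h : STm L} (hh : ∀ p, ¬ h.Occurs (.prop p)) {c : SIneq L}
    (hc : ∀ p, ¬ c.Occurs (.prop p)) (P : Finset ℕ) :
    ∀ (t : STm L) (l : List (STm L × ℕ)), Regular ε σ t → (∀ x ∈ l, Solution Ω ε x) →
      (∀ p, t.Occurs (.prop p) → p ∈ P) →
      (∀ x ∈ l, x.2 ∈ P ∧ ∀ p, x.1.Occurs (.prop p) → p ∈ P) →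
      ∃ t', Regular ε σ t' ∧ (∀ p, ¬ t'.Occurs (.prop p)) ∧
        ReflTransGen RedStep
          ⟨pineq σ (.var (apv σ 0)) h :: pineq σ t (.var (apv σ.flip 0)) ::
            l.map (solvedPremise ε), c⟩
          ⟨[pineq σ (.var (apv σ 0)) h, pineq σ t' (.var (apv σ.flip 0))], c⟩ := by
  induction P using Finset.induction_on with
  | empty =>
    intro t l ht _ htP hlP
    obtain rfl : l = [] := List.eq_nil_iff_forall_not_mem.2 fun x hx => by simpa using (hlP x hx).1
    exact ⟨t, ht, fun p hp => by simpa using htP p hp, .refl⟩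
  | insert p P _ ih =>
    intro t l ht hl htP hlP
    -- The bounds of `p`, to be joined (or met) by the Ackermann rule. The list may be empty, and
    -- then a constant is substituted; this is why regularity tolerates constants anywhere.
    set αs := (l.filter fun x => x.2 = p).map Prod.fst
    set rest := l.filter fun x => x.2 ≠ p
    have hαs : ∀ α ∈ αs, Regular ε (ε p) α ∧ (∀ q, α.Occurs (.prop q) → Ω q p ∧ q ∈ P) := by
      intro α hα
      obtain ⟨⟨α, q⟩, hx, rfl⟩ := List.mem_map.1 hα
      obtain ⟨hxl, hq⟩ := List.mem_filter.1 hx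
      obtain rfl : q = p := by simpa using hq
      refine ⟨(hl _ hxl).1, fun r hr => ⟨(hl _ hxl).2 r hr, ?_⟩⟩
      refine (Finset.mem_insert.1 ((hlP _ hxl).2 r hr)).resolve_left ?_
      -- Irreflexivity: `p` does not occur in its own bounds, which is also the side condition of
      -- the Ackermann rule.
      rintro rfl
      exact hirr _ ((hl _ hxl).2 _ hr)
    have hrest : ∀ x ∈ rest, x ∈ l ∧ x.2 ≠ p := fun x hx => by
      simpa using List.mem_filter.1 hx
    set α := bigOp (ε p) αs
    have hα : Regular ε (ε p) α := regular_bigOp fun β hβ => (hαs β hβ).1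
    have hα' : ∀ q, α.Occurs (.prop q) → Ω q p ∧ q ∈ P := fun q hq =>
      let ⟨β, hβ, hq⟩ := occurs_bigOp hq
      (hαs β hβ).2 q hq
    have mem_of_subst : ∀ X : STm L, (∀ q, X.Occurs (.prop q) → q ∈ insert p P) →
        ∀ q, (X.substVar (.prop p) α).Occurs (.prop q) → q ∈ P := by
      intro X hX q hq
      rcases occurs_substVar hq with ⟨h1, h2⟩ | ⟨-, h2⟩
      · exact (Finset.mem_insert.1 (hX q h2)).resolve_left fun h => h1 (by rw [h])
      · exact (hα' q h2).2
    obtain ⟨t', h1, h2, h3⟩ := ih (t.substVar (.prop p) α)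
      (rest.map fun x => (x.1.substVar (.prop p) α, x.2)) (ht.substVar hα) (by
        intro x hx
        obtain ⟨y, hy, rfl⟩ := List.mem_map.1 hx
        refine ⟨(hl y (hrest y hy).1).1.substVar hα, fun q hq => ?_⟩
        rcases occurs_substVar hq with h | h
        · exact (hl y (hrest y hy).1).2 q h.2
        -- A variable entering through the bound of `p` is below `p`, which is below `y.2`.
        -- Transitivity preserves the invariant, so the order of elimination is immaterial.
        · exact htrans q p y.2 (hα' q h.2).1 ((hl y (hrest y hy).1).2 p h.1))
      (mem_of_subst t htP) (by
        intro x hx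
        obtain ⟨y, hy, rfl⟩ := List.mem_map.1 hx
        have := hlP y (hrest y hy).1
        exact ⟨(Finset.mem_insert.1 this.1).resolve_left (hrest y hy).2,
          mem_of_subst y.1 this.2⟩)
    refine ⟨t', h1, h2, .head (.rearrange (Δ := αs.map (fun β => pineq (ε p) β (.var (.prop p))) ++
      (pineq σ (.var (apv σ 0)) h :: pineq σ t (.var (apv σ.flip 0)) ::
        rest.map (solvedPremise ε))) fun e => ?_) (.head (.ackermann ?_ ?_ (hc p)) ?_)⟩
    · have : e ∈ l.map (solvedPremise ε) ↔ e ∈ αs.map (fun β => pineq (ε p) β (.var (.prop p))) ∨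
          e ∈ rest.map (solvedPremise ε) := by
        simp only [List.mem_map, αs, rest, List.mem_filter, decide_eq_true_eq]
        constructor
        · rintro ⟨⟨X, q⟩, hx, rfl⟩
          by_cases hq : q = p
          · subst hq
            exact .inl ⟨X, ⟨(X, q), ⟨hx, rfl⟩, rfl⟩, rfl⟩
          · exact .inr ⟨(X, q), ⟨hx, by simpa using hq⟩, rfl⟩
        · rintro (⟨_, ⟨⟨X, q⟩, ⟨hx, rfl⟩, rfl⟩, rfl⟩ | ⟨x, ⟨hx, -⟩, rfl⟩)
          · exact ⟨(X, q), hx, rfl⟩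
          · exact ⟨x, hx, rfl⟩
      simp only [List.mem_cons, List.mem_append, this]
      tauto
    · exact fun β hβ hp => hirr p ((hαs β hβ).2 p hp).1
    · intro e he
      rcases List.mem_cons.1 he with rfl | he
      · exact ⟨σ, _, _, rfl, fun τ hτ => (not_occurs_apv_prop hτ.occurs).elim, hh p⟩
      rcases List.mem_cons.1 he with rfl | he
      · exact ⟨σ, _, _, rfl, ht.uniform (.prop p), not_occurs_apv_prop⟩
      · obtain ⟨y, hy, rfl⟩ := List.mem_map.1 he
        refine ⟨_, _, _, rfl, (hl y (hrest y hy).1).1.uniform (.prop p), ?_⟩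
        rintro ⟨_, h, -⟩
        exact (hrest y hy).2 (Var.prop.inj h)
    · convert h3 using 2
      simp only [List.map_cons, List.map_map, substVar_pineq,
        Tm.substVar_of_not_occurs _ (not_occurs_apv_prop), Tm.substVar_of_not_occurs _ (hh p)]
      congr 2
      refine List.map_congr_left fun y hy => ?_
      have : ¬ (Tm.var (.prop y.2) : STm L).Occurs (.prop p) := by
        rintro ⟨_, h, -⟩
        exact (hrest y hy).2 (Var.prop.inj h)
      simp [solvedPremise, substVar_pineq, Tm.substVar_of_not_occurs _ this, α]

end ALBA

/-- Supplies the finite set of variables on which the elimination inducts. -/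
theorem Tm.finite_occurs {L : DLESig} {V : Type} (s : Tm L V) : {v | s.Occurs v}.Finite := by
  suffices ∀ σ, {v | ∃ τ, s.OccSign σ v τ}.Finite from this .pos
  induction s with
  | var w =>
    refine fun σ => (Set.finite_singleton w).subset ?_
    rintro v ⟨_, h, -⟩
    exact h.symm
  | top => exact fun σ => Set.finite_empty.subset fun v ⟨_, h⟩ => h
  | bot => exact fun σ => Set.finite_empty.subset fun v ⟨_, h⟩ => h
  | and s t hs ht =>
    exact fun σ => ((hs σ).union (ht σ)).subset fun v ⟨τ, h⟩ => h.imp (⟨τ, ·⟩) (⟨τ, ·⟩)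
  | or s t hs ht =>
    exact fun σ => ((hs σ).union (ht σ)).subset fun v ⟨τ, h⟩ => h.imp (⟨τ, ·⟩) (⟨τ, ·⟩)
  | fc f a ih =>
    exact fun σ => (Set.finite_iUnion fun i => ih i (σ.mul (L.otF f i))).subset
      fun v ⟨τ, i, h⟩ => Set.mem_iUnion.2 ⟨i, τ, h⟩
  | gc g a ih =>
    exact fun σ => (Set.finite_iUnion fun i => ih i (σ.mul (L.otG g i))).subset
      fun v ⟨τ, i, h⟩ => Set.mem_iUnion.2 ⟨i, τ, h⟩

namespace ALBA

open Relation

variable {L : DLESig} {Ω : ℕ → ℕ → Prop} {ε : ℕ → Pol}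

/-! ### Reduction of a definite inequality -/

theorem CritPIA.prop_of_occSign {σ : Pol} {s : STm L} (h : CritPIA Ω ε σ s) :
    ∀ {v τ ρ}, s.OccSign ρ v τ → ∃ p, v = .prop p := by
  induction h with
  | var p => rintro v τ ρ ⟨rfl, -⟩; exact ⟨p, rfl⟩
  | and_pos _ _ ih1 ih2 => exact fun h => h.elim ih1 ih2
  | or_neg _ _ ih1 ih2 => exact fun h => h.elim ih1 ih2
  | and_left _ hs ih => exact fun h => h.elim ih fun h => hs.prop_of_occurs _ h.occurs
  | and_right _ hs ih => exact fun h => h.elim (fun h => hs.prop_of_occurs _ h.occurs) ih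
  | or_left _ hs ih => exact fun h => h.elim ih fun h => hs.prop_of_occurs _ h.occurs
  | or_right _ hs ih => exact fun h => h.elim (fun h => hs.prop_of_occurs _ h.occurs) ih
  | fc f a i _ hs ih =>
    rintro v τ ρ ⟨j, h⟩
    by_cases hj : j = i
    · subst hj; exact ih h
    · exact (hs j hj).prop_of_occurs _ h.occurs
  | gc g a i _ hs ih =>
    rintro v τ ρ ⟨j, h⟩
    by_cases hj : j = i
    · subst hj; exact ih h
    · exact (hs j hj).prop_of_occurs _ h.occurs

theorem Definite.prop_of_occSign {σ : Pol} {s : STm L} (h : Definite Ω ε σ s) :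
    ∀ {v τ ρ}, s.OccSign ρ v τ → ∃ p, v = .prop p := by
  induction h with
  | pia h => exact fun h' => h.prop_of_occSign h'
  | const σ => exact fun h => (not_occSign_topPow h).elim
  | and _ _ ih1 ih2 => exact fun h => h.elim ih1 ih2
  | or _ _ ih1 ih2 => exact fun h => h.elim ih1 ih2
  | fc f a _ ih => exact fun ⟨i, h⟩ => ih i h
  | gc g a _ ih => exact fun ⟨i, h⟩ => ih i h

theorem Definite.prop_of_occurs {σ : Pol} {s : STm L} (h : Definite Ω ε σ s) {v : Var}
    (hv : s.Occurs v) : ∃ p, v = .prop p :=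
  let ⟨_, hv⟩ := hv
  h.prop_of_occSign hv

theorem redSteps_const {σ : Pol} {t t' u : STm L} (h : ReflTransGen (AtNode Const false .pos) t t')
    (Γ : List (SIneq L)) (c : SIneq L) :
    ReflTransGen RedStep ⟨pineq σ t u :: Γ, c⟩ ⟨pineq σ t' u :: Γ, c⟩ := by
  refine h.lift (fun t => QIneq.mk (pineq σ t u :: Γ) c) fun a b hab => ?_
  cases σ
  exacts [.const_left hab, .const_right hab]

theorem OutStep.pineq {σ : Pol} {n : ℕ} {s t : STm L} {Γ : List (SIneq L)}
    (hn : ¬ QIneq.Occurs ⟨Γ, ALBA.pineq σ s t⟩ (apv σ n)) :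
    OutStep ⟨ALBA.pineq σ (.var (apv σ n)) s :: Γ, ALBA.pineq σ (.var (apv σ n)) t⟩
      ⟨Γ, ALBA.pineq σ s t⟩ := by
  cases σ
  exacts [.nom hn, .conom hn]

/-- The conclusion `𝐢 ≤ 𝐦` of the first approximation. -/
theorem firstApprox_concl (σ : Pol) (e : SIneq L) :
    (firstApprox e 0 0).concl = pineq σ (.var (apv σ 0)) (.var (apv σ.flip 0)) := by
  cases σ <;> rfl

/-- The result of a reduction with head `s` and tail `t`: both are primitive and free of variables,
nominals occur positively and conominals negatively in the head, and also in the tail unless this is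
the conominal or nominal of the first approximation. -/
structure IsOutput (σ : Pol) (s t : STm L) : Prop where
  head_prim : s.IsPrim σ
  tail_prim : t.IsPrim σ
  head_scattered : s.Scattered
  head_uniform : Tm.Uniform (extPol fun _ => .pos) σ s
  tail_uniform : Tm.Uniform (extPol fun _ => .pos) σ t ∨
    (t = .var (apv σ.flip 0) ∧ ∀ ρ, ¬ s.Occurs (apv ρ 0))
  head_pure : ∀ p, ¬ s.Occurs (.prop p)
  tail_pure : ∀ p, ¬ t.Occurs (.prop p)

theorem IsOutput.pure {σ : Pol} {s t : STm L} (h : IsOutput σ s t) : (pineq σ s t).Pure :=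
  fun p hp => (occurs_pineq.1 hp).elim (h.head_pure p) (h.tail_pure p)

/-- Signs are fixed by kind, nominals positive and conominals negative, so the two sides agree. In
the exceptional case the tail is a symbol that does not occur in the head. -/
theorem IsOutput.sameOrderType {σ : Pol} {s t : STm L} (h : IsOutput σ s t) {v : Var} {τ τ' : Pol}
    (hs : s.OccSign .pos v τ) (ht : t.OccSign .pos v τ') : τ = τ' := by
  have conv : ∀ {u : STm L} {τ}, u.OccSign .pos v τ → u.OccSign σ v (σ.mul τ) := fun hu => by
    rwa [Tm.occSign_iff_pos, Pol.mul_self_mul]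
  rcases h.tail_uniform with hu | ⟨rfl, h0⟩
  · exact Pol.mul_left_cancel
      ((h.head_uniform v _ (conv hs)).trans (hu v _ (conv ht)).symm)
  · obtain ⟨rfl, -⟩ := ht
    exact (h0 _ hs.occurs).elim

theorem IsOutput.exists_uniform {σ : Pol} {s t : STm L} (h : IsOutput σ s t) :
    ∃ ε : Var → Pol, Tm.Uniform ε .pos t := by
  rcases h.tail_uniform with hu | ⟨rfl, -⟩
  · refine ⟨fun v => σ.mul (extPol (fun _ => .pos) v), fun v τ hv => ?_⟩
    change τ = σ.mul (extPol (fun _ => .pos) v)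
    rw [← hu v (σ.mul τ) (by rwa [Tm.occSign_iff_pos, Pol.mul_self_mul]), Pol.mul_self_mul]
  · exact ⟨fun _ => .pos, fun v τ hv => hv.2.symm⟩

theorem IsOutput.leftPrimitive {s t : STm L} (h : IsOutput .pos s t) :
    (pineq .pos s t).LeftPrimitive :=
  ⟨h.head_prim, h.tail_prim, h.head_scattered, fun _ _ _ => h.sameOrderType, h.exists_uniform⟩

theorem IsOutput.rightPrimitive {s t : STm L} (h : IsOutput .neg s t) :
    (pineq .neg s t).RightPrimitive :=
  ⟨h.tail_prim, h.head_prim, h.head_scattered, fun _ _ _ h1 h2 => (h.sameOrderType h2 h1).symm,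
    h.exists_uniform⟩

/-- The output stage for the premises `𝐢 ≤ h` and `t ≤ 𝐦`, where `t` is primitive up to constants. -/
theorem exists_output {σ : Pol} {h t : STm L} (hprim : h.IsPrim σ) (hsc : h.Scattered)
    (hnamed : ∀ v ρ, h.OccSign σ v ρ → ∃ k, k ≠ 0 ∧ v = apv ρ k) (ht : Regular ε σ t)
    (htp : ∀ p, ¬ t.Occurs (.prop p)) :
    ∃ q t', ReflTransGen RedStep ⟨[pineq σ (.var (apv σ 0)) h, pineq σ t (.var (apv σ.flip 0))],
        pineq σ (.var (apv σ 0)) (.var (apv σ.flip 0))⟩ q ∧ q.Pure ∧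
      ReflTransGen OutStep q ⟨[], pineq σ h t'⟩ ∧ IsOutput σ h t' := by
  have h0 : ∀ ρ, ¬ h.Occurs (apv ρ 0) := by
    intro ρ hρ
    obtain ⟨τ, hρ⟩ := (Tm.occurs_iff h σ _).1 hρ
    obtain ⟨k, hk, hv⟩ := hnamed _ _ hρ
    exact hk (apv_inj.1 hv).2.symm
  have hp : ∀ p, ¬ h.Occurs (.prop p) := by
    intro p hp
    obtain ⟨τ, hp⟩ := (Tm.occurs_iff h σ _).1 hp
    obtain ⟨k, -, hv⟩ := hnamed _ _ hp
    exact apv_ne_prop hv.symm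
  have hu : Tm.Uniform (extPol fun _ => .pos) σ h := by
    intro v ρ hv
    obtain ⟨k, -, rfl⟩ := hnamed v ρ hv
    cases ρ <;> rfl
  have hvar : ∀ {ρ τ : Pol} {k : ℕ}, (Tm.var (apv τ k) : STm L).Occurs (apv ρ 0) → τ = ρ := by
    rintro ρ τ k ⟨_, h, -⟩
    exact (apv_inj.1 h).1
  obtain ⟨t', hr, hn, ho⟩ := exists_const_normal ht.prePrim
  have hocc : ∀ {v}, t'.Occurs v → t.Occurs v := fun ⟨τ, hτ⟩ => (ho _ _ _ hτ).occurs
  have steps : ReflTransGen RedStep ⟨[pineq σ (.var (apv σ 0)) h, pineq σ t (.var (apv σ.flip 0))],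
      pineq σ (.var (apv σ 0)) (.var (apv σ.flip 0))⟩
      ⟨[pineq σ t' (.var (apv σ.flip 0)), pineq σ (.var (apv σ 0)) h],
      pineq σ (.var (apv σ 0)) (.var (apv σ.flip 0))⟩ :=
    .head (.rearrange fun e => by simp [or_comm]) (redSteps_const (hr false .pos) _ _)
  rcases hn with rfl | hn
  -- The tail collapsed to `⊥` (`⊤` for `σ = neg`), which is not primitive for `σ`. Its premise is
  -- removed as a tautology, and the symbol `𝐦` (`𝐢` for `σ = neg`) of the first approximation stays
  -- behind as the tail.
  · have hO : IsOutput σ h (.var (apv σ.flip 0)) :=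
      ⟨hprim, trivial, hsc, hu, .inr ⟨rfl, h0⟩, hp, fun p => not_occurs_apv_prop⟩
    refine ⟨_, _, steps.tail (.taut ?_), ?_, .single (.pineq ?_), hO⟩
    · cases σ
      exacts [.bot _, .top _]
    · rintro p (⟨e, he, hpe⟩ | hpc)
      · rw [List.mem_singleton] at he
        subst he
        exact (occurs_pineq.1 hpe).elim not_occurs_apv_prop (hp p)
      · exact (occurs_pineq.1 hpc).elim not_occurs_apv_prop not_occurs_apv_prop
    · rintro (⟨e, he, -⟩ | hc)
      · simp at he
      · rcases occurs_pineq.1 hc with hc | hc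
        · exact h0 _ hc
        · exact σ.ne_flip (hvar hc).symm
  · have htu : Tm.Uniform (extPol fun _ => .pos) σ t' := by
      intro v ρ hv
      have h1 := ht.uniform v ρ (ho _ _ _ hv)
      cases v with
      | nom k => exact h1
      | conom k => exact h1
      | prop p => exact (htp p (hocc hv.occurs)).elim
    have hO : IsOutput σ h t' :=
      ⟨hprim, hn, hsc, hu, .inl htu, hp, fun p hp' => htp p (hocc hp')⟩
    have ht0 : ∀ ρ, ¬ t'.Occurs (apv ρ 0) := fun ρ h => ht.not_zero ρ (hocc h)
    refine ⟨_, t', steps, ?_, ?_, hO⟩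
    · rintro p (⟨e, he, hpe⟩ | hpc)
      · rcases List.mem_pair.1 he with rfl | rfl
        · exact (occurs_pineq.1 hpe).elim (hO.tail_pure p) not_occurs_apv_prop
        · exact (occurs_pineq.1 hpe).elim not_occurs_apv_prop (hp p)
      · exact (occurs_pineq.1 hpc).elim not_occurs_apv_prop not_occurs_apv_prop
    -- For `σ = pos`, the conclusion `𝐢 ≤ 𝐦` first becomes `𝐢 ≤ t'`, after which eliminating `𝐢`
    -- gives `h ≤ t'`.
    · have h1 := OutStep.pineq (σ := σ.flip) (n := 0) (s := t') (t := .var (apv σ 0))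
        (Γ := [pineq σ (.var (apv σ 0)) h]) (by
          rintro (⟨e, he, hc⟩ | hc)
          · rw [List.mem_singleton] at he
            subst he
            rcases occurs_pineq.1 hc with hc | hc
            · exact σ.ne_flip (hvar hc)
            · exact h0 _ hc
          · rcases occurs_pineq.1 hc with hc | hc
            · exact ht0 _ hc
            · exact σ.ne_flip (hvar hc))
      simp only [pineq_flip] at h1
      refine .head h1 (.single (.pineq ?_))
      rintro (⟨e, he, -⟩ | hc)
      · simp at he
      · exact (occurs_pineq.1 hc).elim (h0 _) (ht0 _)

/-- Reduction of an inequality with a definite head. -/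
theorem Definite.exists_reduction (hirr : ∀ p, ¬ Ω p p)
    (htrans : ∀ p q r, Ω p q → Ω q r → Ω p r) {σ : Pol} {d t : STm L} (hd : Definite Ω ε σ d)
    (ht : Regular ε σ t) (htp : ∀ v, t.Occurs v → ∃ p, v = .prop p) :
    ∃ q h t', ReflTransGen RedStep (firstApprox (pineq σ d t) 0 0) q ∧ q.Pure ∧
      ReflTransGen OutStep q ⟨[], pineq σ h t'⟩ ∧ IsOutput σ h t' := by
  obtain ⟨h, n', Δ, happ, -, hprim, hnamed, hsc, hΔ⟩ :=
    -- Index `0` is reserved for the nominal and the conominal of the first approximation, so fresh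
    -- symbols start at `1`.
    hd.approximable 1 [pineq σ t (.var (apv σ.flip 0))]
  have hnamed' : ∀ v ρ, h.OccSign σ v ρ → ∃ k, k ≠ 0 ∧ v = apv ρ k := fun v ρ hv =>
    let ⟨k, hk, _, hv⟩ := hnamed v ρ hv
    ⟨k, by omega, hv⟩
  have hh : ∀ p, ¬ h.Occurs (.prop p) := by
    intro p hp
    obtain ⟨τ, hp⟩ := (Tm.occurs_iff h σ _).1 hp
    obtain ⟨k, -, hv⟩ := hnamed' _ _ hp
    exact apv_ne_prop hv.symm
  obtain ⟨l, hl, hsolve⟩ := exists_solve_premises Δ hΔ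
  have hfin : ({p | t.Occurs (.prop p)} ∪
      ⋃ x ∈ {x | x ∈ l}, ({x.2} ∪ {p | x.1.Occurs (.prop p)})).Finite := by
    have hpre : ∀ s : STm L, {p | s.Occurs (.prop p)}.Finite := fun s =>
      Set.Finite.preimage (f := Var.prop) (fun p _ q _ hpq => Var.prop.inj hpq) s.finite_occurs
    exact (hpre t).union ((List.finite_toSet l).biUnion fun x _ =>
      (Set.finite_singleton x.2).union (hpre x.1))
  set c := (firstApprox (pineq σ d t) 0 0).concl with hc
  have hcp : ∀ p, ¬ c.Occurs (.prop p) := by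
    intro p hp
    rw [hc, firstApprox_concl σ] at hp
    exact (occurs_pineq.1 hp).elim not_occurs_apv_prop not_occurs_apv_prop
  obtain ⟨t', ht', htp', helim⟩ := exists_eliminate (c := c) hirr htrans hh hcp hfin.toFinset t l ht
    hl (fun p hp => by simp [hp]) (fun x hx => by
      constructor
      · simp only [Set.Finite.mem_toFinset, Set.mem_union, Set.mem_iUnion]
        exact .inr ⟨x, hx, .inl rfl⟩
      · intro p hp
        simp only [Set.Finite.mem_toFinset, Set.mem_union, Set.mem_iUnion]
        exact .inr ⟨x, hx, .inr hp⟩)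
  obtain ⟨q, t'', hred, hpure, hout, hO⟩ := exists_output hprim hsc hnamed' ht' htp'
  refine ⟨q, h, t'', ?_, hpure, hout, hO⟩
  rw [← firstApprox_concl σ (pineq σ d t), ← hc] at hred
  -- For `σ = neg` the first approximation lists the premise of the head second.
  refine .head (b := ⟨[pineq σ (.var (apv σ 0)) d, pineq σ t (.var (apv σ.flip 0))], c⟩)
    (.rearrange fun e => ?_) ?_
  · cases σ
    · rfl
    · simp [pineq, apv, or_comm]
  refine (redSteps_of_approxSteps (c := c) happ ?_).trans ?_
  · have h0 : ∀ {ρ τ : Pol} {k}, (Tm.var (apv τ 0) : STm L).Occurs (apv ρ k) → k < 1 := by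
      rintro ρ τ k ⟨_, h, -⟩
      have := (apv_inj.1 h).2
      omega
    have hprop : ∀ {s : STm L} {ρ k}, (∀ v, s.Occurs v → ∃ p, v = .prop p) →
        s.Occurs (apv ρ k) → k < 1 := fun h1 h2 =>
      let ⟨_, h⟩ := h1 _ h2
      (apv_ne_prop h).elim
    rintro ρ k (⟨e, he, hk⟩ | hk)
    · rcases List.mem_pair.1 he with rfl | rfl
      · exact (occurs_pineq.1 hk).elim h0 (hprop fun v hv => hd.prop_of_occurs hv)
      · exact (occurs_pineq.1 hk).elim (hprop htp) h0
    · change c.Occurs _ at hk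
      rw [hc, firstApprox_concl σ] at hk
      exact (occurs_pineq.1 hk).elim h0 h0
  refine .head (.rearrange (Δ := Δ ++ [pineq σ (.var (apv σ 0)) h,
    pineq σ t (.var (apv σ.flip 0))]) fun e => ?_) ((hsolve _ c).trans ?_)
  · simp only [List.mem_cons, List.mem_append]
    tauto
  refine .head (.rearrange fun e => ?_) (helim.trans hred)
  simp only [List.mem_cons, List.mem_append, List.not_mem_nil, or_false]
  tauto

/-- Reduction of an inequality whose head is a restricted analytic inductive tree and whose tail is
uniform and primitive. -/
theorem exists_reduction (hirr : ∀ p, ¬ Ω p p) (htrans : ∀ p q r, Ω p q → Ω q r → Ω p r)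
    {σ : Pol} {s t : Tm L ℕ} {e : Ineq L ℕ} (he : e.emb = pineq σ s.emb t.emb)
    (hs : s.RestrictedAnalytic Ω ε σ) (htu : t.Uniform (fun v => (ε v).flip) σ.flip)
    (htp : t.IsPrim σ) :
    ∃ E : List (SIneq L), Reduction e E ∧
      (∀ e' ∈ E, ∃ h t', e' = pineq σ h t' ∧ IsOutput σ h t') ∧
      ∀ (A : Type*) [CompletelyDistribLattice A] (I : Interp L A), IsPerfectDLE I →
        (e.Valid I ↔ ∀ e' ∈ E, e'.SValid I) := by
  have hprop : ∀ v, t.emb.Occurs v → ∃ p, v = .prop p := fun v hv =>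
    (Tm.exists_prop_of_occurs_emb hv).imp fun _ => And.left
  have ht : Regular ε σ t.emb := by
    refine ⟨htp.prePrim.emb, fun v ρ hv => ?_, fun ρ hρ => ?_⟩
    · obtain ⟨p, rfl, hv'⟩ := (Tm.occSign_emb _ _ _ _).1 hv
      exact Pol.flip_injective (htu p _ ((Tm.occSign_flip t σ p _).2 (by rwa [Pol.flip_flip])))
    · obtain ⟨p, hp⟩ := hprop _ hρ
      exact apv_ne_prop hp
  obtain ⟨ds, hds, hpre⟩ := hs.skel.exists_preprocess t.emb
  rw [← he] at hpre
  -- Arbitrary values for `choose!` outside the list `ds`.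
  have : Inhabited (STm L) := ⟨.top⟩
  have : Inhabited (QIneq L) := ⟨⟨[], ⟨.top, .top⟩⟩⟩
  choose! q h t' hred hpure hout hO using fun d hd =>
    (hds d hd).exists_reduction hirr htrans ht hprop
  refine ⟨ds.map fun d => pineq σ (h d) (t' d), ⟨_, hpre, ?_⟩, ?_, ?_⟩
  · rw [List.forall₂_map_left_iff, List.forall₂_map_right_iff, List.forall₂_same]
    exact fun d hd => ⟨0, 0, q d, hred d hd, hpure d hd, hout d hd⟩
  · simp only [List.forall_mem_map]
    exact fun d hd => ⟨_, _, rfl, hO d hd⟩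
  · intro A _ I hI
    have hA : JoinGenerated A := hI.join_gen
    rw [← sValid_emb hA, ← List.forall_mem_singleton (p := fun e : SIneq L => e.SValid I),
      ← Preprocess.sValid hI.normal hpre]
    simp only [List.forall_mem_map]
    -- Soundness needs the nominal and the conominal of index `0` to be absent from the inequality.
    -- Head and tail contain proposition variables only.
    refine forall₂_congr fun d hd => (sValid_of_steps hI.normal hA ?_ ?_ (hred d hd)
      (hout d hd)).symm
    · intro h
      rcases occurs_pineq.1 h with h | h
      · obtain ⟨p, hp⟩ := (hds d hd).prop_of_occurs h
        cases hp
      · obtain ⟨p, hp⟩ := hprop _ h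
        cases hp
    · intro h
      rcases occurs_pineq.1 h with h | h
      · obtain ⟨p, hp⟩ := (hds d hd).prop_of_occurs h
        cases hp
      · obtain ⟨p, hp⟩ := hprop _ h
        cases hp

end ALBA

/-! ### The main theorem, from the two signs of the polarised reduction -/

theorem mainTheorem7 (L : DLESig) (e : Ineq L ℕ) :
    (e.IsVeryRestrictedLeft →
      ∃ E : List (SIneq L), ALBA.Reduction e E ∧
        (∀ e' ∈ E, e'.Pure ∧ e'.LeftPrimitive) ∧
        ∀ (A : Type*) [CompletelyDistribLattice A] (I : Interp L A), IsPerfectDLE I →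
          (e.Valid I ↔ ∀ e' ∈ E, e'.SValid I)) ∧
    (e.IsVeryRestrictedRight →
      ∃ E : List (SIneq L), ALBA.Reduction e E ∧
        (∀ e' ∈ E, e'.Pure ∧ e'.RightPrimitive) ∧
        ∀ (A : Type*) [CompletelyDistribLattice A] (I : Interp L A), IsPerfectDLE I →
          (e.Valid I ↔ ∀ e' ∈ E, e'.SValid I)) := by
  constructor
  · rintro ⟨Ω, ε, hirr, htrans, he⟩
    obtain ⟨E, h1, h2, h3⟩ := ALBA.exists_reduction hirr htrans (σ := .pos) (e := e) rfl he.head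
      he.tail_uniform he.tail_prim
    refine ⟨E, h1, fun e' he' => ?_, h3⟩
    obtain ⟨h, t, rfl, hO⟩ := h2 e' he'
    exact ⟨hO.pure, hO.leftPrimitive⟩
  · rintro ⟨Ω, ε, hirr, htrans, he⟩
    obtain ⟨E, h1, h2, h3⟩ := ALBA.exists_reduction hirr htrans (σ := .neg) (e := e) rfl he.head
      he.tail_uniform he.tail_prim
    refine ⟨E, h1, fun e' he' => ?_, h3⟩
    obtain ⟨h, t, rfl, hO⟩ := h2 e' he'
    exact ⟨hO.pure, hO.rightPrimitive⟩
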